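/- Let $\pi$ be a group of type $HF^\infty$, and let $X_\bullet$ be a simplicial set with $X_0=*$, with finitely many simplices in each dimension and with $|X_\bullet|\simeq B\pi$. Let $\Gamma_\bullet=GX_\bullet$ be its Kan loop group: $\Gamma_n$ is the free group on the finite set $X_{n+1}\setminus s_0(X_n)$, with $\partial_0\tau(x)=\tau(d_0x)^{-1}\tau(d_1x)$, $\partial_i\tau(x)=\tau(d_{i+1}x)$ for $i>0$, $s_i\tau(x)=\tau(s_{i+1}x)$, where $\tau(x)$ is the generator of $x$ (and $1$ if $x\in s_0(X_n)$). Let $L_n$ be the standard word length on $\Gamma_n$, let $\varepsilon:\Gamma_0\to\pi$ be the augmentation, identifying $\pi_0(\Gamma_\bullet)$ with $\pi$, and let $L(g)=\min\{L_0(w):\varepsilon(w)=g\}$ for $g\in\pi$. Put $\Gamma^n_{n+1}=\bigcap_{i=0}^{n}\ker(\partial_i:\Gamma_{n+1}\to\Gamma_n)$, $\Gamma^n_n=\bigcap_{i=0}^n\ker(\partial_i:\Gamma_n\to\Gamma_{n-1})$ for $n\ge1$, and $\Gamma^0_0=\partial_1(\Gamma^0_1)$. The $n$-th Dehn function $f_n:\mathbb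 N\to\mathbb N$ is the smallest function for which there is a map of sets $s:\Gamma^n_n\to\Gamma^n_{n+1}$ with $\partial_{n+1}\circ s=\mathrm{id}$ and $L_{n+1}(s(x))\le f_n(L_n(x))$ for all $x$. It is called polynomial if it is bounded above by a polynomial. A p.s. $\pi$-module is a $\mathbb Q[\pi]$-module $A$ with semi-norms $\eta_x$ indexed by a countable $\pi$-set $\Lambda$ such that (i) every finite positive integral combination of the $\eta_x$ is at most $C\eta_y$ for some constant $C$ and some $y\in\Lambda$, and (ii) there are constants $C,N$ such that for every $x'\in\Lambda$ there is $x\in\Lambda$ with $\eta_{gx'}(ha)\le C(1+L(h))^N\eta_{ghx}(a)$ for all $g,h\in\pi$, $a\in A$. Say that $A$ has orbits of polynomial growth if for every $a\in A$ there is $N$ such that for every $x\in\Lambda$ there is $C$ with $\eta_x(ga)\le C(1+L(g))^N$ for all $g\in\pi$. A cochain $c:\pi^k\to A$ is p-bounded if there is $N$ such that for every $x\in\Lambda$ there is $C$ with $\eta_{gx}(c(g_1,\dots,g_k))\le C\,(1+\sum_i L(g_i))^N(1+L(g))^N$ for all $g,g_1,\dots,g_k\in\pi$. The p-bounded cochains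 form a subcomplex of the inhomogeneous bar cochain complex; $PH^*(\pi;A)$ is its cohomology, and $PH^*(\pi;A)\to H^*(\pi;A)$ is induced by the inclusion. 1. If $f_m$ is polynomial for all $m\le n$, then $\Gamma_\bullet^+\to\pi$ is a resolution of type $P(n+1)$: $\pi_i(\Gamma_\bullet)=0$ for $i>0$, and the augmented simplicial set $\ker(\Gamma_\bullet^+\to\pi)$ admits a simplicial contraction (extra degeneracy) through dimension $n$ which is bounded by a polynomial in the word length in each degree. Moreover $PH^k(\pi;A)\to H^k(\pi;A)$ is an isomorphism for all $k\le n+2$ and every p.s. $\pi$-module $A$ with orbits of polynomial growth. 2. If $f_m$ is polynomial for all $m$, then $PH^k(\pi;A)\to H^k(\pi;A)$ is an isomorphism for all $k$ and every p.s. $\pi$-module $A$ with orbits of polynomial growth; that is, $\pi$ satisfies (PC1) for all such coefficients $A$ (in particular for $A=\mathbb Q$). -/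

import Mathlib

open CategoryTheory

noncomputable section

/-! ### Groups with word-length -/

/-- A word-length function on a group. -/
structure WordLength (G : Type) [Group G] where
  len : G → ℕ
  len_one : len 1 = 0
  len_inv : ∀ g, len g⁻¹ = len g
  len_mul : ∀ g h, len (g * h) ≤ len g + len h

/-- The standard word-length on a free group, with respect to its basis. -/
def freeLen {S : Type} (w : FreeGroup S) : ℕ :=
  letI := Classical.decEq S
  w.norm

/-- The word-length function induced on `G` by a surjection `ε` from a free group:
`L(g) = min { L(w) | ε w = g }`.  It is the standard word-length function of `G` with respect
to the images of the basis elements. -/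
def inducedLength {S G : Type} [Group G] (ε : FreeGroup S →* G)
    (hε : Function.Surjective ε) : WordLength G where
  len g := sInf (freeLen '' {w | ε w = g})
  len_one := by
    apply Nat.eq_zero_of_le_zero
    apply Nat.sInf_le
    exact ⟨1, by simp, by simp [freeLen]⟩
  len_inv g := by
    congr 1
    ext k
    constructor
    · rintro ⟨w, hw, rfl⟩
      refine ⟨w⁻¹, ?_, by simp [freeLen]⟩
      simp only [Set.mem_ofPred_eq] at hw ⊢
      rw [map_inv, hw, inv_inv]
    · rintro ⟨w, hw, rfl⟩
      refine ⟨w⁻¹, ?_, by simp [freeLen]⟩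
      simp only [Set.mem_ofPred_eq] at hw ⊢
      rw [map_inv, hw]
  len_mul g h := by
    have hne : ∀ a : G, (freeLen '' {w | ε w = a}).Nonempty := fun a =>
      Set.Nonempty.image freeLen (hε a)
    obtain ⟨u, hu, hu'⟩ := Nat.sInf_mem (hne g)
    obtain ⟨v, hv, hv'⟩ := Nat.sInf_mem (hne h)
    rw [← hu', ← hv']
    have huv : freeLen (u * v) ∈ freeLen '' {w | ε w = g * h} := by
      refine ⟨u * v, ?_, rfl⟩
      simp only [Set.mem_ofPred_eq] at hu hv ⊢
      rw [map_mul, hu, hv]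
    refine (Nat.sInf_le huv).trans ?_
    let _ := Classical.decEq S
    exact FreeGroup.norm_mul_le u v

/-- A function of natural numbers is of polynomial type if it is bounded above by a polynomial. -/
def IsPolynomialType (f : ℕ → ℕ) : Prop :=
  ∃ p : Polynomial ℝ, ∀ k, (f k : ℝ) ≤ p.eval (k : ℝ)

/-! ### p-semi-normed modules and p-bounded cohomology -/

/-- A p-semi-normed module over a group with word-length `(G, L)`: a `ℚ[G]`-module with a family
of semi-norms indexed by a countable `G`-set. -/
structure PSModule {G : Type} [Group G] (L : WordLength G) where
  /-- the underlying `ℚ[G]`-module -/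
  V : Rep.{0} ℚ G
  /-- the index set of the semi-norms -/
  Λ : Type
  [countable : Countable Λ]
  [action : MulAction G Λ]
  η : Λ → V → ℝ
  nonneg : ∀ x a, 0 ≤ η x a
  add_le : ∀ x a b, η x (a + b) ≤ η x a + η x b
  smul_le : ∀ x (q : ℚ) a, η x (q • a) ≤ |(q : ℝ)| * η x a
  directed : ∀ (k : ℕ) (x : Fin (k + 1) → Λ) (l : Fin (k + 1) → ℕ+),
    ∃ (C : ℝ) (y : Λ), ∀ a, ∑ i, (l i : ℝ) * η (x i) a ≤ C * η y a
  bounded_action : ∃ (C : ℝ) (n : ℕ), ∀ x' : Λ, ∃ x : Λ, ∀ (g h : G) (a : V),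
    η (g • x') (V.ρ h a) ≤ C * (1 + (L.len h : ℝ)) ^ n * η ((g * h) • x) a

attribute [instance] PSModule.countable PSModule.action

namespace PSModule

variable {G : Type} [Group G] {L : WordLength G} (M : PSModule L)

/-- Every orbit map `g ↦ g a` has polynomial growth. Equivalently, every `ℚ[G]`-linear map
`ℚ[G] → M` is p-bounded. -/
def HasPolynomialOrbits : Prop :=
  ∀ a : M.V, ∃ N : ℕ, ∀ x : M.Λ, ∃ C : ℝ, ∀ g : G,
    M.η x (M.V.ρ g a) ≤ C * (1 + (L.len g : ℝ)) ^ N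

/-- The total length `∑ L(γ i)` of a tuple; the weight of the bar generator
`(1, γ 0, …, γ (k-1))` is `1 + total L γ`. -/
def total (L : WordLength G) {k : ℕ} (γ : Fin k → G) : ℝ := ∑ i, (L.len (γ i) : ℝ)

/-- An inhomogeneous cochain `c` is p-bounded if the corresponding equivariant map on the bar
resolution is p-bounded on the weighted set of bar generators. The exponent is uniform in the
semi-norms and the constant depends only on the index `x`. -/
def IsPBounded {k : ℕ} (c : (Fin k → G) → M.V) : Prop :=
  ∃ N : ℕ, ∀ x : M.Λ, ∃ C : ℝ, ∀ (g : G) (γ : Fin k → G),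
    M.η (g • x) (c γ) ≤ C * (1 + total L γ) ^ N * (1 + (L.len g : ℝ)) ^ N

lemma total_nonneg {k : ℕ} (γ : Fin k → G) : 0 ≤ total L γ :=
  Finset.sum_nonneg fun _ _ => Nat.cast_nonneg _

lemma len_le_total {k : ℕ} (γ : Fin k → G) (i : Fin k) : (L.len (γ i) : ℝ) ≤ total L γ :=
  Finset.single_le_sum (f := fun i => (L.len (γ i) : ℝ)) (fun _ _ => Nat.cast_nonneg _)
    (Finset.mem_univ i)

lemma isPBounded_zero {k : ℕ} : M.IsPBounded (0 : (Fin k → G) → M.V) := by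
  refine ⟨0, fun x => ⟨0, fun g γ => ?_⟩⟩
  have := M.smul_le (g • x) 0 0
  simpa using this

/-- A bound with exponent `N` gives one with a nonnegative constant and any larger exponent. -/
lemma IsPBounded.weaken {k : ℕ} {c : (Fin k → G) → M.V} {N : ℕ} {x : M.Λ} {C : ℝ}
    (h : ∀ (g : G) (γ : Fin k → G),
      M.η (g • x) (c γ) ≤ C * (1 + total L γ) ^ N * (1 + (L.len g : ℝ)) ^ N)
    {N' : ℕ} (hN : N ≤ N') (g : G) (γ : Fin k → G) :
    M.η (g • x) (c γ) ≤ |C| * (1 + total L γ) ^ N' * (1 + (L.len g : ℝ)) ^ N' := by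
  have h1 : (1 : ℝ) ≤ 1 + total L γ := by linarith [total_nonneg (L := L) γ]
  have h2 : (1 : ℝ) ≤ 1 + (L.len g : ℝ) := by linarith [Nat.cast_nonneg (α := ℝ) (L.len g)]
  refine (h g γ).trans ?_
  gcongr
  · exact le_abs_self C

lemma IsPBounded.add {k : ℕ} {c d : (Fin k → G) → M.V} (hc : M.IsPBounded c)
    (hd : M.IsPBounded d) : M.IsPBounded (c + d) := by
  obtain ⟨N, hN⟩ := hc
  obtain ⟨N', hN'⟩ := hd
  refine ⟨max N N', fun x => ?_⟩
  obtain ⟨C, hC⟩ := hN x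
  obtain ⟨C', hC'⟩ := hN' x
  refine ⟨|C| + |C'|, fun g γ => ?_⟩
  have h1 := IsPBounded.weaken M hC (le_max_left N N') g γ
  have h2 := IsPBounded.weaken M hC' (le_max_right N N') g γ
  have h3 := M.add_le (g • x) (c γ) (d γ)
  simp only [Pi.add_apply, add_mul]
  linarith

lemma IsPBounded.smul {k : ℕ} {c : (Fin k → G) → M.V} (q : ℚ) (hc : M.IsPBounded c) :
    M.IsPBounded (q • c) := by
  obtain ⟨N, hN⟩ := hc
  refine ⟨N, fun x => ?_⟩
  obtain ⟨C, hC⟩ := hN x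
  refine ⟨|(q : ℝ)| * C, fun g γ => (M.smul_le _ q _).trans ?_⟩
  rw [mul_assoc, mul_assoc, ← mul_assoc C]
  exact mul_le_mul_of_nonneg_left (hC g γ) (abs_nonneg _)

lemma IsPBounded.sum {k : ℕ} {ι : Type} (s : Finset ι) (c : ι → (Fin k → G) → M.V)
    (hc : ∀ i ∈ s, M.IsPBounded (c i)) : M.IsPBounded (∑ i ∈ s, c i) :=
  Finset.sum_induction c M.IsPBounded (fun _ _ => IsPBounded.add M) M.isPBounded_zero hc

lemma total_contractNth_le {k : ℕ} (j : Fin (k + 1)) (γ : Fin (k + 1) → G) :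
    total L (Fin.contractNth j (· * ·) γ) ≤ 2 * k * total L γ := by
  have key : ∀ i : Fin k, (L.len (Fin.contractNth j (· * ·) γ i) : ℝ) ≤ 2 * total L γ := by
    intro i
    have ht := total_nonneg (L := L) γ
    have h1 := len_le_total (L := L) γ i.castSucc
    have h2 := len_le_total (L := L) γ i.succ
    have h3 : (L.len (γ i.castSucc * γ i.succ) : ℝ) ≤
        L.len (γ i.castSucc) + L.len (γ i.succ) := by exact_mod_cast L.len_mul _ _
    simp only [Fin.contractNth]
    split_ifs <;> linarith
  calc total L (Fin.contractNth j (· * ·) γ) ≤ ∑ _i : Fin k, 2 * total L γ :=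
        Finset.sum_le_sum fun i _ => key i
    _ = 2 * k * total L γ := by simp; ring

lemma IsPBounded.contract {k : ℕ} {c : (Fin k → G) → M.V} (hc : M.IsPBounded c)
    (j : Fin (k + 1)) : M.IsPBounded (fun γ => c (Fin.contractNth j (· * ·) γ)) := by
  obtain ⟨N, hN⟩ := hc
  refine ⟨N, fun x => ?_⟩
  obtain ⟨C, hC⟩ := hN x
  refine ⟨|C| * (1 + 2 * k) ^ N, fun g γ => ?_⟩
  refine (IsPBounded.weaken M hC le_rfl g _).trans ?_
  rw [mul_assoc |C| ((1 + 2 * (k : ℝ)) ^ N), ← mul_pow]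
  have ht := total_nonneg (L := L) γ
  have ht' := total_nonneg (L := L) (Fin.contractNth j (· * ·) γ)
  have h := total_contractNth_le (L := L) j γ
  have hk : (0 : ℝ) ≤ k := Nat.cast_nonneg k
  have : 1 + total L (Fin.contractNth j (· * ·) γ) ≤ (1 + 2 * k) * (1 + total L γ) := by
    nlinarith
  gcongr

lemma total_tail {k : ℕ} (γ : Fin (k + 1) → G) :
    total L γ = L.len (γ 0) + total L (fun i : Fin k => γ i.succ) :=
  Fin.sum_univ_succ _

lemma IsPBounded.act {k : ℕ} {c : (Fin k → G) → M.V} (hc : M.IsPBounded c) :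
    M.IsPBounded (fun γ : Fin (k + 1) → G => M.V.ρ (γ 0) (c fun i => γ i.succ)) := by
  obtain ⟨N, hN⟩ := hc
  obtain ⟨D, n, hD⟩ := M.bounded_action
  refine ⟨n + N + N, fun x' => ?_⟩
  obtain ⟨x, hx⟩ := hD x'
  obtain ⟨C, hC⟩ := hN x
  refine ⟨|D| * |C|, fun g γ => ?_⟩
  have ht := total_nonneg (L := L) fun i : Fin k => γ i.succ
  have htt := total_nonneg (L := L) γ
  have hl : (0 : ℝ) ≤ L.len (γ 0) := Nat.cast_nonneg _
  have hg : (0 : ℝ) ≤ L.len g := Nat.cast_nonneg _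
  have e := total_tail (L := L) γ
  have hm : (L.len (g * γ 0) : ℝ) ≤ L.len g + L.len (γ 0) := by exact_mod_cast L.len_mul _ _
  have hm0 : (0 : ℝ) ≤ L.len (g * γ 0) := Nat.cast_nonneg _
  have b1 : 1 + (L.len (γ 0) : ℝ) ≤ 1 + total L γ := by linarith
  have b2 : 1 + total L (fun i : Fin k => γ i.succ) ≤ 1 + total L γ := by linarith
  have b3 : 1 + (L.len (g * γ 0) : ℝ) ≤ (1 + total L γ) * (1 + L.len g) := by nlinarith
  have h1 := IsPBounded.weaken M hC le_rfl (g * γ 0) (fun i => γ i.succ)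
  calc M.η (g • x') (M.V.ρ (γ 0) (c fun i => γ i.succ))
      ≤ D * (1 + (L.len (γ 0) : ℝ)) ^ n * M.η ((g * γ 0) • x) (c fun i => γ i.succ) := hx _ _ _
    _ ≤ |D| * (1 + (L.len (γ 0) : ℝ)) ^ n * M.η ((g * γ 0) • x) (c fun i => γ i.succ) := by
        have := M.nonneg ((g * γ 0) • x) (c fun i => γ i.succ)
        gcongr
        exact le_abs_self D
    _ ≤ |D| * (1 + total L γ) ^ n * (|C| * (1 + total L γ) ^ N *
          ((1 + total L γ) * (1 + (L.len g : ℝ))) ^ N) := by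
        refine mul_le_mul (by gcongr) (h1.trans ?_) (M.nonneg _ _) (by positivity)
        gcongr
    _ = |D| * |C| * (1 + total L γ) ^ (n + N + N) * (1 + (L.len g : ℝ)) ^ N := by
        rw [mul_pow, pow_add, pow_add]; ring
    _ ≤ |D| * |C| * (1 + total L γ) ^ (n + N + N) * (1 + (L.len g : ℝ)) ^ (n + N + N) := by
        have : (1 : ℝ) ≤ 1 + L.len g := by linarith
        have : N ≤ n + N + N := by omega
        gcongr

/-- The space of p-bounded inhomogeneous `k`-cochains. -/
def pCochains (k : ℕ) : Submodule ℚ ((Fin k → G) → M.V) where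
  carrier := {c | M.IsPBounded c}
  add_mem' := IsPBounded.add M
  zero_mem' := M.isPBounded_zero
  smul_mem' := fun q _ hc => IsPBounded.smul M q hc

lemma d_mem_pCochains {k : ℕ} {c : (Fin k → G) → M.V} (hc : c ∈ M.pCochains k) :
    (inhomogeneousCochains.d M.V k).hom c ∈ M.pCochains (k + 1) := by
  have h : M.IsPBounded
      ((fun γ : Fin (k + 1) → G => M.V.ρ (γ 0) (c fun i => γ i.succ)) +
        ∑ j : Fin (k + 1), (-1 : ℚ) ^ ((j : ℕ) + 1) •
          fun γ => c (Fin.contractNth j (· * ·) γ)) :=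
    IsPBounded.add M (IsPBounded.act M hc)
      (IsPBounded.sum M _ _ fun j _ => IsPBounded.smul M _ (IsPBounded.contract M hc j))
  have e : (inhomogeneousCochains.d M.V k).hom c =
      ((fun γ : Fin (k + 1) → G => M.V.ρ (γ 0) (c fun i => γ i.succ)) +
        ∑ j : Fin (k + 1), (-1 : ℚ) ^ ((j : ℕ) + 1) •
          fun γ => c (Fin.contractNth j (· * ·) γ)) := by
    ext γ
    simp [inhomogeneousCochains.d_hom_apply, Finset.sum_apply]
  rw [e]
  exact h

/-- The coboundary on p-bounded cochains. -/
def pd (k : ℕ) : ModuleCat.of ℚ (M.pCochains k) ⟶ ModuleCat.of ℚ (M.pCochains (k + 1)) :=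
  ModuleCat.ofHom ((inhomogeneousCochains.d M.V k).hom.restrict fun _ hc => M.d_mem_pCochains hc)

lemma pd_comp_pd (k : ℕ) : M.pd k ≫ M.pd (k + 1) = 0 := by
  refine ModuleCat.hom_ext (LinearMap.ext fun c => ?_)
  have h := groupCohomology.inhomogeneousCochains.d_comp_d (n := k) M.V
  have h' := congrArg (fun φ => φ.hom c.1) h
  exact Subtype.ext h'

/-- The cocomplex `PC^*(G; M)` of p-bounded inhomogeneous cochains. -/
def pComplex : CochainComplex (ModuleCat ℚ) ℕ :=
  CochainComplex.of (fun k => ModuleCat.of ℚ (M.pCochains k)) M.pd M.pd_comp_pd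

/-- The inclusion of `PC^*(G; M)` into the cocomplex of all inhomogeneous cochains. -/
def pInclusion : M.pComplex ⟶ groupCohomology.inhomogeneousCochains M.V :=
  CochainComplex.ofHom (fun k => ModuleCat.ofHom (M.pCochains k).subtype) fun k => by
    simp only [pComplex, CochainComplex.of_d]
    rfl

/-- The p-bounded cohomology `PH^k(G; M)`. -/
def PH (k : ℕ) : ModuleCat ℚ := M.pComplex.homology k

/-- The natural map `PH^k(G; M) → H^k(G; M)` induced by the inclusion of cochains. -/
def comparison (k : ℕ) : M.PH k ⟶ groupCohomology M.V k :=
  HomologicalComplex.homologyMap M.pInclusion k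

end PSModule

/-! ### The Kan loop group -/

namespace KanLoop

/-- The set `X_n` of `n`-simplices. -/
abbrev Simp (X : SSet.{0}) (n : ℕ) : Type := X.obj (Opposite.op (SimplexCategory.mk n))

variable (X : SSet.{0})

/-- The generators `X_{n+1} - s_0 (X_n)` of the loop group in dimension `n`. -/
abbrev Gen (n : ℕ) : Type := {x : Simp X (n + 1) // x ∉ Set.range (X.σ (0 : Fin (n + 1)))}

/-- The group `(GX)_n`. -/
abbrev Grp (n : ℕ) : Type := FreeGroup (Gen X n)

variable {X} in
/-- The twisting function `X_{n+1} → (GX)_n`, trivial on `s_0 (X_n)`. -/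
def τ {n : ℕ} (x : Simp X (n + 1)) : Grp X n :=
  open Classical in if h : x ∉ Set.range (X.σ (0 : Fin (n + 1))) then FreeGroup.of ⟨x, h⟩ else 1

/-- The face homomorphisms: `∂_0 τ(x) = τ(d_0 x)⁻¹ τ(d_1 x)` and `∂_i τ(x) = τ(d_{i+1} x)` for
`i > 0`. -/
def face (n : ℕ) (i : Fin (n + 2)) : Grp X (n + 1) →* Grp X n :=
  FreeGroup.lift fun x =>
    Fin.cases (motive := fun _ => Grp X n)
      ((τ (X.δ 0 x.1))⁻¹ * τ (X.δ 1 x.1)) (fun j => τ (X.δ j.succ.succ x.1)) i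

/-- The degeneracy homomorphisms: `s_i τ(x) = τ(s_{i+1} x)`. -/
def degen (n : ℕ) (i : Fin (n + 1)) : Grp X n →* Grp X (n + 1) :=
  FreeGroup.lift fun x => τ (X.σ i.succ x.1)

/-- `Γ^n_{n+1}`: the elements of `(GX)_{n+1}` killed by `∂_0, …, ∂_n`. -/
def fillers (n : ℕ) : Subgroup (Grp X (n + 1)) :=
  ⨅ i : Fin (n + 1), (face X n i.castSucc).ker

/-- `Γ^n_n`: for `n ≥ 1` the elements killed by all faces, and `Γ^0_0 = ∂_1 (Γ^0_1)`. -/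
def spheres : (n : ℕ) → Subgroup (Grp X n)
  | 0 => (fillers X 0).map (face X 0 (Fin.last 1))
  | n + 1 => ⨅ i : Fin (n + 2), (face X n i).ker

/-- `f` bounds the word-length of some section of `∂_{n+1} : Γ^n_{n+1} → Γ^n_n`. -/
def IsSectionBound (n : ℕ) (f : ℕ → ℕ) : Prop :=
  ∃ s : spheres X n → fillers X n,
    (∀ x, face X n (Fin.last (n + 1)) (s x).1 = x.1) ∧
    ∀ x, freeLen (s x).1 ≤ f (freeLen x.1)

/-- `f` is the `n`-th Dehn function of the loop group: the smallest function bounding the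
word-length of some section of `∂_{n+1} : Γ^n_{n+1} → Γ^n_n`. -/
def IsDehnFunction (n : ℕ) (f : ℕ → ℕ) : Prop :=
  IsLeast {f | IsSectionBound X n f} f

variable {X} {π : Type} [Group π]

/-- `ε : (GX)_0 → π` makes the loop group into an augmented simplicial group with `π` in
dimension `-1`, in such a way that `ε` identifies `π_0(GX) = (GX)_0 / Γ^0_0` with `π`. -/
structure IsAugmentation (ε : Grp X 0 →* π) : Prop where
  comp_face : ε.comp (face X 0 0) = ε.comp (face X 0 1)
  surjective : Function.Surjective ε
  ker_eq : ε.ker = spheres X 0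

/-- The iterated augmentation `(GX)_n → π`. -/
def aug (ε : Grp X 0 →* π) : (n : ℕ) → Grp X n →* π
  | 0 => ε
  | n + 1 => (aug ε n).comp (face X n 0)

/-- The augmented loop group is a resolution of `π`: `π_0 = π` and `π_n = 0` for `n > 0`. -/
structure IsResolution (ε : Grp X 0 →* π) : Prop extends IsAugmentation ε where
  exact : ∀ n, ∀ z ∈ spheres X (n + 1), ∃ y ∈ fillers X (n + 1),
    face X (n + 1) (Fin.last (n + 2)) y = z

/-- The maps `s_n : (GX)_n → (GX)_{n+1}`, `n < m`, restrict to a contraction (extra degeneracy)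
through dimension `m - 1` of the augmented simplicial set `Γ(ε) = ker((GX)^+ → π)`, which is the
inclusion of the trivial group in dimension `-1`. -/
structure IsContraction (ε : Grp X 0 →* π) (m : ℕ) (s : ∀ n, Grp X n → Grp X (n + 1)) :
    Prop where
  mem : ∀ n < m, ∀ x ∈ (aug ε n).ker, s n x ∈ (aug ε (n + 1)).ker
  face_last : ∀ n < m, ∀ x ∈ (aug ε n).ker, face X n (Fin.last (n + 1)) (s n x) = x
  face_zero : 0 < m → ∀ x ∈ (aug ε 0).ker, face X 0 0 (s 0 x) = 1
  face_succ : ∀ n, n + 1 < m → ∀ x ∈ (aug ε (n + 1)).ker, ∀ j : Fin (n + 2),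
    face X (n + 1) j.castSucc (s (n + 1) x) = s n (face X n j x)
  degen_comm : ∀ n, n + 1 < m → ∀ x ∈ (aug ε n).ker, ∀ j : Fin (n + 1),
    s (n + 1) (degen X n j x) = degen X (n + 1) j.castSucc (s n x)

/-- The augmented loop group is a resolution of type `P(m)`: it is a resolution, and `Γ(ε)` admits
a simplicial contraction through dimension `m - 1` which is p-bounded in each degree. -/
def IsTypeP (ε : Grp X 0 →* π) (m : ℕ) : Prop :=
  IsResolution ε ∧ ∃ s : ∀ n, Grp X n → Grp X (n + 1), IsContraction ε m s ∧
    ∀ n < m, ∃ (C : ℝ) (N : ℕ), ∀ x ∈ (aug ε n).ker,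
      (freeLen (s n x) : ℝ) ≤ C * (1 + (freeLen x : ℝ)) ^ N

end KanLoop

end

noncomputable section

set_option linter.unusedSectionVars false

/-! ### Simplicial identities in the loop group -/

namespace KanLoop

variable {X : SSet.{0}}

/-! Two constructions carry the theorem: a length-controlled contraction of the loop group, and a
factorization of the bar resolution, up to homotopy, through finitely generated free modules.

Contraction. The Dehn function `f n` bounds a section that fills `n`-spheres, while Moore's
algorithm (`exists_horn_filler`) fills horns in any simplicial group with linear growth of length.
Together they fill a horn and then correct its last face (`exists_filler`). The extra degeneracy `s`
on the kernel of the augmentation is built by induction on the degree: on degenerate simplices its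
value is forced, and on the others it fills the horn with faces `s (∂_j x)` and last face `x`. If `f
0, …, f n` are polynomial, then so is the growth of `s n` (`exists_contraction`).

Factorization. Choosing geodesics extends `s` to the whole loop group. A geodesic section `π → Γ_0`
is not a homomorphism, but its defect is corrected inductively by the contraction, which gives a
chain map from the bar resolution of `π` to the total complex of the bar complexes of the groups
`Γ_n` (`barBoundary_barLift`). Fox derivatives project this complex onto the free `ℚ[π]`-modules on
the finite sets `Gen X n`, placed in degree `n + 1`. Going back along the standard contraction of
the bar resolution yields a chain endomorphism `Θ` (`endo`) and a homotopy `h` from the identity to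
it (`homotopy`).

Conclusion. An equivariant map from a finitely generated free module to a module with orbits of
polynomial growth is automatically p-bounded (`isBddTo_of_finite`). Hence `y ∘ Θ` is p-bounded for
every cochain `y`, provided the map onto the finitely generated module is p-bounded. A cocycle `y`
is cohomologous to `y ∘ Θ`, which gives surjectivity; a p-bounded `x = y ∘ d` equals `(y ∘ Θ - x ∘
h) ∘ d`, which gives injectivity (`comparison_isIso_succ`). Degree `k` involves only `s m` with `m ≤
k - 2`, so bounds on `s 0, …, s n` reach degree `n + 2`. -/

lemma tau_degenerate {n : ℕ} (y : Simp X n) : τ (X.σ (0 : Fin (n + 1)) y) = 1 := by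
  simp [τ]

lemma tau_gen {n : ℕ} (x : Gen X n) : τ x.1 = FreeGroup.of x := by
  simp only [τ]
  rw [dif_pos x.2]

lemma tau_eq {n : ℕ} (x : Simp X (n + 1)) :
    (∃ y, x = X.σ (0 : Fin (n + 1)) y) ∨ ∃ g : Gen X n, g.1 = x := by
  by_cases h : x ∈ Set.range (X.σ (0 : Fin (n + 1)))
  · obtain ⟨y, rfl⟩ := h
    exact Or.inl ⟨y, rfl⟩
  · exact Or.inr ⟨⟨x, h⟩, rfl⟩

/-- The face formulas persist on `s_0`-degenerate simplices, where `τ` is trivial. Thus they can be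
iterated without asking whether a face of a generator is again a generator. -/
lemma face_zero_tau {n : ℕ} (x : Simp X (n + 2)) :
    face X n 0 (τ x) = (τ (X.δ 0 x))⁻¹ * τ (X.δ 1 x) := by
  rcases tau_eq x with ⟨y, rfl⟩ | ⟨g, rfl⟩
  · have h0 := SSet.δ_comp_σ_self_apply (S := X) (0 : Fin (n + 2)) y
    have h1 := SSet.δ_comp_σ_succ_apply (S := X) (0 : Fin (n + 2)) y
    simp only [Fin.castSucc_zero, Fin.succ_zero_eq_one] at h0 h1
    rw [tau_degenerate, h0, h1]; simp
  · rw [tau_gen]; simp [face]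

lemma face_succ_tau {n : ℕ} (j : Fin (n + 1)) (x : Simp X (n + 2)) :
    face X n j.succ (τ x) = τ (X.δ j.succ.succ x) := by
  rcases tau_eq x with ⟨y, rfl⟩ | ⟨g, rfl⟩
  · have h := SSet.δ_comp_σ_of_gt_apply (S := X) (i := j.succ) (j := 0)
      (by simp [Fin.lt_def]) y
    simp only [Fin.castSucc_zero] at h
    rw [tau_degenerate, h, tau_degenerate, map_one]
  · rw [tau_gen]; simp [face]

lemma degen_tau {n : ℕ} (i : Fin (n + 1)) (x : Simp X (n + 1)) :
    degen X n i (τ x) = τ (X.σ i.succ x) := by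
  rcases tau_eq x with ⟨y, rfl⟩ | ⟨g, rfl⟩
  · have h := SSet.σ_comp_σ_apply (S := X) (i := 0) (j := i) (Fin.zero_le _) y
    simp only [Fin.castSucc_zero] at h
    rw [tau_degenerate, ← h, tau_degenerate, map_one]
  · rw [tau_gen]; simp [degen]

lemma hom_ext_tau {n : ℕ} {H : Type*} [Group H] {φ ψ : Grp X n →* H}
    (h : ∀ x, φ (τ x) = ψ (τ x)) (w : Grp X n) : φ w = ψ w := by
  have : φ = ψ := FreeGroup.ext_hom _ _ fun a => by rw [← tau_gen]; exact h _
  rw [this]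

lemma face_face {n : ℕ} {i j : Fin (n + 2)} (h : i ≤ j) (w : Grp X (n + 2)) :
    face X n i (face X (n + 1) j.succ w) = face X n j (face X (n + 1) i.castSucc w) := by
  refine hom_ext_tau (φ := (face X n i).comp (face X (n + 1) j.succ))
    (ψ := (face X n j).comp (face X (n + 1) i.castSucc)) (fun x => ?_) w
  simp only [MonoidHom.comp_apply]
  rw [face_succ_tau]
  induction i using Fin.cases with
  | zero =>
    rw [face_zero_tau, Fin.castSucc_zero, face_zero_tau]
    have e1 := SSet.δ_comp_δ_apply (S := X) (i := 0) (j := j.succ) (Fin.zero_le _) x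
    have e2 := SSet.δ_comp_δ_apply (S := X) (i := 1) (j := j.succ) (by simp [Fin.le_def]) x
    simp only [Fin.castSucc_zero, Fin.castSucc_one] at e1 e2
    induction j using Fin.cases with
    | zero =>
      -- In this case both factors of `∂_0 τ(x)` contribute; the terms from `d_0 d_0 x` and `d_0 d_1
      -- x` coincide and cancel.
      have e3 := SSet.δ_comp_δ_apply (S := X) (i := 0) (j := 0) le_rfl x
      simp only [Fin.castSucc_zero] at e3
      rw [map_mul, map_inv, face_zero_tau, face_zero_tau, e1, e2]
      simp only [Fin.succ_zero_eq_one] at *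
      rw [e3]
      group
    | succ j =>
      rw [map_mul, map_inv, face_succ_tau, face_succ_tau, e1, e2]
  | succ i =>
    induction j using Fin.cases with
    | zero => simp at h
    | succ j =>
      rw [face_succ_tau, ← Fin.succ_castSucc, face_succ_tau, face_succ_tau,
        Fin.succ_castSucc, Fin.succ_castSucc]
      congr 1
      refine SSet.δ_comp_δ_apply (S := X) (i := i.succ.succ) (j := j.succ.succ) ?_ x
      simpa using h

lemma face_degen_self {n : ℕ} (i : Fin (n + 1)) (w : Grp X n) :
    face X n i.castSucc (degen X n i w) = w := by
  refine hom_ext_tau (φ := (face X n i.castSucc).comp (degen X n i))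
    (ψ := MonoidHom.id _) (fun x => ?_) w
  simp only [MonoidHom.comp_apply, MonoidHom.id_apply]
  rw [degen_tau]
  have e := SSet.δ_comp_σ_self_apply (S := X) i.succ x
  induction i using Fin.cases with
  | zero =>
    simp only [Fin.succ_zero_eq_one, Fin.castSucc_one] at e
    have e' := SSet.δ_comp_σ_of_le_apply (S := X) (i := 0) (j := 0) (Fin.zero_le _) x
    simp only [Fin.succ_zero_eq_one, Fin.castSucc_zero] at e'
    rw [Fin.castSucc_zero, face_zero_tau, Fin.succ_zero_eq_one, e, e', tau_degenerate]
    simp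
  | succ i => rw [← Fin.succ_castSucc, face_succ_tau, Fin.succ_castSucc, Fin.succ_castSucc, e]

lemma face_degen_succ {n : ℕ} (i : Fin (n + 1)) (w : Grp X n) :
    face X n i.succ (degen X n i w) = w := by
  refine hom_ext_tau (φ := (face X n i.succ).comp (degen X n i))
    (ψ := MonoidHom.id _) (fun x => ?_) w
  simp only [MonoidHom.comp_apply, MonoidHom.id_apply]
  rw [degen_tau, face_succ_tau]
  congr 1
  exact SSet.δ_comp_σ_succ_apply (S := X) i.succ x

lemma face_degen_of_le {n : ℕ} {i : Fin (n + 2)} {j : Fin (n + 1)} (h : i ≤ j.castSucc)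
    (w : Grp X (n + 1)) :
    face X (n + 1) i.castSucc (degen X (n + 1) j.succ w) = degen X n j (face X n i w) := by
  refine hom_ext_tau (φ := (face X (n + 1) i.castSucc).comp (degen X (n + 1) j.succ))
    (ψ := (degen X n j).comp (face X n i)) (fun x => ?_) w
  simp only [MonoidHom.comp_apply]
  rw [degen_tau]
  induction i using Fin.cases with
  | zero =>
    have e0 := SSet.δ_comp_σ_of_le_apply (S := X) (i := 0) (j := j.succ) (Fin.zero_le _) x
    have e1 := SSet.δ_comp_σ_of_le_apply (S := X) (i := 1) (j := j.succ)
      (by simp [Fin.le_def]) x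
    simp only [Fin.castSucc_zero, Fin.castSucc_one] at e0 e1
    rw [Fin.castSucc_zero, face_zero_tau, e0, e1, face_zero_tau, map_mul, map_inv, degen_tau,
      degen_tau]
  | succ i =>
    rw [← Fin.succ_castSucc, face_succ_tau, face_succ_tau, degen_tau]
    congr 1
    rw [Fin.succ_castSucc, Fin.succ_castSucc]
    refine SSet.δ_comp_σ_of_le_apply (S := X) (i := i.succ.succ) (j := j.succ) ?_ x
    simpa [Fin.le_def] using h

lemma face_degen_of_gt {n : ℕ} {i : Fin (n + 2)} {j : Fin (n + 1)} (h : j.castSucc < i)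
    (w : Grp X (n + 1)) :
    face X (n + 1) i.succ (degen X (n + 1) j.castSucc w) = degen X n j (face X n i w) := by
  refine hom_ext_tau (φ := (face X (n + 1) i.succ).comp (degen X (n + 1) j.castSucc))
    (ψ := (degen X n j).comp (face X n i)) (fun x => ?_) w
  simp only [MonoidHom.comp_apply]
  rw [degen_tau, face_succ_tau]
  induction i using Fin.cases with
  | zero => simp at h
  | succ i =>
    rw [face_succ_tau, degen_tau]
    congr 1
    rw [Fin.succ_castSucc]
    refine SSet.δ_comp_σ_of_gt_apply (S := X) (i := i.succ.succ) (j := j.succ) ?_ x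
    simpa [Fin.lt_def] using h

lemma degen_degen {n : ℕ} {i j : Fin (n + 1)} (h : i ≤ j) (w : Grp X n) :
    degen X (n + 1) i.castSucc (degen X n j w) = degen X (n + 1) j.succ (degen X n i w) := by
  refine hom_ext_tau (φ := (degen X (n + 1) i.castSucc).comp (degen X n j))
    (ψ := (degen X (n + 1) j.succ).comp (degen X n i)) (fun x => ?_) w
  simp only [MonoidHom.comp_apply]
  rw [degen_tau, degen_tau, degen_tau, degen_tau, Fin.succ_castSucc]
  congr 1
  refine SSet.σ_comp_σ_apply (S := X) (i := i.succ) (j := j.succ) ?_ x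
  simpa using h

end KanLoop

/-! ### Word length in free groups and polynomial bounds -/

lemma freeLen_one {S : Type} : freeLen (1 : FreeGroup S) = 0 := by simp [freeLen]

lemma freeLen_mul_le {S : Type} (u v : FreeGroup S) : freeLen (u * v) ≤ freeLen u + freeLen v := by
  let _ := Classical.decEq S
  exact FreeGroup.norm_mul_le u v

lemma freeLen_inv {S : Type} (u : FreeGroup S) : freeLen u⁻¹ = freeLen u := by simp [freeLen]

lemma freeLen_of {S : Type} (x : S) : freeLen (FreeGroup.of x) = 1 := by simp [freeLen]

lemma freeLen_mk_le {S : Type} (l : List (S × Bool)) : freeLen (FreeGroup.mk l) ≤ l.length := by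
  let _ := Classical.decEq S
  exact FreeGroup.norm_mk_le

lemma exists_word {S : Type} (w : FreeGroup S) :
    ∃ l : List (S × Bool), FreeGroup.mk l = w ∧ l.length = freeLen w := by
  let _ := Classical.decEq S
  exact ⟨w.toWord, FreeGroup.mk_toWord, rfl⟩

/-- A homomorphism out of a free group scales a subadditive length by at most its maximum on the
basis. -/
lemma length_hom_le {S H : Type} [Group H] (φ : FreeGroup S →* H) (ℓ : H → ℕ) (h1 : ℓ 1 = 0)
    (hmul : ∀ a b, ℓ (a * b) ≤ ℓ a + ℓ b) (hinv : ∀ a, ℓ a⁻¹ = ℓ a) (K : ℕ)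
    (hK : ∀ x, ℓ (φ (FreeGroup.of x)) ≤ K) (w : FreeGroup S) : ℓ (φ w) ≤ K * freeLen w := by
  obtain ⟨l, rfl, hl⟩ := exists_word w
  rw [← hl]
  clear hl
  induction l with
  | nil => simp [← FreeGroup.one_eq_mk, h1]
  | cons a l ih =>
    have e : FreeGroup.mk (a :: l) = FreeGroup.mk [a] * FreeGroup.mk l := by
      rw [FreeGroup.mul_mk]; rfl
    have ha : ℓ (φ (FreeGroup.mk [a])) ≤ K := by
      obtain ⟨x, b⟩ := a
      cases b
      · have : FreeGroup.mk [(x, false)] = (FreeGroup.of x)⁻¹ := rfl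
        rw [this, map_inv, hinv]; exact hK x
      · exact hK x
    rw [e, map_mul, List.length_cons, mul_add, mul_one]
    have := hmul (φ (FreeGroup.mk [a])) (φ (FreeGroup.mk l))
    omega

/-- Replaces a polynomial by a monotone bound with natural constants: `C` dominates the sum of the
absolute values of the coefficients. -/
lemma IsPolynomialType.exists_bound {f : ℕ → ℕ} (hf : IsPolynomialType f) :
    ∃ C N : ℕ, ∀ k, f k ≤ C * (1 + k) ^ N := by
  obtain ⟨p, hp⟩ := hf
  obtain ⟨C, hC⟩ := exists_nat_ge (∑ i ∈ Finset.range (p.natDegree + 1), |p.coeff i|)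
  refine ⟨C, p.natDegree, fun k => ?_⟩
  have : (f k : ℝ) ≤ C * (1 + k) ^ p.natDegree := by
    refine (hp k).trans ?_
    rw [Polynomial.eval_eq_sum_range]
    refine le_trans ?_ (mul_le_mul_of_nonneg_right hC (by positivity))
    rw [Finset.sum_mul]
    refine Finset.sum_le_sum fun i hi => ?_
    have hi' : i ≤ p.natDegree := by simpa [Nat.lt_succ_iff] using hi
    refine mul_le_mul (le_abs_self _) ?_ (by positivity) (abs_nonneg _)
    have hk : (0 : ℝ) ≤ k := Nat.cast_nonneg k
    calc (k : ℝ) ^ i ≤ (1 + k) ^ i := by gcongr; linarith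
      _ ≤ (1 + k) ^ p.natDegree := pow_le_pow_right₀ (by linarith) hi'
  exact_mod_cast this

/-! ### Length-controlled horn filling -/

namespace KanLoop

variable {X : SSet.{0}}

lemma freeLen_tau_le {n : ℕ} (x : Simp X (n + 1)) : freeLen (τ x) ≤ 1 := by
  rcases tau_eq x with ⟨y, rfl⟩ | ⟨g, rfl⟩
  · rw [tau_degenerate, freeLen_one]; omega
  · rw [tau_gen, freeLen_of]

lemma freeLen_degen_le {n : ℕ} (i : Fin (n + 1)) (w : Grp X n) :
    freeLen (degen X n i w) ≤ freeLen w := by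
  have := length_hom_le (degen X n i) freeLen freeLen_one freeLen_mul_le freeLen_inv 1
    (fun x => by rw [← tau_gen, degen_tau]; exact freeLen_tau_le _) w
  omega

lemma freeLen_face_le {n : ℕ} (i : Fin (n + 2)) (w : Grp X (n + 1)) :
    freeLen (face X n i w) ≤ 2 * freeLen w := by
  refine length_hom_le (face X n i) freeLen freeLen_one freeLen_mul_le freeLen_inv 2
    (fun x => ?_) w
  rw [← tau_gen]
  induction i using Fin.cases with
  | zero =>
    rw [face_zero_tau]
    have h := freeLen_mul_le (τ (X.δ 0 x.1))⁻¹ (τ (X.δ 1 x.1))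
    rw [freeLen_inv] at h
    have h1 := freeLen_tau_le (X.δ 0 x.1)
    have h2 := freeLen_tau_le (X.δ 1 x.1)
    omega
  | succ i =>
    rw [face_succ_tau]
    have := freeLen_tau_le (X.δ i.succ.succ x.1)
    omega

lemma degen_injective {n : ℕ} (i : Fin (n + 1)) : Function.Injective (degen X n i) :=
  Function.LeftInverse.injective (face_degen_self i)

/-- Moore's algorithm for filling the horns with missing last face. -/
lemma exists_horn_filler {n : ℕ} (y : Fin (n + 2) → Grp X (n + 1)) (M : ℕ)
    (hM : ∀ j, freeLen (y j) ≤ M)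
    (hy : ∀ i j : Fin (n + 1), i ≤ j →
      face X n i.castSucc (y j.succ) = face X n j.castSucc (y i.castSucc)) :
    ∃ w : Grp X (n + 2), (∀ j, face X (n + 1) j.castSucc w = y j) ∧
      freeLen w ≤ 4 ^ (n + 2) * M := by
  suffices H : ∀ k ≤ n + 2, ∃ w : Grp X (n + 2),
      (∀ j : Fin (n + 2), (j : ℕ) < k → face X (n + 1) j.castSucc w = y j) ∧
      freeLen w ≤ 4 ^ k * M by
    obtain ⟨w, hw, hw'⟩ := H (n + 2) le_rfl
    exact ⟨w, fun j => hw j j.2, hw'⟩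
  intro k
  induction k with
  | zero => exact fun _ => ⟨1, fun j hj => by omega, by simp [freeLen_one]⟩
  | succ k ih =>
    intro hk
    obtain ⟨w, hw, hwl⟩ := ih (by omega)
    let κ : Fin (n + 2) := ⟨k, by omega⟩
    -- `u` is the error in the `k`-th face. Multiplying by its `k`-th degeneracy repairs that face,
    -- and the earlier faces survive because horn compatibility makes the corresponding faces of `u`
    -- trivial.
    let u := (face X (n + 1) κ.castSucc w)⁻¹ * y κ
    refine ⟨w * degen X (n + 1) κ u, fun j hj => ?_, ?_⟩
    · rw [map_mul]
      rcases Nat.lt_succ_iff_lt_or_eq.1 hj with hjk | hjk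
      · rw [hw j hjk]
        have hk0 : κ ≠ 0 := by
          intro h
          have : k = 0 := congrArg Fin.val h
          omega
        obtain ⟨κ', hκ'⟩ := Fin.exists_succ_eq.2 hk0
        have hjl : j ≠ Fin.last (n + 1) := by
          intro h
          have : (j : ℕ) = n + 1 := congrArg Fin.val h
          omega
        obtain ⟨j', rfl⟩ := Fin.exists_castSucc_eq.2 hjl
        have hκv : (κ' : ℕ) + 1 = k := by simpa using congrArg Fin.val hκ'
        have hle : j' ≤ κ' := by
          simp only [Fin.val_castSucc] at hjk
          rw [Fin.le_def]; omega
        rw [← hκ', face_degen_of_le (by simpa using hle)]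
        have : face X n j'.castSucc u = 1 := by
          simp only [u]
          rw [map_mul, map_inv, ← hκ', ← Fin.succ_castSucc, face_face (by simpa using hle),
            hw _ hjk, hy _ _ hle]
          simp
        rw [this, map_one, mul_one]
      · have : j = κ := Fin.ext hjk
        subst this
        rw [face_degen_self]
        simp [u]
    · have h1 := freeLen_mul_le w (degen X (n + 1) κ u)
      have h2 := freeLen_degen_le κ u
      have h3 := freeLen_mul_le (face X (n + 1) κ.castSucc w)⁻¹ (y κ)
      rw [freeLen_inv] at h3
      have h4 := freeLen_face_le κ.castSucc w
      have h5 := hM κ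
      -- The new length is at most `|w| + (2|w| + M)`, hence at most `3 * 4 ^ k * M + M`; absorbing
      -- the last `M` explains the base `4`.
      have h6 : M ≤ 4 ^ k * M := Nat.le_mul_of_pos_left _ (by positivity)
      have : 4 ^ (k + 1) * M = 4 * (4 ^ k * M) := by ring
      have : freeLen u ≤ _ := h3
      omega

/-- Extending a filled horn to a simplex with prescribed last face. -/
lemma exists_filler {n : ℕ} {f : ℕ → ℕ} (hf : IsSectionBound X (n + 1) f)
    (y : Fin (n + 2) → Grp X (n + 1)) (x : Grp X (n + 1)) (M : ℕ)
    (hM : ∀ j, freeLen (y j) ≤ M)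
    (hy : ∀ i j : Fin (n + 1), i ≤ j →
      face X n i.castSucc (y j.succ) = face X n j.castSucc (y i.castSucc))
    (hx : ∀ i, face X n i x = face X n (Fin.last (n + 1)) (y i)) :
    ∃ w : Grp X (n + 2), (∀ j, face X (n + 1) j.castSucc w = y j) ∧
      face X (n + 1) (Fin.last (n + 2)) w = x ∧
      ∃ m ≤ freeLen x + 2 * (4 ^ (n + 2) * M), freeLen w ≤ f m + 4 ^ (n + 2) * M := by
  obtain ⟨w, hw, hwl⟩ := exists_horn_filler y M hM hy
  obtain ⟨s, hs, hsl⟩ := hf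
  -- The error in the last face is a sphere, because `x` and the last face of `w` have the same
  -- boundary.
  have hmem : x * (face X (n + 1) (Fin.last (n + 2)) w)⁻¹ ∈ spheres X (n + 1) := by
    simp only [spheres, Subgroup.mem_iInf, MonoidHom.mem_ker]
    intro i
    rw [map_mul, map_inv, ← Fin.succ_last, face_face (Fin.le_last i), hw, hx]
    simp
  let z := s ⟨_, hmem⟩
  have hz : ∀ j : Fin (n + 2), face X (n + 1) j.castSucc z.1 = 1 := by
    have := z.2
    simp only [fillers, Subgroup.mem_iInf, MonoidHom.mem_ker] at this
    exact this
  -- The bound refers to the actual length `m` of the sphere, since `f` is not assumed to be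
  -- monotone.
  refine ⟨z.1 * w, fun j => ?_, ?_,
    freeLen (x * (face X (n + 1) (Fin.last (n + 2)) w)⁻¹), ?_, ?_⟩
  · rw [map_mul, hz, hw, one_mul]
  · rw [map_mul, hs]; simp
  · have h1 := freeLen_mul_le x (face X (n + 1) (Fin.last (n + 2)) w)⁻¹
    rw [freeLen_inv] at h1
    have h2 := freeLen_face_le (Fin.last (n + 2)) w
    omega
  · have h1 := freeLen_mul_le z.1 w
    have h2 : freeLen z.1 ≤ f (freeLen (x * (face X (n + 1) (Fin.last (n + 2)) w)⁻¹)) :=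
      hsl ⟨_, hmem⟩
    omega

/-! ### The contraction, constructed degree by degree -/

variable {π : Type} [Group π] {ε : Grp X 0 →* π}

lemma IsAugmentation.aug_face (hε : IsAugmentation ε) (n : ℕ) (j : Fin (n + 2))
    (w : Grp X (n + 1)) : aug ε n (face X n j w) = aug ε (n + 1) w := by
  induction n with
  | zero =>
    have h := DFunLike.congr_fun hε.comp_face w
    fin_cases j
    · rfl
    · exact h.symm
  | succ n ih =>
    induction j using Fin.cases with
    | zero => rfl
    | succ j =>
      change aug ε n (face X n 0 _) = _
      rw [face_face (Fin.zero_le _), ih]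
      rfl

lemma IsAugmentation.aug_degen (hε : IsAugmentation ε) {n : ℕ} (j : Fin (n + 1)) (w : Grp X n) :
    aug ε (n + 1) (degen X n j w) = aug ε n w := by
  rw [← hε.aug_face n j.castSucc, face_degen_self]

/-- The properties of the `n`-th map of a contraction that are needed to construct the next one. -/
structure IsExtendable (ε : Grp X 0 →* π) (n : ℕ) (s : Grp X n → Grp X (n + 1)) : Prop where
  mem : ∀ x ∈ (aug ε n).ker, s x ∈ (aug ε (n + 1)).ker
  face_last : ∀ x ∈ (aug ε n).ker, face X n (Fin.last (n + 1)) (s x) = x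
  horn : ∀ x ∈ (aug ε (n + 1)).ker, ∀ i j : Fin (n + 1), i ≤ j →
    face X n i.castSucc (s (face X n j.succ x)) = face X n j.castSucc (s (face X n i.castSucc x))
  degen_eq : ∀ x ∈ (aug ε n).ker, ∀ y ∈ (aug ε n).ker, ∀ i j : Fin (n + 1),
    degen X n i x = degen X n j y →
    degen X (n + 1) i.castSucc (s x) = degen X (n + 1) j.castSucc (s y)
  face_degen : ∀ x ∈ (aug ε n).ker, ∀ (i : Fin (n + 1)) (j : Fin (n + 2)),
    face X (n + 1) j.castSucc (degen X (n + 1) i.castSucc (s x)) = s (face X n j (degen X n i x))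

/-- Two consecutive maps of a contraction are compatible. -/
structure IsExtension (ε : Grp X 0 →* π) (n : ℕ) (s : Grp X n → Grp X (n + 1))
    (t : Grp X (n + 1) → Grp X (n + 2)) : Prop where
  face_last : ∀ x ∈ (aug ε (n + 1)).ker, face X (n + 1) (Fin.last (n + 2)) (t x) = x
  face_succ : ∀ x ∈ (aug ε (n + 1)).ker, ∀ j : Fin (n + 2),
    face X (n + 1) j.castSucc (t x) = s (face X n j x)
  degen_comm : ∀ x ∈ (aug ε n).ker, ∀ j : Fin (n + 1),
    t (degen X n j x) = degen X (n + 1) j.castSucc (s x)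

/-- Polynomial growth on the kernel of the augmentation. -/
def IsPolyBounded (ε : Grp X 0 →* π) (n : ℕ) (s : Grp X n → Grp X (n + 1)) : Prop :=
  ∃ C N : ℕ, ∀ x ∈ (aug ε n).ker, freeLen (s x) ≤ C * (1 + freeLen x) ^ N

/-- This closes the induction: the conditions needed at the next stage follow from the simplicial
identities alone, so the choices of fillers play no role. -/
lemma IsExtension.isExtendable (hε : IsAugmentation ε) {n : ℕ} {s : Grp X n → Grp X (n + 1)}
    {t : Grp X (n + 1) → Grp X (n + 2)} (hs : IsExtendable ε n s) (h : IsExtension ε n s t) :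
    IsExtendable ε (n + 1) t where
  mem x hx := by
    rw [MonoidHom.mem_ker, ← hε.aug_face (n + 1) (Fin.castSucc 0), h.face_succ x hx,
      ← MonoidHom.mem_ker]
    apply hs.mem
    rwa [MonoidHom.mem_ker, hε.aug_face]
  face_last := h.face_last
  horn x hx i j hij := by
    have hf : ∀ k, face X (n + 1) k x ∈ (aug ε (n + 1)).ker := fun k => by
      rwa [MonoidHom.mem_ker, hε.aug_face]
    rw [h.face_succ _ (hf _), h.face_succ _ (hf _), face_face hij]
  degen_eq := by
    have key : ∀ x ∈ (aug ε (n + 1)).ker, ∀ y ∈ (aug ε (n + 1)).ker, ∀ i j : Fin (n + 2), i ≤ j →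
        degen X (n + 1) i x = degen X (n + 1) j y →
        degen X (n + 2) i.castSucc (t x) = degen X (n + 2) j.castSucc (t y) := by
      intro x hx y hy i j hij e
      rcases hij.eq_or_lt with rfl | hlt
      · rw [degen_injective i e]
      obtain ⟨i, rfl⟩ := Fin.exists_castSucc_eq.2 (Fin.ne_last_of_lt hlt)
      obtain ⟨j, rfl⟩ := Fin.exists_succ_eq.2 (Fin.ne_zero_of_lt hlt)
      have hle : i ≤ j := by
        rw [Fin.lt_def] at hlt; rw [Fin.le_def]; simp at hlt; omega
      -- If one element is degenerate in two directions, then `x` and `y` are both degeneracies of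
      -- this common `z`. So the two prescribed values agree by the identity for iterated
      -- degeneracies.
      let z := face X n i.castSucc y
      have hz : z ∈ (aug ε n).ker := by
        rw [MonoidHom.mem_ker, hε.aug_face]; exact hy
      have ex : x = degen X n j z := by
        rw [← face_degen_self i.castSucc x, e, face_degen_of_le (by simpa using hle)]
      have ey : y = degen X n i z := by
        rw [← face_degen_succ j.succ y, ← e, face_degen_of_gt (by simpa [Fin.lt_def] using hlt), ex,
          face_degen_succ]
      rw [ex, ey, h.degen_comm z hz, h.degen_comm z hz, degen_degen (by simpa using hle),
        Fin.succ_castSucc]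
    intro x hx y hy i j e
    rcases le_total i j with hij | hij
    · exact key x hx y hy i j hij e
    · exact (key y hy x hx j i hij e.symm).symm
  face_degen x hx i j := by
    have hf : ∀ k, face X n k x ∈ (aug ε n).ker := fun k => by
      rwa [MonoidHom.mem_ker, hε.aug_face]
    rcases lt_trichotomy j i.castSucc with hlt | rfl | hgt
    · obtain ⟨j, rfl⟩ := Fin.exists_castSucc_eq.2 (Fin.ne_last_of_lt hlt)
      have hlt' : j < i := by simpa using hlt
      obtain ⟨i, rfl⟩ := Fin.exists_succ_eq.2 (Fin.ne_zero_of_lt hlt')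
      have hle : j ≤ i.castSucc := by
        rw [Fin.lt_def] at hlt'; rw [Fin.le_def]; simp at hlt' ⊢; omega
      rw [← Fin.succ_castSucc, face_degen_of_le (by simpa using hle), h.face_succ x hx,
        face_degen_of_le hle, h.degen_comm _ (hf _)]
    · rw [face_degen_self, face_degen_self]
    · obtain ⟨j, rfl⟩ := Fin.exists_succ_eq.2 (Fin.ne_zero_of_lt hgt)
      rw [← Fin.succ_castSucc]
      rcases (Fin.castSucc_lt_succ_iff.1 hgt).eq_or_lt with rfl | hlt
      · rw [face_degen_succ, face_degen_succ]
      · obtain ⟨i, rfl⟩ := Fin.exists_castSucc_eq.2 (Fin.ne_last_of_lt hlt)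
        rw [face_degen_of_gt (by simpa using hlt), h.face_succ x hx, face_degen_of_gt hlt,
          h.degen_comm _ (hf _)]

/-- The growth clause is an implication, and `t` is chosen independently of it. Thus one contraction
exists in all degrees, and is polynomial as far as the Dehn functions are. -/
lemma IsExtendable.exists_extension (hε : IsAugmentation ε) {n : ℕ}
    {s : Grp X n → Grp X (n + 1)} (hs : IsExtendable ε n s) {f : ℕ → ℕ}
    (hf : IsSectionBound X (n + 1) f) :
    ∃ t, IsExtension ε n s t ∧
      (IsPolyBounded ε n s → IsPolynomialType f → IsPolyBounded ε (n + 1) t) := by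
  let M : Grp X (n + 1) → ℕ := fun x => Finset.univ.sup fun j => freeLen (s (face X n j x))
  have H : ∀ x ∈ (aug ε (n + 1)).ker, ∃ w : Grp X (n + 2),
      (∀ j, face X (n + 1) j.castSucc w = s (face X n j x)) ∧
      face X (n + 1) (Fin.last (n + 2)) w = x ∧
      (∀ x' ∈ (aug ε n).ker, ∀ j, x = degen X n j x' → w = degen X (n + 1) j.castSucc (s x')) ∧
      ((∃ m ≤ freeLen x + 2 * (4 ^ (n + 2) * M x), freeLen w ≤ f m + 4 ^ (n + 2) * M x) ∨
        ∃ x' ∈ (aug ε n).ker, freeLen x' ≤ 2 * freeLen x ∧ freeLen w ≤ freeLen (s x')) := by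
    intro x hx
    -- On degenerate elements the value is dictated by compatibility with degeneracies; `degen_eq`
    -- makes it independent of the presentation. Only the remaining elements need a filler.
    by_cases hd : ∃ x' ∈ (aug ε n).ker, ∃ j, x = degen X n j x'
    · obtain ⟨x', hx', j, rfl⟩ := hd
      refine ⟨degen X (n + 1) j.castSucc (s x'), fun k => hs.face_degen x' hx' j k, ?_,
        fun x'' hx'' k hk => hs.degen_eq _ hx' _ hx'' _ _ hk, Or.inr ⟨x', hx', ?_, ?_⟩⟩
      · rw [← Fin.succ_last, face_degen_of_gt (Fin.castSucc_lt_last j), hs.face_last x' hx']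
      -- `x'` is a face of `x`, so its length is at most twice that of `x`.
      · conv_lhs => rw [← face_degen_self j x']
        exact freeLen_face_le _ _
      · exact freeLen_degen_le _ _
    · obtain ⟨w, h1, h2, h3⟩ := exists_filler hf (fun j => s (face X n j x)) x (M x)
        (fun j => Finset.le_sup (f := fun j => freeLen (s (face X n j x))) (Finset.mem_univ j))
        (fun i j hij => hs.horn x hx i j hij)
        (fun i => (hs.face_last _ (by rwa [MonoidHom.mem_ker, hε.aug_face])).symm)
      exact ⟨w, h1, h2, fun x' hx' j hj => absurd ⟨x', hx', j, hj⟩ hd, Or.inl h3⟩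
  choose t h1 h2 h3 h4 using H
  classical
  refine ⟨fun x => if hx : x ∈ (aug ε (n + 1)).ker then t x hx else 1, ⟨?_, ?_, ?_⟩, ?_⟩
  · intro x hx; simp only [dif_pos hx]; exact h2 x hx
  · intro x hx; simp only [dif_pos hx]; exact h1 x hx
  · intro x hx j
    have : degen X n j x ∈ (aug ε (n + 1)).ker := by
      rwa [MonoidHom.mem_ker, hε.aug_degen]
    simp only [dif_pos this]
    exact h3 _ this x hx j rfl
  · rintro ⟨C, N, hC⟩ hp
    obtain ⟨D, K, hD⟩ := hp.exists_bound
    -- The factor `2 ^ N` accounts for faces doubling the length, and `4 ^ (n + 2)` comes from horn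
    -- filling. With this `A`, the length `m` of the sphere satisfies `1 + m ≤ A * (1 + freeLen x) ^
    -- (N + 1)`; applying the bound of degree `K` on `f` gives the exponent `(N + 1) * K`.
    let A := 1 + 2 * (4 ^ (n + 2) * (C * 2 ^ N))
    refine ⟨D * A ^ K + 4 ^ (n + 2) * (C * 2 ^ N), (N + 1) * K + N, fun x hx => ?_⟩
    simp only [dif_pos hx]
    have hb : ∀ {S : Type} (x' : FreeGroup S), freeLen x' ≤ 2 * freeLen x →
        C * (1 + freeLen x') ^ N ≤
        C * 2 ^ N * (1 + freeLen x) ^ N := by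
      intro _ x' hx'
      rw [mul_assoc, ← mul_pow]
      gcongr
      omega
    have e1 : (1 + freeLen x) ^ N ≤ (1 + freeLen x) ^ ((N + 1) * K + N) :=
      Nat.pow_le_pow_right (by omega) (by omega)
    have e2 : ((1 + freeLen x) ^ (N + 1)) ^ K ≤ (1 + freeLen x) ^ ((N + 1) * K + N) := by
      rw [← pow_mul]
      exact Nat.pow_le_pow_right (by omega) (by omega)
    have e3 : (1 + freeLen x) ≤ (1 + freeLen x) ^ (N + 1) := Nat.le_self_pow (by omega) _
    have e4 : (1 + freeLen x) ^ N ≤ (1 + freeLen x) ^ (N + 1) :=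
      Nat.pow_le_pow_right (by omega) (by omega)
    rcases h4 x hx with ⟨m, hm, hw⟩ | ⟨x', hx', hl, hw⟩
    · have hM : M x ≤ C * 2 ^ N * (1 + freeLen x) ^ N := by
        refine Finset.sup_le fun j _ => ?_
        refine (hC _ (by rwa [MonoidHom.mem_ker, hε.aug_face])).trans (hb _ (freeLen_face_le j x))
      have hm' : 1 + m ≤ A * (1 + freeLen x) ^ (N + 1) := by
        calc 1 + m ≤ (1 + freeLen x) + 2 * (4 ^ (n + 2) * M x) := by omega
          _ ≤ (1 + freeLen x) ^ (N + 1) + 2 * (4 ^ (n + 2) * (C * 2 ^ N *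
              (1 + freeLen x) ^ (N + 1))) := by gcongr; exact hM.trans (by gcongr)
          _ = _ := by ring
      calc freeLen (t x hx) ≤ D * (1 + m) ^ K + 4 ^ (n + 2) * M x :=
            hw.trans (by gcongr; exact hD m)
        _ ≤ D * (A * (1 + freeLen x) ^ (N + 1)) ^ K + 4 ^ (n + 2) *
            (C * 2 ^ N * (1 + freeLen x) ^ N) := by gcongr
        _ ≤ D * (A ^ K * (1 + freeLen x) ^ ((N + 1) * K + N)) + 4 ^ (n + 2) *
            (C * 2 ^ N * (1 + freeLen x) ^ ((N + 1) * K + N)) := by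
            rw [mul_pow]; gcongr
        _ = _ := by ring
    · calc freeLen (t x hx) ≤ C * 2 ^ N * (1 + freeLen x) ^ N :=
            hw.trans ((hC x' hx').trans (hb x' hl))
        _ ≤ (4 ^ (n + 2) * (C * 2 ^ N)) * (1 + freeLen x) ^ ((N + 1) * K + N) := by
            exact Nat.mul_le_mul (Nat.le_mul_of_pos_left _ (by positivity)) e1
        _ ≤ _ := by gcongr; omega

/-- The induction starts without a horn: `ker ε` is exactly the group of 0-spheres, so the given
section is itself the contraction. The degeneracy conditions involve only the single index of `Fin
1`. -/
lemma exists_isExtendable_zero (hε : IsAugmentation ε) {f : ℕ → ℕ} (hf : IsSectionBound X 0 f) :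
    ∃ s, IsExtendable ε 0 s ∧ (∀ x ∈ (aug ε 0).ker, face X 0 0 (s x) = 1) ∧
      (IsPolynomialType f → IsPolyBounded ε 0 s) := by
  obtain ⟨s, hs, hl⟩ := hf
  have hk : ∀ x, x ∈ (aug ε 0).ker → x ∈ spheres X 0 := fun x hx => by
    rw [← hε.ker_eq]; exact hx
  classical
  let t : Grp X 0 → Grp X 1 := fun x => if hx : x ∈ (aug ε 0).ker then (s ⟨x, hk x hx⟩).1 else 1
  have ht : ∀ x (hx : x ∈ (aug ε 0).ker), t x = (s ⟨x, hk x hx⟩).1 := fun x hx => dif_pos hx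
  have h0 : ∀ x ∈ (aug ε 0).ker, face X 0 0 (t x) = 1 := fun x hx => by
    rw [ht x hx]
    have := (s ⟨x, hk x hx⟩).2
    simp only [fillers, Subgroup.mem_iInf, MonoidHom.mem_ker] at this
    exact this 0
  refine ⟨t, ⟨?_, ?_, ?_, ?_, ?_⟩, h0, ?_⟩
  · intro x hx
    rw [MonoidHom.mem_ker, ← hε.aug_face 0 0, h0 x hx, map_one]
  · intro x hx
    rw [ht x hx]; exact hs _
  · intro x hx i j _
    have hf : ∀ k, face X 0 k x ∈ (aug ε 0).ker := fun k => by
      rwa [MonoidHom.mem_ker, hε.aug_face]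
    obtain rfl : i = 0 := Fin.fin_one_eq_zero i
    obtain rfl : j = 0 := Fin.fin_one_eq_zero j
    rw [Fin.castSucc_zero, h0 _ (hf _), h0 _ (hf _)]
  · intro x _ y _ i j e
    obtain rfl : i = j := Subsingleton.elim (α := Fin 1) i j
    rw [degen_injective i e]
  · intro x hx i j
    obtain rfl : i = 0 := Fin.fin_one_eq_zero i
    have : j = Fin.castSucc 0 ∨ j = Fin.succ 0 := by fin_cases j <;> simp
    rcases this with rfl | rfl
    · rw [face_degen_self, face_degen_self]
    · rw [← Fin.succ_castSucc, face_degen_succ, face_degen_succ]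
  · intro hp
    obtain ⟨C, N, hC⟩ := hp.exists_bound
    refine ⟨C, N, fun x hx => ?_⟩
    rw [ht x hx]
    exact (hl _).trans (hC _)

/-- A sequence of sections of the last faces gives rise to a simplicial contraction, which is
polynomially bounded as far as the bounds of the sections are of polynomial type. -/
theorem exists_contraction (hε : IsAugmentation ε) {f : ℕ → ℕ → ℕ}
    (hf : ∀ m, IsSectionBound X m (f m)) :
    ∃ s : ∀ n, Grp X n → Grp X (n + 1), (∀ m, IsContraction ε m s) ∧
      ∀ n, (∀ m ≤ n, IsPolynomialType (f m)) → IsPolyBounded ε n (s n) := by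
  obtain ⟨s₀, hs₀, hz, hp₀⟩ := exists_isExtendable_zero hε (hf 0)
  have step : ∀ (n : ℕ) (s : {s : Grp X n → Grp X (n + 1) // IsExtendable ε n s}),
      ∃ t : {t : Grp X (n + 1) → Grp X (n + 2) // IsExtendable ε (n + 1) t},
        IsExtension ε n s.1 t.1 ∧
        (IsPolyBounded ε n s.1 → IsPolynomialType (f (n + 1)) → IsPolyBounded ε (n + 1) t.1) := by
    intro n s
    obtain ⟨t, ht, hp⟩ := s.2.exists_extension hε (hf (n + 1))
    exact ⟨⟨t, ht.isExtendable hε s.2⟩, ht, hp⟩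
  choose next hnext hpnext using step
  let S : ∀ n, {s : Grp X n → Grp X (n + 1) // IsExtendable ε n s} :=
    fun n => Nat.rec ⟨s₀, hs₀⟩ (fun n s => next n s) n
  refine ⟨fun n => (S n).1, fun m => ⟨?_, ?_, ?_, ?_, ?_⟩, fun n => ?_⟩
  · exact fun n _ => (S n).2.mem
  · exact fun n _ => (S n).2.face_last
  · exact fun _ => hz
  · exact fun n _ => (hnext n (S n)).face_succ
  · exact fun n _ => (hnext n (S n)).degen_comm
  · induction n with
    | zero => exact fun h => hp₀ (h 0 le_rfl)
    | succ n ih => exact fun h => hpnext n (S n) (ih fun m hm => h m (by omega)) (h _ le_rfl)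

end KanLoop

/-! ### Weighted sets and bounded maps of free modules -/

/-- The weighted `ℓ¹`-norm of exponent `j` on the `ℚ`-vector space on a set with weight `w`. -/
def wnorm {Ω : Type} (w : Ω → ℕ) (j : ℕ) (v : Ω →₀ ℚ) : ℝ :=
  v.sum fun a q => |(q : ℝ)| * (1 + (w a : ℝ)) ^ j

section wnorm

variable {Ω Ω' Ω'' : Type} {w : Ω → ℕ} {w' : Ω' → ℕ} {w'' : Ω'' → ℕ} {j : ℕ}

lemma wnorm_single (a : Ω) (q : ℚ) :
    wnorm w j (Finsupp.single a q) = |(q : ℝ)| * (1 + (w a : ℝ)) ^ j := by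
  simp [wnorm]

@[simp]
lemma wnorm_zero : wnorm w j 0 = 0 := by simp [wnorm]

lemma wnorm_nonneg (v : Ω →₀ ℚ) : 0 ≤ wnorm w j v :=
  Finset.sum_nonneg fun _ _ => by positivity

lemma wnorm_eq_sum (v : Ω →₀ ℚ) {s : Finset Ω} (hs : v.support ⊆ s) :
    wnorm w j v = ∑ a ∈ s, |(v a : ℝ)| * (1 + (w a : ℝ)) ^ j :=
  Finsupp.sum_of_support_subset _ hs _ (by simp)

lemma wnorm_add_le (u v : Ω →₀ ℚ) : wnorm w j (u + v) ≤ wnorm w j u + wnorm w j v := by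
  classical
  rw [wnorm_eq_sum (u + v) Finsupp.support_add,
    wnorm_eq_sum u (Finset.subset_union_left (s₂ := v.support)),
    wnorm_eq_sum v (Finset.subset_union_right (s₁ := u.support)), ← Finset.sum_add_distrib]
  refine Finset.sum_le_sum fun a _ => ?_
  rw [← add_mul]
  gcongr
  rw [Finsupp.add_apply]
  push_cast
  exact abs_add_le _ _

lemma wnorm_smul (q : ℚ) (v : Ω →₀ ℚ) : wnorm w j (q • v) = |(q : ℝ)| * wnorm w j v := by
  rw [wnorm_eq_sum (q • v) Finsupp.support_smul, wnorm_eq_sum v subset_rfl, Finset.mul_sum]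
  refine Finset.sum_congr rfl fun a _ => ?_
  rw [Finsupp.smul_apply, smul_eq_mul]
  push_cast
  rw [abs_mul]; ring

lemma wnorm_neg (v : Ω →₀ ℚ) : wnorm w j (-v) = wnorm w j v := by
  have := wnorm_smul (w := w) (j := j) (-1) v
  simpa using this

lemma wnorm_sub_le (u v : Ω →₀ ℚ) : wnorm w j (u - v) ≤ wnorm w j u + wnorm w j v := by
  rw [sub_eq_add_neg, ← wnorm_neg v]; exact wnorm_add_le _ _

lemma wnorm_mono {i j : ℕ} (h : i ≤ j) (v : Ω →₀ ℚ) : wnorm w i v ≤ wnorm w j v := by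
  refine Finset.sum_le_sum fun a _ => ?_
  have : (1 : ℝ) ≤ 1 + w a := by simp
  dsimp only
  gcongr

/-- A subadditive function composed with a linear map out of a free module is controlled by its
values on the basis. -/
lemma seminorm_le_wnorm {V : Type*} [AddCommGroup V] [Module ℚ V] (p : V → ℝ) (h0 : p 0 ≤ 0)
    (hadd : ∀ u v, p (u + v) ≤ p u + p v) (hsmul : ∀ (q : ℚ) v, p (q • v) ≤ |(q : ℝ)| * p v)
    (φ : (Ω →₀ ℚ) →ₗ[ℚ] V) {C : ℝ}
    (hC : ∀ a, p (φ (Finsupp.single a 1)) ≤ C * (1 + (w a : ℝ)) ^ j) (v : Ω →₀ ℚ) :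
    p (φ v) ≤ C * wnorm w j v := by
  have hφ : φ v = ∑ a ∈ v.support, v a • φ (Finsupp.single a 1) := by
    conv_lhs => rw [← Finsupp.sum_single v, Finsupp.sum, map_sum]
    refine Finset.sum_congr rfl fun a _ => ?_
    rw [← map_smul, Finsupp.smul_single, smul_eq_mul, mul_one]
  rw [hφ, wnorm, Finsupp.sum, Finset.mul_sum]
  have : ∀ s : Finset Ω, p (∑ a ∈ s, v a • φ (Finsupp.single a 1)) ≤
      ∑ a ∈ s, C * (|(v a : ℝ)| * (1 + (w a : ℝ)) ^ j) := by
    classical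
    intro s
    induction s using Finset.induction_on with
    | empty => simpa using h0
    | insert a s ha ih =>
      rw [Finset.sum_insert ha, Finset.sum_insert ha]
      refine (hadd _ _).trans (add_le_add ((hsmul _ _).trans ?_) ih)
      have := mul_le_mul_of_nonneg_left (hC a) (abs_nonneg (v a : ℝ))
      linarith
  exact this _

lemma wnorm_map_le (φ : (Ω →₀ ℚ) →ₗ[ℚ] (Ω' →₀ ℚ)) {C : ℝ} {i : ℕ}
    (hC : ∀ a, wnorm w' i (φ (Finsupp.single a 1)) ≤ C * (1 + (w a : ℝ)) ^ j) (v : Ω →₀ ℚ) :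
    wnorm w' i (φ v) ≤ C * wnorm w j v :=
  seminorm_le_wnorm _ (by simp) wnorm_add_le (fun q v => (wnorm_smul q v).le) φ hC v

lemma wnorm_mapDomain_le (f : Ω → Ω') (v : Ω →₀ ℚ) :
    wnorm w' j (Finsupp.lmapDomain ℚ ℚ f v) ≤ wnorm (fun a => w' (f a)) j v := by
  have := wnorm_map_le (w := fun a => w' (f a)) (w' := w') (i := j) (j := j) (C := 1)
    (Finsupp.lmapDomain ℚ ℚ f) (fun a => by simp [wnorm_single]) v
  simpa using this

variable (w w') in
/-- A linear map of free modules on weighted sets is p-bounded. -/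
def IsBddMap (φ : (Ω →₀ ℚ) →ₗ[ℚ] (Ω' →₀ ℚ)) : Prop :=
  ∀ j : ℕ, ∃ (C : ℝ) (i : ℕ), 0 ≤ C ∧ ∀ v, wnorm w' j (φ v) ≤ C * wnorm w i v

lemma IsBddMap.of_basis {φ : (Ω →₀ ℚ) →ₗ[ℚ] (Ω' →₀ ℚ)}
    (h : ∀ j : ℕ, ∃ (C : ℝ) (i : ℕ), ∀ a,
      wnorm w' j (φ (Finsupp.single a 1)) ≤ C * (1 + (w a : ℝ)) ^ i) : IsBddMap w w' φ := by
  intro j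
  obtain ⟨C, i, hC⟩ := h j
  refine ⟨|C|, i, abs_nonneg C, wnorm_map_le φ fun a => (hC a).trans ?_⟩
  gcongr
  exact le_abs_self C

lemma IsBddMap.basis_le {φ : (Ω →₀ ℚ) →ₗ[ℚ] (Ω' →₀ ℚ)} (h : IsBddMap w w' φ) (j : ℕ) :
    ∃ (C : ℝ) (i : ℕ), 0 ≤ C ∧ ∀ a,
      wnorm w' j (φ (Finsupp.single a 1)) ≤ C * (1 + (w a : ℝ)) ^ i := by
  obtain ⟨C, i, hC0, hC⟩ := h j
  exact ⟨C, i, hC0, fun a => by simpa [wnorm_single] using hC (Finsupp.single a 1)⟩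

lemma IsBddMap.zero : IsBddMap w w' 0 := fun _ => ⟨0, 0, le_rfl, fun _ => by simp⟩

lemma IsBddMap.id : IsBddMap w w LinearMap.id :=
  fun j => ⟨1, j, zero_le_one, fun _ => by simp⟩

lemma IsBddMap.add {φ ψ : (Ω →₀ ℚ) →ₗ[ℚ] (Ω' →₀ ℚ)} (hφ : IsBddMap w w' φ)
    (hψ : IsBddMap w w' ψ) : IsBddMap w w' (φ + ψ) := by
  intro j
  obtain ⟨C, i, hC0, hC⟩ := hφ j
  obtain ⟨D, k, hD0, hD⟩ := hψ j
  refine ⟨C + D, max i k, by positivity, fun v => ?_⟩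
  calc wnorm w' j ((φ + ψ) v) ≤ C * wnorm w i v + D * wnorm w k v :=
        (wnorm_add_le _ _).trans (add_le_add (hC v) (hD v))
    _ ≤ C * wnorm w (max i k) v + D * wnorm w (max i k) v := by
        gcongr
        · exact wnorm_mono (le_max_left _ _) v
        · exact wnorm_mono (le_max_right _ _) v
    _ = _ := by ring

lemma IsBddMap.smul {φ : (Ω →₀ ℚ) →ₗ[ℚ] (Ω' →₀ ℚ)} (q : ℚ) (hφ : IsBddMap w w' φ) :
    IsBddMap w w' (q • φ) := by
  intro j
  obtain ⟨C, i, hC0, hC⟩ := hφ j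
  refine ⟨|(q : ℝ)| * C, i, by positivity, fun v => ?_⟩
  rw [LinearMap.smul_apply, wnorm_smul, mul_assoc]
  exact mul_le_mul_of_nonneg_left (hC v) (abs_nonneg _)

lemma IsBddMap.sub {φ ψ : (Ω →₀ ℚ) →ₗ[ℚ] (Ω' →₀ ℚ)} (hφ : IsBddMap w w' φ)
    (hψ : IsBddMap w w' ψ) : IsBddMap w w' (φ - ψ) := by
  have e : φ - ψ = φ + (-1 : ℚ) • ψ := by module
  rw [e]
  exact hφ.add (hψ.smul (-1))

lemma IsBddMap.comp {φ : (Ω →₀ ℚ) →ₗ[ℚ] (Ω' →₀ ℚ)} {ψ : (Ω' →₀ ℚ) →ₗ[ℚ] (Ω'' →₀ ℚ)}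
    (hψ : IsBddMap w' w'' ψ) (hφ : IsBddMap w w' φ) : IsBddMap w w'' (ψ ∘ₗ φ) := by
  intro j
  obtain ⟨D, k, hD0, hD⟩ := hψ j
  obtain ⟨C, i, hC0, hC⟩ := hφ k
  refine ⟨D * C, i, by positivity, fun v => (hD _).trans ?_⟩
  rw [mul_assoc]
  exact mul_le_mul_of_nonneg_left (hC v) hD0

lemma IsBddMap.lmapDomain {f : Ω → Ω'} (h : ∃ C N : ℕ, ∀ a, w' (f a) ≤ C * (1 + w a) ^ N) :
    IsBddMap w w' (Finsupp.lmapDomain ℚ ℚ f) := by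
  obtain ⟨C, N, hC⟩ := h
  refine .of_basis fun j => ⟨(1 + C) ^ j, N * j, fun a => ?_⟩
  have h1 : (w' (f a) : ℝ) ≤ C * (1 + w a) ^ N := by exact_mod_cast hC a
  have h2 : (1 : ℝ) ≤ (1 + (w a : ℝ)) ^ N := one_le_pow₀ (by simp)
  rw [Finsupp.lmapDomain_apply, Finsupp.mapDomain_single, wnorm_single, pow_mul, ← mul_pow]
  simp only [Rat.cast_one, abs_one, one_mul]
  gcongr
  linarith

end wnorm

/-! ### Free modules over a group -/

/-- The underlying `ℚ`-vector space of the free `ℚ[G]`-module on `B`. -/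
abbrev FreeRep (G B : Type) : Type := G × B →₀ ℚ

namespace FreeRep

/-- Two linear maps agreeing on the basis are equal. -/
lemma hom_ext {G B : Type} {V : Type*} [AddCommGroup V] [Module ℚ V]
    {φ ψ : FreeRep G B →ₗ[ℚ] V}
    (h : ∀ g b, φ (Finsupp.single (g, b) 1) = ψ (Finsupp.single (g, b) 1)) : φ = ψ :=
  Finsupp.lhom_ext' fun a => LinearMap.ext_ring (h a.1 a.2)

variable {G : Type} [Group G] {B B' : Type}

/-- Translation by a group element. -/
def act (g : G) : FreeRep G B →ₗ[ℚ] FreeRep G B :=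
  Finsupp.lmapDomain ℚ ℚ fun p => (g * p.1, p.2)

@[simp]
lemma act_single (g h : G) (b : B) (q : ℚ) :
    act g (Finsupp.single (h, b) q) = Finsupp.single (g * h, b) q := by
  simp [act]

@[simp]
lemma act_one (v : FreeRep G B) : act 1 v = v := by
  have : act (1 : G) = (LinearMap.id : FreeRep G B →ₗ[ℚ] _) := hom_ext fun g b => by simp
  rw [this]; rfl

lemma act_act (g h : G) (v : FreeRep G B) : act g (act h v) = act (g * h) v := by
  have : act g ∘ₗ act h = (act (g * h) : FreeRep G B →ₗ[ℚ] _) :=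
    hom_ext fun k b => by simp [mul_assoc]
  exact LinearMap.congr_fun this v

/-- Equivariance of a linear map of free modules. -/
def IsEquivariant (φ : FreeRep G B →ₗ[ℚ] FreeRep G B') : Prop :=
  ∀ g v, φ (act g v) = act g (φ v)

lemma IsEquivariant.of_basis {φ : FreeRep G B →ₗ[ℚ] FreeRep G B'}
    (h : ∀ g k b, φ (Finsupp.single (g * k, b) 1) = act g (φ (Finsupp.single (k, b) 1))) :
    IsEquivariant φ := fun g v => by
  have : φ ∘ₗ act g = act g ∘ₗ φ := hom_ext fun k b => by simp [h]
  exact LinearMap.congr_fun this v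

lemma IsEquivariant.comp {B'' : Type} {φ : FreeRep G B →ₗ[ℚ] FreeRep G B'}
    {ψ : FreeRep G B' →ₗ[ℚ] FreeRep G B''} (hψ : IsEquivariant ψ) (hφ : IsEquivariant φ) :
    IsEquivariant (ψ ∘ₗ φ) := fun g v => by simp [hφ g v, hψ g]

lemma IsEquivariant.add {φ ψ : FreeRep G B →ₗ[ℚ] FreeRep G B'} (hφ : IsEquivariant φ)
    (hψ : IsEquivariant ψ) : IsEquivariant (φ + ψ) := fun g v => by simp [hφ g v, hψ g v]

lemma IsEquivariant.smul {φ : FreeRep G B →ₗ[ℚ] FreeRep G B'} (q : ℚ) (hφ : IsEquivariant φ) :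
    IsEquivariant (q • φ) := fun g v => by simp [hφ g v]

/-- Equivariant maps agreeing on the basis elements are equal. -/
lemma IsEquivariant.hom_ext {φ ψ : FreeRep G B →ₗ[ℚ] FreeRep G B'} (hφ : IsEquivariant φ)
    (hψ : IsEquivariant ψ)
    (h : ∀ b, φ (Finsupp.single (1, b) 1) = ψ (Finsupp.single (1, b) 1)) : φ = ψ :=
  FreeRep.hom_ext fun g b => by
    have e : Finsupp.single (g, b) (1 : ℚ) = act g (Finsupp.single (1, b) 1) := by simp
    rw [e, hφ, hψ, h]

/-- The equivariant extension of a function on the basis. -/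
def extend (f : B → FreeRep G B') : FreeRep G B →ₗ[ℚ] FreeRep G B' :=
  Finsupp.linearCombination ℚ fun p => act p.1 (f p.2)

@[simp]
lemma extend_single (f : B → FreeRep G B') (g : G) (b : B) :
    extend f (Finsupp.single (g, b) 1) = act g (f b) := by
  simp [extend]

lemma extend_equivariant (f : B → FreeRep G B') : IsEquivariant (extend f) :=
  .of_basis fun g k b => by simp [act_act]

/-- The weight of a basis element of a free module. -/
def weight (L : WordLength G) (wt : B → ℕ) : G × B → ℕ := fun p => L.len p.1 + wt p.2

variable {L : WordLength G} {wt : B → ℕ} {wt' : B' → ℕ}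

lemma wnorm_act_le (j : ℕ) (g : G) (v : FreeRep G B) :
    wnorm (weight L wt) j (act g v) ≤ (1 + (L.len g : ℝ)) ^ j * wnorm (weight L wt) j v := by
  refine wnorm_map_le (act g) (fun a => ?_) v
  obtain ⟨h, b⟩ := a
  rw [act_single, wnorm_single, ← mul_pow]
  simp only [Rat.cast_one, abs_one, one_mul, weight]
  have : (L.len (g * h) : ℝ) ≤ L.len g + L.len h := by exact_mod_cast L.len_mul g h
  have h1 : (0 : ℝ) ≤ L.len g := by positivity
  have h2 : (0 : ℝ) ≤ L.len h := by positivity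
  have h3 : (0 : ℝ) ≤ wt b := by positivity
  gcongr
  push_cast
  nlinarith [mul_nonneg h1 h2, mul_nonneg h1 h3]

/-- Translating by `g` costs only a factor `(1 + L g) ^ j`, so it suffices to bound an equivariant
map on the elements `(1, b)`. -/
lemma IsEquivariant.isBddMap {φ : FreeRep G B →ₗ[ℚ] FreeRep G B'} (hφ : IsEquivariant φ)
    (h : ∀ j : ℕ, ∃ (C : ℝ) (i : ℕ), ∀ b,
      wnorm (weight L wt') j (φ (Finsupp.single (1, b) 1)) ≤ C * (1 + (wt b : ℝ)) ^ i) :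
    IsBddMap (weight L wt) (weight L wt') φ := by
  refine .of_basis fun j => ?_
  obtain ⟨C, i, hC⟩ := h j
  refine ⟨|C|, j + i, fun ⟨g, b⟩ => ?_⟩
  have e : Finsupp.single (g, b) (1 : ℚ) = act g (Finsupp.single (1, b) 1) := by simp
  rw [e, hφ]
  refine (wnorm_act_le j g _).trans ?_
  have h1 : (0 : ℝ) ≤ L.len g := by positivity
  have h3 : (0 : ℝ) ≤ wt b := by positivity
  calc (1 + (L.len g : ℝ)) ^ j * wnorm (weight L wt') j (φ (Finsupp.single (1, b) 1))
      ≤ (1 + (L.len g : ℝ)) ^ j * (|C| * (1 + (wt b : ℝ)) ^ i) := by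
        gcongr
        refine (hC b).trans ?_
        gcongr
        exact le_abs_self C
    _ ≤ (1 + (weight L wt (g, b) : ℝ)) ^ j * (|C| * (1 + (weight L wt (g, b) : ℝ)) ^ i) := by
        simp only [weight, Nat.cast_add]
        gcongr <;> linarith
    _ = _ := by rw [pow_add]; ring

lemma IsEquivariant.isBddMap_of_finite [Finite B] {φ : FreeRep G B →ₗ[ℚ] FreeRep G B'}
    (hφ : IsEquivariant φ) : IsBddMap (weight L wt) (weight L wt') φ := by
  cases nonempty_fintype B
  refine hφ.isBddMap fun j =>
    ⟨∑ b, wnorm (weight L wt') j (φ (Finsupp.single (1, b) 1)), 0, fun b => ?_⟩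
  rw [pow_zero, mul_one]
  exact Finset.single_le_sum
    (f := fun b => wnorm (weight L wt') j (φ (Finsupp.single (1, b) 1)))
    (fun _ _ => wnorm_nonneg _) (Finset.mem_univ b)

end FreeRep

/-! ### The bar complex with coefficients along a homomorphism -/

namespace Bar

open FreeRep

variable {G H : Type} [Group G] [Group H]

/-- Multiply the first entry of a list from the left. -/
def mulHead (a : H) : List H → List H
  | [] => []
  | x :: t => (a * x) :: t

/-- Prepend an entry to the bar generators. -/
def consMap (a : H) : FreeRep G (List H) →ₗ[ℚ] FreeRep G (List H) :=
  Finsupp.lmapDomain ℚ ℚ fun p => (p.1, a :: p.2)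

/-- Multiply the first entry of the bar generators from the left. -/
def headMap (a : H) : FreeRep G (List H) →ₗ[ℚ] FreeRep G (List H) :=
  Finsupp.lmapDomain ℚ ℚ fun p => (p.1, mulHead a p.2)

/-- The inner faces and the last face of a bar generator, with their signs. -/
def innerBasis (g : G) : List H → FreeRep G (List H)
  | [] => 0
  | a :: m => -Finsupp.single (g, mulHead a m) 1 - consMap a (innerBasis g m)

variable (G H) in
/-- The inner faces and the last face of the bar complex, with their signs. -/
def inner : FreeRep G (List H) →ₗ[ℚ] FreeRep G (List H) :=
  Finsupp.linearCombination ℚ fun p => innerBasis p.1 p.2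

/-- The zeroth face of a bar generator. -/
def firstBasis (ε : H →* G) (g : G) : List H → FreeRep G (List H)
  | [] => 0
  | a :: m => Finsupp.single (g * ε a, m) 1

/-- The zeroth face of the bar complex. -/
def first (ε : H →* G) : FreeRep G (List H) →ₗ[ℚ] FreeRep G (List H) :=
  Finsupp.linearCombination ℚ fun p => firstBasis ε p.1 p.2

/-- The differential of the bar complex of `H` with coefficients in `ℚ[G]`. -/
def bar (ε : H →* G) : FreeRep G (List H) →ₗ[ℚ] FreeRep G (List H) := first ε + inner G H

variable (ε : H →* G)

@[simp]
lemma consMap_single (a : H) (g : G) (l : List H) (q : ℚ) :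
    consMap a (Finsupp.single (g, l) q) = Finsupp.single (g, a :: l) q := by simp [consMap]

@[simp]
lemma headMap_single (a : H) (g : G) (l : List H) (q : ℚ) :
    headMap a (Finsupp.single (g, l) q) = Finsupp.single (g, mulHead a l) q := by simp [headMap]

@[simp]
lemma inner_nil (g : G) : inner G H (Finsupp.single (g, []) 1) = 0 := by
  simp [inner, innerBasis]

@[simp]
lemma inner_cons (g : G) (a : H) (m : List H) : inner G H (Finsupp.single (g, a :: m) 1) =
    -Finsupp.single (g, mulHead a m) 1 - consMap a (inner G H (Finsupp.single (g, m) 1)) := by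
  simp [inner, innerBasis]

@[simp]
lemma first_nil (g : G) : first ε (Finsupp.single (g, []) 1) = 0 := by
  simp [first, firstBasis]

@[simp]
lemma first_cons (g : G) (a : H) (m : List H) :
    first ε (Finsupp.single (g, a :: m) 1) = Finsupp.single (g * ε a, m) 1 := by
  simp [first, firstBasis]

lemma bar_nil (g : G) : bar ε (Finsupp.single (g, []) 1) = 0 := by simp [bar]

lemma inner_consMap (a : H) (v : FreeRep G (List H)) :
    inner G H (consMap a v) = -headMap a v - consMap a (inner G H v) := by
  have : inner G H ∘ₗ consMap a = -headMap a - consMap a ∘ₗ inner G H :=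
    hom_ext fun g l => by simp
  exact LinearMap.congr_fun this v

lemma inner_headMap (a : H) (v : FreeRep G (List H)) :
    inner G H (headMap a v) = headMap a (inner G H v) := by
  have h1 : ∀ x : H, (headMap a ∘ₗ consMap x : FreeRep G (List H) →ₗ[ℚ] _) = consMap (a * x) :=
    fun x => hom_ext fun g l => by simp [mulHead]
  have : inner G H ∘ₗ headMap a = headMap a ∘ₗ inner G H := hom_ext fun g l => by
    cases l with
    | nil => simp [mulHead]
    | cons x t =>
      have h := LinearMap.congr_fun (h1 x) (inner G H (Finsupp.single (g, t) 1))
      simp only [LinearMap.comp_apply] at h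
      simp only [LinearMap.comp_apply, headMap_single, mulHead, inner_cons, map_sub, map_neg, h]
      cases t <;> simp [mulHead, mul_assoc]
  exact LinearMap.congr_fun this v

/-- In the recursion for `a :: m`, the two terms `headMap a (inner m)` cancel and the induction
hypothesis kills what remains. -/
lemma inner_inner (v : FreeRep G (List H)) : inner G H (inner G H v) = 0 := by
  have : inner G H ∘ₗ inner G H = 0 := hom_ext fun g l => by
    induction l with
    | nil => simp
    | cons a m ih =>
      simp only [LinearMap.comp_apply, LinearMap.zero_apply] at ih ⊢
      rw [inner_cons, ← headMap_single, map_sub, map_neg, inner_headMap, inner_consMap, ih]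
      simp
  exact LinearMap.congr_fun this v

/-- The zeroth face moves the leading entry into the coefficient by the right translation `R`, which
commutes with the inner faces. Removing the first two entries in turn equals removing their product,
which cancels the mixed terms. -/
lemma bar_bar (v : FreeRep G (List H)) : bar ε (bar ε v) = 0 := by
  let R : H → FreeRep G (List H) →ₗ[ℚ] FreeRep G (List H) :=
    fun a => Finsupp.lmapDomain ℚ ℚ fun p => (p.1 * ε a, p.2)
  have hR : ∀ a g l, R a (Finsupp.single (g, l) 1) = Finsupp.single (g * ε a, l) 1 :=
    fun a g l => by simp [R]
  have hf : ∀ a v, first ε (consMap a v) = R a v := fun a v => by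
    have : first ε ∘ₗ consMap a = R a := hom_ext fun g l => by simp [hR]
    exact LinearMap.congr_fun this v
  have hRc : ∀ a x v, R a (consMap x v) = consMap x (R a v) := fun a x v => by
    have : R a ∘ₗ consMap x = consMap x ∘ₗ R a := hom_ext fun g l => by simp [hR]
    exact LinearMap.congr_fun this v
  have hi : ∀ a v, inner G H (R a v) = R a (inner G H v) := fun a v => by
    have : inner G H ∘ₗ R a = R a ∘ₗ inner G H := hom_ext fun g l => by
      induction l with
      | nil => simp [hR]
      | cons x t ih =>
        simp only [LinearMap.comp_apply, hR] at ih ⊢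
        rw [inner_cons, inner_cons, ih, map_sub, map_neg, hR, hRc]
    exact LinearMap.congr_fun this v
  have hh : ∀ a g l, first ε (R a (Finsupp.single (g, l) 1)) =
      first ε (headMap a (Finsupp.single (g, l) 1)) := fun a g l => by
    cases l <;> simp [hR, mulHead, mul_assoc]
  have : bar ε ∘ₗ bar ε = 0 := hom_ext fun g l => by
    cases l with
    | nil => simp [bar]
    | cons a m =>
      rw [← consMap_single]
      simp only [bar, LinearMap.comp_apply, LinearMap.add_apply, map_add, inner_inner, hf,
        inner_consMap, inner_headMap, map_zero, map_sub, map_neg, hh, hi, LinearMap.zero_apply]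
      abel
  exact LinearMap.congr_fun this v

lemma act_consMap (k : G) (a : H) (v : FreeRep G (List H)) :
    act k (consMap a v) = consMap a (act k v) := by
  have : (act k ∘ₗ consMap a : FreeRep G (List H) →ₗ[ℚ] _) = consMap a ∘ₗ act k :=
    hom_ext fun g l => by simp
  exact LinearMap.congr_fun this v

lemma inner_equivariant : IsEquivariant (inner G H) :=
  .of_basis fun g k l => by
    induction l with
    | nil => simp
    | cons a m ih => simp [ih, act_consMap]

lemma bar_equivariant : IsEquivariant (bar ε) :=
  .add (.of_basis fun g k l => by cases l <;> simp [mul_assoc]) inner_equivariant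

/-- The map of bar complexes induced by a map of sets. -/
def listMap {H' : Type} (f : H → H') : FreeRep G (List H) →ₗ[ℚ] FreeRep G (List H') :=
  Finsupp.lmapDomain ℚ ℚ fun p => (p.1, p.2.map f)

@[simp]
lemma listMap_single {H' : Type} (f : H → H') (g : G) (l : List H) (q : ℚ) :
    listMap f (Finsupp.single (g, l) q) = Finsupp.single (g, l.map f) q := by simp [listMap]

lemma listMap_equivariant {H' : Type} (f : H → H') :
    IsEquivariant (listMap f : FreeRep G (List H) →ₗ[ℚ] _) :=
  .of_basis fun g k l => by simp

lemma listMap_listMap {H' H'' : Type} [Group H'] (f : H → H') (f' : H' → H'') (v : FreeRep G (List H)) :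
    listMap f' (listMap f v) = listMap (f' ∘ f) v := by
  have : listMap f' ∘ₗ listMap f = (listMap (f' ∘ f) : FreeRep G (List H) →ₗ[ℚ] _) :=
    hom_ext fun g l => by simp
  exact LinearMap.congr_fun this v

lemma listMap_id (v : FreeRep G (List H)) : listMap (fun x => x) v = v := by
  have : (listMap fun x => x : FreeRep G (List H) →ₗ[ℚ] _) = LinearMap.id :=
    hom_ext fun g l => by simp
  exact LinearMap.congr_fun this v

lemma bar_listMap {H' : Type} [Group H'] {ε' : H' →* G} (θ : H →* H') (h : ∀ x, ε' (θ x) = ε x)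
    (v : FreeRep G (List H)) : bar ε' (listMap θ v) = listMap θ (bar ε v) := by
  have hc : ∀ (a : H) (v : FreeRep G (List H)),
      listMap θ (consMap a v) = consMap (θ a) (listMap θ v) := fun a v => by
    have : (listMap θ ∘ₗ consMap a : FreeRep G (List H) →ₗ[ℚ] _) = consMap (θ a) ∘ₗ listMap θ :=
      hom_ext fun g l => by simp
    exact LinearMap.congr_fun this v
  have : bar ε' ∘ₗ listMap θ = listMap θ ∘ₗ bar ε := hom_ext fun g l => by
    simp only [bar, LinearMap.comp_apply, LinearMap.add_apply, map_add, listMap_single]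
    congr 1
    · cases l <;> simp [h]
    · induction l with
      | nil => simp
      | cons a m ih =>
        simp only [List.map_cons, inner_cons, ih, map_sub, map_neg, hc, listMap_single]
        cases m <;> simp [mulHead]
  exact LinearMap.congr_fun this v

/-! Degrees -/

variable (G H) in
/-- The part of degree `p` of the bar complex. -/
def deg (p : ℕ) : Submodule ℚ (FreeRep G (List H)) :=
  Finsupp.supported ℚ ℚ {x | x.2.length = p}

lemma single_mem_deg (g : G) (l : List H) (q : ℚ) :
    Finsupp.single (g, l) q ∈ deg G H l.length :=
  Finsupp.single_mem_supported ℚ q rfl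

/-- Linear maps agreeing on the basis elements of degree `p` agree in degree `p`. -/
lemma deg_ext {V : Type*} [AddCommGroup V] [Module ℚ V] {φ ψ : FreeRep G (List H) →ₗ[ℚ] V} {p : ℕ}
    (h : ∀ g l, l.length = p → φ (Finsupp.single (g, l) 1) = ψ (Finsupp.single (g, l) 1))
    {v : FreeRep G (List H)} (hv : v ∈ deg G H p) : φ v = ψ v := by
  rw [deg, Finsupp.supported_eq_span_single] at hv
  induction hv using Submodule.span_induction with
  | mem x hx => obtain ⟨⟨g, l⟩, hl, rfl⟩ := hx; exact h g l hl
  | zero => simp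
  | add u v _ _ hu hv => simp [hu, hv]
  | smul a v _ hv => simp [hv]

lemma consMap_mem_deg (a : H) {p : ℕ} {v : FreeRep G (List H)} (hv : v ∈ deg G H p) :
    consMap a v ∈ deg G H (p + 1) := by
  rw [deg, Finsupp.supported_eq_span_single] at hv
  induction hv using Submodule.span_induction with
  | mem x hx =>
    obtain ⟨⟨g, l⟩, hl, rfl⟩ := hx
    obtain rfl : l.length = p := hl
    dsimp only
    rw [consMap_single]
    exact single_mem_deg _ _ _
  | zero => simp
  | add u v _ _ hu hv => rw [map_add]; exact add_mem hu hv
  | smul a v _ hv => rw [map_smul]; exact Submodule.smul_mem _ _ hv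

lemma length_mulHead (a : H) (l : List H) : (mulHead a l).length = l.length := by
  cases l <;> simp [mulHead]

lemma bar_mem_deg (g : G) {l : List H} {p : ℕ} (hl : l.length = p + 1) :
    bar ε (Finsupp.single (g, l) 1) ∈ deg G H p := by
  cases l with
  | nil => simp at hl
  | cons a m =>
    obtain rfl : m.length = p := by simpa using hl
    refine add_mem ?_ ?_
    · rw [first_cons]; exact single_mem_deg _ _ _
    · clear hl
      induction m generalizing a with
      | nil =>
        simp only [inner_cons, mulHead, inner_nil, map_zero, sub_zero]
        exact neg_mem (single_mem_deg _ _ _)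
      | cons x t ih =>
        rw [inner_cons]
        refine sub_mem (neg_mem ?_) (consMap_mem_deg a (ih x))
        rw [← length_mulHead a]
        exact single_mem_deg _ _ _

/-- The projection onto degree `0`. -/
def proj₀ : FreeRep G (List H) →ₗ[ℚ] FreeRep G (List H) :=
  Finsupp.linearCombination ℚ fun p => if p.2 = [] then Finsupp.single p 1 else 0

@[simp]
lemma proj₀_nil (g : G) : (proj₀ (Finsupp.single (g, []) 1) : FreeRep G (List H)) =
    Finsupp.single (g, []) 1 := by simp [proj₀]

@[simp]
lemma proj₀_cons (g : G) (a : H) (l : List H) : proj₀ (Finsupp.single (g, a :: l) 1) = 0 := by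
  simp [proj₀]

lemma proj₀_equivariant : IsEquivariant (proj₀ : FreeRep G (List H) →ₗ[ℚ] _) :=
  .of_basis fun g k l => by cases l <;> simp

lemma proj₀_eq_self {v : FreeRep G (List H)} (hv : v ∈ deg G H 0) : proj₀ v = v :=
  deg_ext (φ := proj₀) (ψ := LinearMap.id) (fun g l hl => by
    obtain rfl := List.eq_nil_of_length_eq_zero hl
    simp) hv

lemma proj₀_eq_zero {p : ℕ} {v : FreeRep G (List H)} (hv : v ∈ deg G H (p + 1)) : proj₀ v = 0 :=
  deg_ext (φ := proj₀) (ψ := 0) (fun g l hl => by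
    cases l with
    | nil => simp at hl
    | cons a l => simp) hv

/-! The contraction of the bar resolution -/

/-- The standard contraction of the bar resolution. -/
def cone : FreeRep G (List G) →ₗ[ℚ] FreeRep G (List G) :=
  Finsupp.lmapDomain ℚ ℚ fun p => (1, p.1 :: p.2)

@[simp]
lemma cone_single (g : G) (l : List G) (q : ℚ) :
    cone (Finsupp.single (g, l) q) = Finsupp.single (1, g :: l) q := by simp [cone]

/-- The augmentation of the bar resolution. -/
def augm : FreeRep G (List G) →ₗ[ℚ] ℚ :=
  Finsupp.linearCombination ℚ fun p => if p.2 = [] then 1 else 0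

@[simp]
lemma augm_nil (g : G) : augm (Finsupp.single (g, ([] : List G)) 1) = 1 := by simp [augm]

@[simp]
lemma augm_cons (g a : G) (l : List G) : augm (Finsupp.single (g, a :: l) 1) = 0 := by
  simp [augm]

lemma augm_cone (v : FreeRep G (List G)) : augm (cone v) = 0 := by
  have : augm ∘ₗ cone = (0 : FreeRep G (List G) →ₗ[ℚ] ℚ) := hom_ext fun g l => by simp
  exact LinearMap.congr_fun this v

lemma augm_act (g : G) (v : FreeRep G (List G)) : augm (act g v) = augm v := by
  have : augm ∘ₗ act g = (augm : FreeRep G (List G) →ₗ[ℚ] ℚ) := hom_ext fun g l => by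
    cases l <;> simp
  exact LinearMap.congr_fun this v

lemma augm_eq_zero {p : ℕ} {v : FreeRep G (List G)} (hv : v ∈ deg G G (p + 1)) : augm v = 0 :=
  deg_ext (φ := augm) (ψ := 0) (fun g l hl => by
    cases l with
    | nil => simp at hl
    | cons a l => simp) hv

/-- The cone satisfies `d ∘ cone + cone ∘ d = id - augm` up to the inclusion of the unit. It
therefore gives preimages of cycles with vanishing augmentation. -/
lemma bar_cone {v : FreeRep G (List G)} (hv : bar (MonoidHom.id G) v = 0) (hv' : augm v = 0) :
    bar (MonoidHom.id G) (cone v) = v := by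
  have hc : ∀ (g : G) m, cone (inner G G (Finsupp.single (g, m) 1)) =
      consMap g (inner G G (Finsupp.single (1, m) 1)) := fun g m => by
    have h1 : inner G G (Finsupp.single (g, m) 1) =
        act g (inner G G (Finsupp.single (1, m) 1)) := by
      rw [← inner_equivariant]; simp
    have h2 : ∀ m, inner G G (Finsupp.single (1, m) 1) ∈
        Finsupp.supported ℚ ℚ {x : G × List G | x.1 = 1} := fun m => by
      induction m with
      | nil => simp
      | cons a m ih =>
        rw [inner_cons]
        refine sub_mem (neg_mem (Finsupp.single_mem_supported ℚ 1 rfl)) ?_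
        generalize inner G G (Finsupp.single (1, m) 1) = v at ih
        rw [Finsupp.supported_eq_span_single] at ih
        induction ih using Submodule.span_induction with
        | mem x hx =>
          obtain ⟨⟨g, l⟩, hl, rfl⟩ := hx
          dsimp only
          rw [consMap_single]
          exact Finsupp.single_mem_supported ℚ 1 hl
        | zero => simp
        | add u v _ _ hu hv => rw [map_add]; exact add_mem hu hv
        | smul a v _ hv => rw [map_smul]; exact Submodule.smul_mem _ _ hv
    rw [h1]
    have h3 := h2 m
    generalize inner G G (Finsupp.single (1, m) 1) = v at h3
    rw [Finsupp.supported_eq_span_single] at h3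
    induction h3 using Submodule.span_induction with
    | mem x hx =>
      obtain ⟨⟨g, l⟩, hl, rfl⟩ := hx
      obtain rfl : g = 1 := hl
      simp
    | zero => simp
    | add u v _ _ hu hv => simp [hu, hv]
    | smul a v _ hv => simp [hv]
  have : bar (MonoidHom.id G) ∘ₗ cone + cone ∘ₗ bar (MonoidHom.id G) =
      LinearMap.id - (LinearMap.toSpanSingleton ℚ _ (Finsupp.single (1, []) 1)) ∘ₗ augm := by
    refine hom_ext fun g l => ?_
    cases l with
    | nil => simp [bar, mulHead, sub_eq_add_neg]
    | cons a m =>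
      simp only [bar, LinearMap.add_apply, LinearMap.comp_apply, cone_single, first_cons,
        map_add, hc, inner_cons (1 : G) g, mulHead, MonoidHom.id_apply, one_mul,
        LinearMap.sub_apply, LinearMap.id_apply, augm_cons, map_zero]
      abel
  have := LinearMap.congr_fun this v
  simpa [hv, hv'] using this

end Bar

/-! ### Polynomial bounds on the bar complex -/

namespace Bar

open FreeRep

variable {G H : Type} [Group G] [Group H]

/-- The weight of a list with respect to a length of its entries. -/
def listWeight (ℓ : H → ℕ) (l : List H) : ℕ := (l.map fun a => 1 + ℓ a).sum

variable {L : WordLength G} {ℓ : H → ℕ}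

lemma listWeight_nil : listWeight ℓ [] = 0 := rfl

lemma listWeight_cons (a : H) (l : List H) :
    listWeight ℓ (a :: l) = 1 + ℓ a + listWeight ℓ l := by simp [listWeight]

lemma length_le_listWeight (l : List H) : l.length ≤ listWeight ℓ l := by
  induction l with
  | nil => simp
  | cons a l ih => rw [listWeight_cons, List.length_cons]; omega

lemma listWeight_mulHead_le (hmul : ∀ a b, ℓ (a * b) ≤ ℓ a + ℓ b) (a : H) (l : List H) :
    listWeight ℓ (mulHead a l) ≤ listWeight ℓ (a :: l) := by
  cases l with
  | nil => simp [mulHead, listWeight_nil]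
  | cons x t =>
    have := hmul a x
    simp only [mulHead, listWeight_cons]; omega

/-- The shift `K` makes the induction work: prepending `a` raises every weight by `1 + ℓ a`, which
is absorbed into `K`. The number of faces appears as `l.length`, and the summand `1` for each entry
in `listWeight` lets the weight control it. -/
lemma wnorm_inner_le (hmul : ∀ a b, ℓ (a * b) ≤ ℓ a + ℓ b) (j K : ℕ) (g : G) (l : List H) :
    wnorm (fun p => K + weight L (listWeight ℓ) p) j (inner G H (Finsupp.single (g, l) 1)) ≤
      l.length * (1 + ((K + weight L (listWeight ℓ) (g, l) : ℕ) : ℝ)) ^ j := by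
  induction l generalizing K with
  | nil => simp
  | cons a m ih =>
    have h1 : wnorm (fun p => K + weight L (listWeight ℓ) p) j
        (-Finsupp.single (g, mulHead a m) 1) ≤
        (1 + ((K + weight L (listWeight ℓ) (g, a :: m) : ℕ) : ℝ)) ^ j := by
      rw [wnorm_neg, wnorm_single]
      simp only [Rat.cast_one, abs_one, one_mul]
      have := listWeight_mulHead_le hmul a m
      gcongr
      simp only [weight]
      omega
    have h2 : wnorm (fun p => K + weight L (listWeight ℓ) p) j
        (consMap a (inner G H (Finsupp.single (g, m) 1))) ≤
        m.length * (1 + ((K + weight L (listWeight ℓ) (g, a :: m) : ℕ) : ℝ)) ^ j := by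
      refine (wnorm_mapDomain_le _ _).trans ?_
      have e : ∀ p : G × List H, K + weight L (listWeight ℓ) (p.1, a :: p.2) =
          (K + (1 + ℓ a)) + weight L (listWeight ℓ) p := fun p => by
        simp only [weight, listWeight_cons]; ring
      simp only [e]
      have := ih (K + (1 + ℓ a))
      rwa [← e] at this
    rw [inner_cons, List.length_cons]
    push_cast at *
    linarith [wnorm_sub_le (w := fun p => K + weight L (listWeight ℓ) p) (j := j)
      (-Finsupp.single (g, mulHead a m) 1) (consMap a (inner G H (Finsupp.single (g, m) 1)))]

lemma bar_isBddMap (hmul : ∀ a b, ℓ (a * b) ≤ ℓ a + ℓ b) (ε : H →* G) {K : ℕ}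
    (hε : ∀ a, L.len (ε a) ≤ K * ℓ a) :
    IsBddMap (weight L (listWeight ℓ)) (weight L (listWeight ℓ)) (bar ε) := by
  refine .add (.of_basis fun j => ⟨(1 + K : ℝ) ^ j, j, fun ⟨g, l⟩ => ?_⟩)
    (.of_basis fun j => ⟨1, j + 1, fun ⟨g, l⟩ => ?_⟩)
  · cases l with
    | nil => rw [first_nil, wnorm_zero]; positivity
    | cons a m =>
      rw [first_cons, wnorm_single, ← mul_pow]
      simp only [Rat.cast_one, abs_one, one_mul, weight, listWeight_cons]
      gcongr
      have h1 := L.len_mul g (ε a)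
      have h2 := hε a
      have : 1 + (L.len (g * ε a) + listWeight ℓ m) ≤
          (1 + K) * (1 + (L.len g + (1 + ℓ a + listWeight ℓ m))) := by nlinarith
      exact_mod_cast this
  · have := wnorm_inner_le (L := L) hmul j 0 g l
    simp only [zero_add] at this
    refine this.trans ?_
    rw [one_mul, pow_succ']
    gcongr
    have := length_le_listWeight (ℓ := ℓ) l
    have : l.length ≤ 1 + weight L (listWeight ℓ) (g, l) := by simp only [weight]; omega
    exact_mod_cast this

lemma cone_isBddMap :
    IsBddMap (weight L (listWeight L.len)) (weight L (listWeight L.len)) cone :=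
  .lmapDomain ⟨1, 1, fun ⟨g, l⟩ => by
    simp only [weight, listWeight_cons, L.len_one, pow_one]; omega⟩

lemma proj₀_isBddMap :
    IsBddMap (weight L (listWeight ℓ)) (weight L (listWeight ℓ)) proj₀ :=
  .of_basis fun j => ⟨1, j, fun ⟨g, l⟩ => by
    cases l with
    | nil => simp [wnorm_single]
    | cons a l => rw [proj₀_cons, wnorm_zero]; positivity⟩

lemma listMap_isBddMap {H' : Type} [Group H'] {ℓ' : H' → ℕ} (f : H → H')
    (h : ∃ C N : ℕ, ∀ a, ℓ' (f a) ≤ C * (1 + ℓ a) ^ N) :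
    IsBddMap (weight L (listWeight ℓ)) (weight L (listWeight ℓ')) (listMap f) := by
  obtain ⟨C, N, hC⟩ := h
  have key : ∀ l : List H, listWeight ℓ' (l.map f) ≤
      (C + 1) * listWeight ℓ l ^ (N + 1) := fun l => by
    induction l with
    | nil => simp [listWeight_nil]
    | cons a l ih =>
      rw [List.map_cons, listWeight_cons, listWeight_cons]
      have h1 : 1 + ℓ' (f a) ≤ (C + 1) * (1 + ℓ a) ^ (N + 1) := by
        have h2 : (1 + ℓ a) ^ N ≤ (1 + ℓ a) ^ (N + 1) := Nat.pow_le_pow_right (by omega) (by omega)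
        have h3 : 1 ≤ (1 + ℓ a) ^ (N + 1) := Nat.one_le_pow _ _ (by omega)
        have h4 := Nat.mul_le_mul_left C h2
        have := hC a
        rw [add_mul]; omega
      -- Superadditivity of powers makes the constant independent of the length of the list. It
      -- needs a nonzero exponent, hence `N + 1`.
      have h5 : (1 + ℓ a) ^ (N + 1) + listWeight ℓ l ^ (N + 1) ≤
          (1 + ℓ a + listWeight ℓ l) ^ (N + 1) := pow_add_pow_le (by simp) (by simp) (by simp)
      have := Nat.mul_le_mul_left (C + 1) h5
      rw [mul_add] at this
      omega
  refine .lmapDomain ⟨C + 2, N + 1, fun ⟨g, l⟩ => ?_⟩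
  simp only [weight]
  have h1 := key l
  have h2 : listWeight ℓ l ^ (N + 1) ≤ (1 + (L.len g + listWeight ℓ l)) ^ (N + 1) :=
    Nat.pow_le_pow_left (by omega) _
  have h3 : 1 + (L.len g + listWeight ℓ l) ≤ (1 + (L.len g + listWeight ℓ l)) ^ (N + 1) :=
    Nat.le_self_pow (by omega) _
  have h4 := Nat.mul_le_mul_left (C + 1) h2
  have : (C + 2) * (1 + (L.len g + listWeight ℓ l)) ^ (N + 1) =
    (C + 1) * (1 + (L.len g + listWeight ℓ l)) ^ (N + 1) +
      (1 + (L.len g + listWeight ℓ l)) ^ (N + 1) := by ring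
  omega

end Bar

/-! ### Fox derivatives -/

namespace Fox

open FreeRep Bar

variable {G S : Type} [Group G]

/-- The affine transformation `v ↦ x + ε(x) v` of the free module on the basis. -/
def affine (ε : FreeGroup S →* G) (x : S) : Equiv.Perm (FreeRep G S) where
  toFun v := Finsupp.single (1, x) 1 + act (ε (.of x)) v
  invFun v := act (ε (.of x))⁻¹ (v - Finsupp.single (1, x) 1)
  left_inv v := by simp [act_act]
  right_inv v := by simp only [act_act]; simp

/-- The universal crossed homomorphism out of a free group. -/
def fox (ε : FreeGroup S →* G) (u : FreeGroup S) : FreeRep G S :=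
  FreeGroup.lift (affine ε) u 0

variable (ε : FreeGroup S →* G)

/-- Each letter acts by an affine map, so a word does too, and its translation part is the Fox
derivative. Composition of affine maps is the crossed product rule. -/
lemma lift_affine (u : FreeGroup S) (v : FreeRep G S) :
    FreeGroup.lift (affine ε) u v = fox ε u + act (ε u) v := by
  simp only [fox]
  induction u using FreeGroup.induction_on generalizing v with
  | C1 => simp
  | of x => simp [affine]
  | inv_of x _ =>
    rw [map_inv, FreeGroup.lift_apply_of]
    simp only [Equiv.Perm.inv_def, affine, Equiv.coe_fn_symm_mk, map_inv, map_sub, map_zero]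
    abel
  | mul u u' hu hu' =>
    rw [map_mul, Equiv.Perm.mul_apply, Equiv.Perm.mul_apply, hu, hu', hu (FreeGroup.lift (affine ε) u' 0)]
    simp [act_act, add_assoc]

@[simp]
lemma fox_one : fox ε 1 = 0 := by simp [fox]

@[simp]
lemma fox_of (x : S) : fox ε (.of x) = Finsupp.single (1, x) 1 := by simp [fox, affine]

lemma fox_mul (u v : FreeGroup S) : fox ε (u * v) = fox ε u + act (ε u) (fox ε v) := by
  rw [← lift_affine, fox, map_mul, Equiv.Perm.mul_apply]; rfl

lemma fox_inv (u : FreeGroup S) : fox ε u⁻¹ = -act (ε u⁻¹) (fox ε u) := by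
  have := fox_mul ε u⁻¹ u
  rw [inv_mul_cancel, fox_one] at this
  exact eq_neg_of_add_eq_zero_left this.symm

/-- A crossed homomorphism factors through the universal one. -/
lemma map_fox {B : Type} (φ : FreeRep G S →ₗ[ℚ] FreeRep G B) (hφ : IsEquivariant φ)
    (d : FreeGroup S → FreeRep G B) (hd : ∀ u v, d (u * v) = d u + act (ε u) (d v))
    (h : ∀ x, φ (Finsupp.single (1, x) 1) = d (.of x)) (u : FreeGroup S) :
    φ (fox ε u) = d u := by
  have h1 : d 1 = 0 := by simpa using hd 1 1
  induction u using FreeGroup.induction_on with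
  | C1 => rw [fox_one, map_zero, h1]
  | of x => rw [fox_of, h]
  | inv_of x hx =>
    rw [fox_inv, map_neg, hφ, hx]
    have := hd (.of x)⁻¹ (.of x)
    rw [inv_mul_cancel, h1] at this
    exact (eq_neg_of_add_eq_zero_left this.symm).symm
  | mul u v hu hv => rw [fox_mul, map_add, hφ, hu, hv, hd]

/-- The Fox derivative has one term for each letter, and its coefficient is the image of a prefix of
the word. The length of that image is at most `K` times the length of the word. -/
lemma wnorm_fox_le {L : WordLength G} {K : ℕ} (hε : ∀ u, L.len (ε u) ≤ K * freeLen u) (j : ℕ)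
    (u : FreeGroup S) :
    wnorm (weight L fun _ : S => 0) j (fox ε u) ≤
      freeLen u * (1 + ((K * freeLen u : ℕ) : ℝ)) ^ j := by
  obtain ⟨l, rfl, hl⟩ := exists_word u
  rw [← hl]
  clear hl
  induction l using List.reverseRecOn with
  | nil => simp [← FreeGroup.one_eq_mk]
  | append_singleton l a ih =>
    have e : FreeGroup.mk (l ++ [a]) = FreeGroup.mk l * FreeGroup.mk [a] := by
      rw [FreeGroup.mul_mk]
    have hb : ∀ l', l'.length ≤ l.length + 1 →
        L.len (ε (FreeGroup.mk l')) ≤ K * (l.length + 1) := fun l' h' =>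
      (hε _).trans (Nat.mul_le_mul_left K ((freeLen_mk_le l').trans h'))
    have h1 : wnorm (weight L fun _ : S => 0) j
        (act (ε (FreeGroup.mk l)) (fox ε (FreeGroup.mk [a]))) ≤
        (1 + ((K * (l.length + 1) : ℕ) : ℝ)) ^ j := by
      obtain ⟨x, b⟩ := a
      cases b
      -- For an inverse letter the prefix includes the letter itself.
      · have h2 : FreeGroup.mk [(x, false)] = (FreeGroup.of x)⁻¹ := rfl
        rw [h2, fox_inv, fox_of, ← h2, act_single, map_neg, act_single, wnorm_neg, wnorm_single,
          mul_one, ← map_mul, ← e]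
        simp only [Rat.cast_one, abs_one, one_mul, weight, add_zero]
        gcongr
        exact hb _ (by simp)
      · have h2 : FreeGroup.mk [(x, true)] = FreeGroup.of x := rfl
        rw [h2, fox_of, act_single, wnorm_single, mul_one]
        simp only [Rat.cast_one, abs_one, one_mul, weight, add_zero]
        gcongr
        exact hb _ (by simp)
    rw [e, fox_mul]
    refine (wnorm_add_le _ _).trans ?_
    have h3 : (l.length : ℝ) * (1 + ((K * l.length : ℕ) : ℝ)) ^ j ≤
        l.length * (1 + ((K * (l.length + 1) : ℕ) : ℝ)) ^ j := by
      gcongr; omega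
    simp only [List.length_append, List.length_singleton]
    push_cast at *
    linarith

/-- The map from the bar complex that is the Fox derivative in degree one. -/
def barFox : FreeRep G (List (FreeGroup S)) →ₗ[ℚ] FreeRep G S :=
  extend fun l => match l with
    | [u] => fox ε u
    | _ => 0

@[simp]
lemma barFox_nil (g : G) : barFox ε (Finsupp.single (g, []) 1) = 0 := by simp [barFox]

@[simp]
lemma barFox_one (g : G) (u : FreeGroup S) :
    barFox ε (Finsupp.single (g, [u]) 1) = act g (fox ε u) := by simp [barFox]

@[simp]
lemma barFox_cons_cons (g : G) (u v : FreeGroup S) (l : List (FreeGroup S)) :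
    barFox ε (Finsupp.single (g, u :: v :: l) 1) = 0 := by simp [barFox]

lemma barFox_equivariant : IsEquivariant (barFox ε) := extend_equivariant _

/-- In degree two this is the crossed product rule. In higher degrees the boundary has no component
in degree one. -/
lemma barFox_bar (v : FreeRep G (List (FreeGroup S))) : barFox ε (bar ε v) = 0 := by
  have : barFox ε ∘ₗ bar ε = 0 := hom_ext fun g l => by
    match l with
    | [] => simp [bar]
    | [a] => simp [bar, mulHead]
    | [a, x] => simp [bar, mulHead, fox_mul, act_act]
    | a :: x :: y :: t =>
      have h : ∀ (b c : FreeGroup S) (v : FreeRep G (List (FreeGroup S))),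
          barFox ε (consMap b (consMap c v)) = 0 := fun b c v => by
        have : barFox ε ∘ₗ consMap b ∘ₗ consMap c = 0 := hom_ext fun g l => by simp
        exact LinearMap.congr_fun this v
      rw [LinearMap.comp_apply, bar, LinearMap.add_apply, first_cons, inner_cons, inner_cons]
      simp [mulHead, h]
  exact LinearMap.congr_fun this v

lemma barFox_isBddMap {L : WordLength G} {K : ℕ} (hε : ∀ u, L.len (ε u) ≤ K * freeLen u) :
    IsBddMap (weight L (listWeight freeLen)) (weight L fun _ => 0) (barFox ε) := by
  refine (barFox_equivariant ε).isBddMap fun j => ⟨(1 + K : ℝ) ^ j, j + 1, fun l => ?_⟩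
  match l with
  | [] => rw [barFox_nil, wnorm_zero]; positivity
  | a :: x :: t => rw [barFox_cons_cons, wnorm_zero]; positivity
  | [u] =>
    rw [barFox_one, act_one]
    refine (wnorm_fox_le ε hε j u).trans ?_
    simp only [listWeight_cons, listWeight_nil]
    have h0 : (0 : ℝ) ≤ freeLen u := by positivity
    have h1 : (0 : ℝ) ≤ K := by positivity
    calc (freeLen u : ℝ) * (1 + ((K * freeLen u : ℕ) : ℝ)) ^ j
        ≤ (1 + ((1 + freeLen u + 0 : ℕ) : ℝ)) *
          ((1 + K) * (1 + ((1 + freeLen u + 0 : ℕ) : ℝ))) ^ j := by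
          push_cast
          gcongr
          · linarith
          · nlinarith
      _ = _ := by rw [mul_pow]; ring

end Fox

/-- The cancellation behind `d² = 0` for alternating sums of faces. -/
lemma alternating_double_sum_eq_zero {M : Type*} [AddCommGroup M] [Module ℚ M] {n : ℕ}
    (F : Fin (n + 2) → Fin (n + 3) → M) (hF : ∀ i j : Fin (n + 2), i ≤ j →
      F i j.succ = F j i.castSucc) :
    ∑ i : Fin (n + 2), ∑ j : Fin (n + 3), ((-1 : ℚ) ^ (i : ℕ) * (-1 : ℚ) ^ (j : ℕ)) • F i j = 0 := by
  rw [← Finset.sum_product']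
  have h := Finset.sum_filter_add_sum_filter_not
    (Finset.univ ×ˢ Finset.univ : Finset (Fin (n + 2) × Fin (n + 3)))
    (fun p => p.1.castSucc < p.2)
    (fun p => ((-1 : ℚ) ^ (p.1 : ℕ) * (-1 : ℚ) ^ (p.2 : ℕ)) • F p.1 p.2)
  rw [← h, ← eq_neg_iff_add_eq_zero, ← Finset.sum_neg_distrib]
  refine Finset.sum_bij'
    (fun p hp => (p.2.pred (Fin.ne_zero_of_lt (Finset.mem_filter.1 hp).2), p.1.castSucc))
    (fun p hp => (p.2.castLT (by
      have := (Finset.mem_filter.1 hp).2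
      rw [not_lt, Fin.le_def] at this
      exact lt_of_le_of_lt this (by simp)), p.1.succ)) ?_ ?_ ?_ ?_ ?_
  · rintro ⟨i, j⟩ hp
    simp only [Finset.mem_filter, Finset.mem_product, Finset.mem_univ, true_and, Fin.lt_def,
      Fin.val_castSucc, Fin.val_pred] at hp ⊢
    omega
  · rintro ⟨i, j⟩ hp
    simp only [Finset.mem_filter, Finset.mem_product, Finset.mem_univ, true_and, Fin.lt_def,
      Fin.val_castSucc, Fin.val_castLT, Fin.val_succ] at hp ⊢
    omega
  · rintro ⟨i, j⟩ hp; simp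
  · rintro ⟨i, j⟩ hp; simp
  · rintro ⟨i, j⟩ hp
    have hij := (Finset.mem_filter.1 hp).2
    obtain ⟨j, rfl⟩ := Fin.exists_succ_eq.2 (Fin.ne_zero_of_lt hij)
    rw [← neg_smul]
    simp only [Fin.pred_succ, Fin.val_succ, Fin.val_castSucc]
    rw [hF i j (Fin.castSucc_lt_succ_iff.1 hij)]
    congr 1
    ring

namespace KanLoop

open FreeRep Bar Fox

variable {X : SSet.{0}} {π : Type} [Group π] {ε : Grp X 0 →* π}

/-! ### The contraction of the augmented loop group -/

variable (X) in
/-- The iterated degeneracy `(GX)_0 → (GX)_n`. -/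
def const : (n : ℕ) → Grp X 0 →* Grp X n
  | 0 => MonoidHom.id _
  | n + 1 => (degen X n 0).comp (const n)

lemma face_const (n : ℕ) (j : Fin (n + 2)) (w : Grp X 0) :
    face X n j (const X (n + 1) w) = const X n w := by
  induction n with
  | zero =>
    have : j = Fin.castSucc 0 ∨ j = Fin.succ 0 := by fin_cases j <;> simp
    rcases this with rfl | rfl
    · exact face_degen_self _ _
    · exact face_degen_succ _ _
  | succ n ih =>
    change face X (n + 1) j (degen X (n + 1) 0 (const X (n + 1) w)) = _
    induction j using Fin.cases with
    | zero => exact face_degen_self 0 _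
    | succ j =>
      induction j using Fin.cases with
      | zero => exact face_degen_succ 0 _
      | succ j =>
        have := face_degen_of_gt (X := X) (i := j.succ) (j := 0) (Fin.succ_pos j)
          (const X (n + 1) w)
        rw [Fin.castSucc_zero] at this
        rw [this, ih]
        rfl

lemma IsAugmentation.aug_const (hε : IsAugmentation ε) (n : ℕ) (w : Grp X 0) :
    aug ε n (const X n w) = ε w := by
  induction n with
  | zero => rfl
  | succ n ih =>
    change aug ε (n + 1) (degen X n 0 (const X n w)) = _
    rw [hε.aug_degen, ih]

lemma freeLen_const_le (n : ℕ) (w : Grp X 0) : freeLen (const X n w) ≤ freeLen w := by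
  induction n with
  | zero => exact le_rfl
  | succ n ih => exact (freeLen_degen_le _ _).trans ih

lemma inducedLength_le {S G : Type} [Group G] (ε : FreeGroup S →* G)
    (hε : Function.Surjective ε) (w : FreeGroup S) : (inducedLength ε hε).len (ε w) ≤ freeLen w :=
  Nat.sInf_le ⟨w, rfl, rfl⟩

lemma exists_geodesic {S G : Type} [Group G] (ε : FreeGroup S →* G)
    (hε : Function.Surjective ε) (g : G) :
    ∃ w, ε w = g ∧ freeLen w = (inducedLength ε hε).len g :=
  Nat.sInf_mem (Set.Nonempty.image freeLen (hε g))

/-- A shortest representative of a group element. -/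
def geodesic (hε : IsAugmentation ε) (g : π) : Grp X 0 :=
  (exists_geodesic ε hε.surjective g).choose

lemma aug_geodesic (hε : IsAugmentation ε) (g : π) : ε (geodesic hε g) = g :=
  (exists_geodesic ε hε.surjective g).choose_spec.1

lemma freeLen_geodesic (hε : IsAugmentation ε) (g : π) :
    freeLen (geodesic hε g) = (inducedLength ε hε.surjective).len g :=
  (exists_geodesic ε hε.surjective g).choose_spec.2

lemma len_aug_le (hε : IsAugmentation ε) (n : ℕ) (w : Grp X n) :
    (inducedLength ε hε.surjective).len (aug ε n w) ≤ 2 ^ n * freeLen w := by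
  induction n with
  | zero => rw [pow_zero, one_mul]; exact inducedLength_le ε hε.surjective w
  | succ n ih =>
    have h1 := ih (face X n 0 w)
    have h2 := Nat.mul_le_mul_left (2 ^ n) (freeLen_face_le 0 w)
    have : 2 ^ (n + 1) * freeLen w = 2 ^ n * (2 * freeLen w) := by ring
    rw [this]
    exact h1.trans h2

/-- The contraction of the kernel of the augmentation extended to the loop group, with respect to
the section of the augmentation by geodesics. -/
def extra (hε : IsAugmentation ε) (s : ∀ n, Grp X n → Grp X (n + 1)) (n : ℕ) (x : Grp X n) :
    Grp X (n + 1) :=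
  s n (x * (const X n (geodesic hε (aug ε n x)))⁻¹) * const X (n + 1) (geodesic hε (aug ε n x))

variable (hε : IsAugmentation ε) {s : ∀ n, Grp X n → Grp X (n + 1)}

include hε in
lemma mul_inv_const_mem (n : ℕ) (x : Grp X n) :
    x * (const X n (geodesic hε (aug ε n x)))⁻¹ ∈ (aug ε n).ker := by
  rw [MonoidHom.mem_ker, map_mul, map_inv, hε.aug_const, aug_geodesic, mul_inv_cancel]

/-- Faces preserve the augmentation and carry constant simplices to constant simplices. Hence
dividing by the geodesic, contracting and multiplying back preserves the face identities. -/
lemma face_last_extra (hs : ∀ m, IsContraction ε m s) (n : ℕ) (x : Grp X n) :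
    face X n (Fin.last (n + 1)) (extra hε s n x) = x := by
  rw [extra, map_mul, (hs (n + 1)).face_last n (by omega) _ (mul_inv_const_mem hε n x), face_const]
  simp

lemma face_extra_zero (hs : ∀ m, IsContraction ε m s) (x : Grp X 0) :
    face X 0 0 (extra hε s 0 x) = geodesic hε (ε x) := by
  rw [extra, map_mul, (hs 1).face_zero (by omega) _ (mul_inv_const_mem hε 0 x), face_const]
  simp [const, aug]

lemma face_extra_succ (hs : ∀ m, IsContraction ε m s) (n : ℕ) (j : Fin (n + 2))
    (x : Grp X (n + 1)) :
    face X (n + 1) j.castSucc (extra hε s (n + 1) x) = extra hε s n (face X n j x) := by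
  rw [extra, map_mul,
    (hs (n + 2)).face_succ n (by omega) _ (mul_inv_const_mem hε (n + 1) x), face_const, map_mul,
    map_inv, face_const, extra, hε.aug_face]

lemma extra_bounded {n : ℕ} (hb : IsPolyBounded ε n (s n)) :
    ∃ C N : ℕ, ∀ x, freeLen (extra hε s n x) ≤ C * (1 + freeLen x) ^ N := by
  obtain ⟨C, N, hC⟩ := hb
  refine ⟨C * (1 + 2 ^ n) ^ N + 2 ^ n, N + 1, fun x => ?_⟩
  have hg : ∀ m, freeLen (const X m (geodesic hε (aug ε n x))) ≤ 2 ^ n * freeLen x := fun m =>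
    (freeLen_const_le m _).trans ((freeLen_geodesic hε _).trans_le (len_aug_le hε n x))
  have h1 : 1 + freeLen (x * (const X n (geodesic hε (aug ε n x)))⁻¹) ≤
      (1 + 2 ^ n) * (1 + freeLen x) := by
    have := freeLen_mul_le x (const X n (geodesic hε (aug ε n x)))⁻¹
    rw [freeLen_inv] at this
    have h2 := hg n
    have : (1 + 2 ^ n) * (1 + freeLen x) = 1 + freeLen x + 2 ^ n + 2 ^ n * freeLen x := by ring
    rw [this]
    have := Nat.one_le_two_pow (n := n)
    linarith
  have h3 : 1 + freeLen x ≤ (1 + freeLen x) ^ (N + 1) := Nat.le_self_pow (by omega) _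
  have h4 : (1 + freeLen x) ^ N ≤ (1 + freeLen x) ^ (N + 1) :=
    Nat.pow_le_pow_right (by omega) (by omega)
  calc freeLen (extra hε s n x)
      ≤ C * ((1 + 2 ^ n) * (1 + freeLen x)) ^ N + 2 ^ n * freeLen x := by
        refine (freeLen_mul_le _ _).trans (add_le_add ?_ (hg _))
        exact (hC _ (mul_inv_const_mem hε n x)).trans (by gcongr)
    _ ≤ C * ((1 + 2 ^ n) ^ N * (1 + freeLen x) ^ (N + 1)) +
        2 ^ n * (1 + freeLen x) ^ (N + 1) := by
        rw [mul_pow]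
        gcongr
        omega
    _ = _ := by ring

/-! ### The comparison of the bar resolution with the bar complexes of the loop group -/

variable (X π) in
/-- The alternating sum of the faces on the bar complexes of the loop group. -/
def barBoundary (n : ℕ) :
    FreeRep π (List (Grp X (n + 1))) →ₗ[ℚ] FreeRep π (List (Grp X n)) :=
  ∑ j : Fin (n + 2), (-1 : ℚ) ^ (j : ℕ) • listMap (face X n j)

include hε in
lemma barBoundary_bar (n : ℕ) (v : FreeRep π (List (Grp X (n + 1)))) :
    barBoundary X π n (bar (aug ε (n + 1)) v) = bar (aug ε n) (barBoundary X π n v) := by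
  simp only [barBoundary, LinearMap.sum_apply, LinearMap.smul_apply, map_sum, map_smul]
  refine Finset.sum_congr rfl fun j _ => ?_
  rw [bar_listMap (aug ε (n + 1)) (face X n j) fun x => hε.aug_face n j x]

lemma barBoundary_extra_zero (hs : ∀ m, IsContraction ε m s) (v : FreeRep π (List (Grp X 0))) :
    barBoundary X π 0 (listMap (extra hε s 0) v) = listMap (geodesic hε) (listMap ε v) - v := by
  have h0 : (face X 0 0 : Grp X 1 → Grp X 0) ∘ extra hε s 0 = geodesic hε ∘ ε :=
    funext (face_extra_zero hε hs)
  have h1 : (face X 0 1 : Grp X 1 → Grp X 0) ∘ extra hε s 0 = fun x => x :=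
    funext (face_last_extra hε hs 0)
  rw [barBoundary, LinearMap.sum_apply, Fin.sum_univ_two, LinearMap.smul_apply,
    LinearMap.smul_apply, listMap_listMap, listMap_listMap, listMap_listMap, h0, h1, listMap_id]
  simp [sub_eq_add_neg]

lemma barBoundary_extra_succ (hs : ∀ m, IsContraction ε m s) (n : ℕ)
    (v : FreeRep π (List (Grp X (n + 1)))) :
    barBoundary X π (n + 1) (listMap (extra hε s (n + 1)) v) =
      listMap (extra hε s n) (barBoundary X π n v) + (-1 : ℚ) ^ n • v := by
  have h0 : ∀ j, (face X (n + 1) (Fin.castSucc j) : Grp X (n + 2) → Grp X (n + 1)) ∘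
      extra hε s (n + 1) = extra hε s n ∘ face X n j :=
    fun j => funext (face_extra_succ hε hs n j)
  have h1 : (face X (n + 1) (Fin.last (n + 2)) : Grp X (n + 2) → Grp X (n + 1)) ∘
      extra hε s (n + 1) = fun x => x := funext (face_last_extra hε hs (n + 1))
  simp only [barBoundary, LinearMap.sum_apply, LinearMap.smul_apply]
  rw [Fin.sum_univ_castSucc]
  simp only [listMap_listMap, h0, h1, listMap_id, map_sum, map_smul, Fin.val_castSucc,
    Fin.val_last]
  congr 2
  ring

variable (s) in
/-- The components of the chain map from the bar resolution to the total complex of the bar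
complexes of the loop group. -/
def barLift : (n : ℕ) → FreeRep π (List π) →ₗ[ℚ] FreeRep π (List (Grp X n))
  | 0 => listMap (geodesic hε)
  | n + 1 => (-1 : ℚ) ^ (n + 1) • listMap (extra hε s n) ∘ₗ
      (barLift n ∘ₗ bar (MonoidHom.id π) + (-1 : ℚ) ^ (n + 1) • bar (aug ε n) ∘ₗ barLift n)

lemma barLift_succ (n : ℕ) (v : FreeRep π (List π)) : barLift hε s (n + 1) v =
    (-1 : ℚ) ^ (n + 1) • listMap (extra hε s n)
      (barLift hε s n (bar (MonoidHom.id π) v) +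
        (-1 : ℚ) ^ (n + 1) • bar (aug ε n) (barLift hε s n v)) := rfl

lemma neg_one_pow_smul_smul {M : Type*} [AddCommGroup M] [Module ℚ M] (n : ℕ) (v : M) :
    (-1 : ℚ) ^ n • (-1 : ℚ) ^ n • v = v := by
  rw [smul_smul, ← mul_pow]; simp

/-- This is the chain map equation in the total complex. The component of index `n` sends bar degree
`p` to bar degree `p - n` of `Γ_n`, and each one repairs the failure of the previous one to commute
with the bar differential. -/
lemma barBoundary_barLift (hs : ∀ m, IsContraction ε m s) (n : ℕ) (v : FreeRep π (List π)) :
    barBoundary X π n (barLift hε s (n + 1) v) =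
      barLift hε s n (bar (MonoidHom.id π) v) +
        (-1 : ℚ) ^ (n + 1) • bar (aug ε n) (barLift hε s n v) := by
  induction n generalizing v with
  | zero =>
    -- Geodesics form a section of `ε`, so the defect of `barLift 0` vanishes after applying `ε`,
    -- and contracting it leaves no residual term.
    have hl : ∀ v, listMap ε (barLift hε s 0 v) = v := fun v => by
      have : (ε : Grp X 0 → π) ∘ geodesic hε = fun x => x := funext (aug_geodesic hε)
      rw [barLift, listMap_listMap, this, listMap_id]
    rw [barLift_succ, map_smul, barBoundary_extra_zero hε hs, map_add, map_smul,
      ← bar_listMap (aug ε 0) (ε' := MonoidHom.id π) ε (fun _ => rfl), hl, hl]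
    simp [add_comm]
  | succ n ih =>
    -- The defect at stage `n + 1` is a cycle for the alternating sum of faces, so the contraction
    -- exhibits it as a boundary.
    have hz : barBoundary X π n (barLift hε s (n + 1) (bar (MonoidHom.id π) v) +
        (-1 : ℚ) ^ (n + 2) • bar (aug ε (n + 1)) (barLift hε s (n + 1) v)) = 0 := by
      rw [map_add, map_smul, barBoundary_bar hε, ih, ih, bar_bar, map_zero, zero_add, map_add,
        map_smul, bar_bar, smul_zero, add_zero, pow_succ _ (n + 1)]
      module
    have e : (-1 : ℚ) ^ n = (-1 : ℚ) ^ (n + 2) := by ring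
    rw [barLift_succ, map_smul, barBoundary_extra_succ hε hs, hz, map_zero, zero_add, e,
      neg_one_pow_smul_smul]

lemma barLift_equivariant (n : ℕ) : IsEquivariant (barLift hε s n) := by
  induction n with
  | zero => exact listMap_equivariant _
  | succ n ih =>
    exact (((listMap_equivariant _).comp ((ih.comp (bar_equivariant _)).add
      (((bar_equivariant _).comp ih).smul _))).smul _)

end KanLoop

namespace KanLoop

open FreeRep Bar Fox

variable {X : SSet.{0}} {π : Type} [Group π] {ε : Grp X 0 →* π}

/-! ### The complex of relative differentials of the loop group -/

variable (ε) in
/-- The faces of the simplicial module of relative differentials of the loop group. -/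
def genFace (n : ℕ) (j : Fin (n + 2)) :
    FreeRep π (Gen X (n + 1)) →ₗ[ℚ] FreeRep π (Gen X n) :=
  extend fun x => fox (aug ε n) (face X n j (.of x))

variable (ε) in
/-- The alternating sum of the faces of relative differentials. -/
def genBoundary (n : ℕ) : FreeRep π (Gen X (n + 1)) →ₗ[ℚ] FreeRep π (Gen X n) :=
  ∑ j : Fin (n + 2), (-1 : ℚ) ^ (j : ℕ) • genFace ε n j

lemma genBoundary_apply (n : ℕ) (v : FreeRep π (Gen X (n + 1))) :
    genBoundary ε n v = ∑ j : Fin (n + 2), (-1 : ℚ) ^ (j : ℕ) • genFace ε n j v := by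
  simp [genBoundary]

lemma genFace_equivariant (n : ℕ) (j : Fin (n + 2)) :
    IsEquivariant (genFace (X := X) ε n j) := extend_equivariant _

lemma genBoundary_equivariant (n : ℕ) : IsEquivariant (genBoundary ε n) := fun g v => by
  simp only [genBoundary_apply, map_sum, map_smul]
  refine Finset.sum_congr rfl fun j _ => ?_
  rw [genFace_equivariant]

variable (hε : IsAugmentation ε) {s : ∀ n, Grp X n → Grp X (n + 1)}

include hε

/-- Both sides are crossed homomorphisms agreeing on the generators. This transfers the simplicial
identities to the relative differentials. -/
lemma genFace_fox (n : ℕ) (j : Fin (n + 2)) (w : Grp X (n + 1)) :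
    genFace ε n j (fox (aug ε (n + 1)) w) = fox (aug ε n) (face X n j w) :=
  map_fox _ _ (genFace_equivariant n j) (fun w => fox (aug ε n) (face X n j w))
    (fun u v => by rw [map_mul, fox_mul, hε.aug_face]) (fun x => by rw [genFace, extend_single, act_one]) w

lemma genFace_genFace (n : ℕ) {i j : Fin (n + 2)} (h : i ≤ j)
    (v : FreeRep π (Gen X (n + 2))) :
    genFace ε n i (genFace ε (n + 1) j.succ v) =
      genFace ε n j (genFace ε (n + 1) i.castSucc v) := by
  have : genFace ε n i ∘ₗ genFace ε (n + 1) j.succ =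
      genFace ε n j ∘ₗ genFace ε (n + 1) i.castSucc :=
    ((genFace_equivariant _ _).comp (genFace_equivariant _ _)).hom_ext
      ((genFace_equivariant _ _).comp (genFace_equivariant _ _)) fun x => by
        rw [LinearMap.comp_apply, LinearMap.comp_apply, ← fox_of (aug ε (n + 2)),
          genFace_fox hε, genFace_fox hε, genFace_fox hε, genFace_fox hε, face_face h]
  exact LinearMap.congr_fun this v

lemma genBoundary_genBoundary (n : ℕ) (v : FreeRep π (Gen X (n + 2))) :
    genBoundary ε n (genBoundary ε (n + 1) v) = 0 := by
  rw [genBoundary_apply]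
  simp only [genBoundary_apply (n + 1), map_sum, map_smul, Finset.smul_sum, smul_smul]
  exact alternating_double_sum_eq_zero
    (fun i j => genFace ε n i (genFace ε (n + 1) j v)) fun i j h => genFace_genFace hε n h v

lemma barFox_barBoundary (n : ℕ) (v : FreeRep π (List (Grp X (n + 1)))) :
    barFox (aug ε n) (barBoundary X π n v) = genBoundary ε n (barFox (aug ε (n + 1)) v) := by
  have h : ∀ j, barFox (aug ε n) (listMap (face X n j) v) =
      genFace ε n j (barFox (aug ε (n + 1)) v) := fun j => by
    have : barFox (aug ε n) ∘ₗ listMap (face X n j) = genFace ε n j ∘ₗ barFox (aug ε (n + 1)) :=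
      hom_ext fun g l => by
        match l with
        | [] => simp
        | [a] =>
          rw [LinearMap.comp_apply, LinearMap.comp_apply, listMap_single, List.map_cons,
            List.map_nil, barFox_one, barFox_one, genFace_equivariant,
            genFace_fox hε]
        | a :: x :: t => simp
    exact LinearMap.congr_fun this v
  simp [barBoundary, genBoundary, h]

omit hε in
variable (s) in
/-- The chain map from the bar resolution to the relative differentials of the loop group. -/
def barToGen (hε : IsAugmentation ε) (n : ℕ) : FreeRep π (List π) →ₗ[ℚ] FreeRep π (Gen X n) :=
  barFox (aug ε n) ∘ₗ barLift hε s n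

omit hε in
lemma barToGen_equivariant (hε : IsAugmentation ε) (n : ℕ) :
    IsEquivariant (barToGen s hε n) :=
  (barFox_equivariant _).comp (barLift_equivariant hε n)

/-- The term of `barBoundary_barLift` lying in the image of the bar differential disappears under
Fox derivatives, leaving a chain map up to the shift of degree by one. -/
lemma genBoundary_barToGen (hs : ∀ m, IsContraction ε m s) (n : ℕ) (v : FreeRep π (List π)) :
    genBoundary ε n (barToGen s hε (n + 1) v) =
      barToGen s hε n (bar (MonoidHom.id π) v) := by
  rw [barToGen, LinearMap.comp_apply, ← barFox_barBoundary hε, barBoundary_barLift hε hs, map_add,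
    map_smul, barFox_bar, smul_zero, add_zero]
  rfl

lemma barLift_isBddMap {n : ℕ} (hb : ∀ m < n, IsPolyBounded ε m (s m)) :
    IsBddMap (weight (inducedLength ε hε.surjective) (listWeight
        (inducedLength ε hε.surjective).len))
      (weight (inducedLength ε hε.surjective) (listWeight freeLen)) (barLift hε s n) := by
  induction n with
  | zero =>
    refine listMap_isBddMap _ ⟨1, 1, fun g => ?_⟩
    rw [freeLen_geodesic, pow_one]
    omega
  | succ n ih =>
    have ih' := ih fun m hm => hb m (by omega)
    have h1 := bar_isBddMap (L := inducedLength ε hε.surjective)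
      (ℓ := (inducedLength ε hε.surjective).len) (inducedLength ε hε.surjective).len_mul
      (MonoidHom.id π) (K := 1) (fun a => by simp)
    have h2 := bar_isBddMap (L := inducedLength ε hε.surjective) freeLen_mul_le (aug ε n)
      (len_aug_le hε n)
    exact (((listMap_isBddMap _ (extra_bounded hε (hb n (by omega)))).comp
      ((ih'.comp h1).add ((h2.comp ih').smul _))).smul _)

lemma barToGen_isBddMap {n : ℕ} (hb : ∀ m < n, IsPolyBounded ε m (s m)) :
    IsBddMap (weight (inducedLength ε hε.surjective) (listWeight
        (inducedLength ε hε.surjective).len))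
      (weight (inducedLength ε hε.surjective) fun _ => 0) (barToGen s hε n) :=
  (barFox_isBddMap _ (len_aug_le hε n)).comp (barLift_isBddMap hε hb)

omit hε

variable (ε) in
/-- The chain map from the relative differentials of the loop group to the bar resolution. -/
def genToBar : (n : ℕ) → FreeRep π (Gen X n) →ₗ[ℚ] FreeRep π (List π)
  | 0 => extend fun x => Finsupp.single (1, [ε (.of x)]) 1
  | n + 1 => extend fun x => cone (genToBar n (genBoundary ε n (Finsupp.single (1, x) 1)))

lemma genToBar_succ_single (n : ℕ) (x : Gen X (n + 1)) :
    genToBar ε (n + 1) (Finsupp.single (1, x) 1) =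
      cone (genToBar ε n (genBoundary ε n (Finsupp.single (1, x) 1))) := by
  rw [genToBar, extend_single, act_one]

lemma genToBar_equivariant (n : ℕ) : IsEquivariant (genToBar ε n) := by
  cases n <;> exact extend_equivariant _

lemma augm_genToBar (n : ℕ) (v : FreeRep π (Gen X n)) : augm (genToBar ε n v) = 0 := by
  have : augm ∘ₗ genToBar ε n = 0 := hom_ext fun g b => by
    cases n with
    | zero => simp [genToBar]
    | succ n => simp [genToBar, augm_act, augm_cone]
  exact LinearMap.congr_fun this v

/-- The fundamental formula of Fox calculus, obtained from the universal property: `ε u - 1` is a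
crossed homomorphism. -/
lemma bar_genToBar_zero (u : Grp X 0) : bar (MonoidHom.id π) (genToBar ε 0 (fox ε u)) =
    Finsupp.single (ε u, []) 1 - Finsupp.single (1, []) 1 := by
  refine map_fox ε (bar (MonoidHom.id π) ∘ₗ genToBar ε 0)
    ((bar_equivariant _).comp (genToBar_equivariant 0))
    (fun u => Finsupp.single (ε u, []) 1 - Finsupp.single (1, []) 1) (fun u v => ?_)
    (fun x => ?_) u
  · simp
  · simp [genToBar, bar, mulHead, sub_eq_add_neg]

include hε

/-- `genToBar` lifts through the contraction of the bar resolution, so it suffices that the element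
being coned is a cycle. In the lowest degree this is `ε ∘ ∂_0 = ε ∘ ∂_1`; afterwards it is `d² = 0`.
-/
lemma bar_genToBar_succ (n : ℕ) (v : FreeRep π (Gen X (n + 1))) :
    bar (MonoidHom.id π) (genToBar ε (n + 1) v) = genToBar ε n (genBoundary ε n v) := by
  induction n with
  | zero =>
    refine LinearMap.congr_fun (IsEquivariant.hom_ext
      (φ := bar (MonoidHom.id π) ∘ₗ genToBar ε 1) (ψ := genToBar ε 0 ∘ₗ genBoundary ε 0)
      ((bar_equivariant _).comp (genToBar_equivariant 1))
      ((genToBar_equivariant 0).comp (genBoundary_equivariant 0)) fun x => ?_) v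
    rw [LinearMap.comp_apply, LinearMap.comp_apply, genToBar_succ_single]
    refine bar_cone ?_ (augm_genToBar _ _)
    rw [genBoundary_apply, Fin.sum_univ_two, ← fox_of (aug ε 1), genFace_fox hε,
      genFace_fox hε, map_add, map_add, map_smul, map_smul, map_smul, map_smul]
    change _ • bar _ (genToBar ε 0 (fox ε _)) + _ • bar _ (genToBar ε 0 (fox ε _)) = 0
    rw [bar_genToBar_zero, bar_genToBar_zero]
    have := DFunLike.congr_fun hε.comp_face (FreeGroup.of x)
    simp only [MonoidHom.comp_apply] at this
    rw [this]
    simp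
  | succ n ih =>
    refine LinearMap.congr_fun (IsEquivariant.hom_ext
      (φ := bar (MonoidHom.id π) ∘ₗ genToBar ε (n + 2))
      (ψ := genToBar ε (n + 1) ∘ₗ genBoundary ε (n + 1))
      ((bar_equivariant _).comp (genToBar_equivariant _))
      ((genToBar_equivariant _).comp (genBoundary_equivariant _)) fun x => ?_) v
    rw [LinearMap.comp_apply, LinearMap.comp_apply, genToBar_succ_single]
    refine bar_cone ?_ (augm_genToBar _ _)
    rw [ih, genBoundary_genBoundary hε, map_zero]

/-! ### The endomorphism of the bar resolution factoring through relative differentials -/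

omit hε in
variable (s) in
/-- A chain endomorphism of the bar resolution which factors in positive degrees through
finitely generated modules. -/
def endo (hε : IsAugmentation ε) : ℕ → FreeRep π (List π) →ₗ[ℚ] FreeRep π (List π)
  | 0 => proj₀
  | p + 1 => genToBar ε p ∘ₗ barToGen s hε p

omit hε in
lemma endo_equivariant (hε : IsAugmentation ε) (p : ℕ) : IsEquivariant (endo s hε p) := by
  cases p with
  | zero => exact proj₀_equivariant
  | succ p => exact (genToBar_equivariant p).comp (barToGen_equivariant hε p)

lemma bar_endo (hs : ∀ m, IsContraction ε m s) (p : ℕ) (v : FreeRep π (List π)) :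
    bar (MonoidHom.id π) (endo s hε (p + 1) v) = endo s hε p (bar (MonoidHom.id π) v) := by
  cases p with
  | zero =>
    have : bar (MonoidHom.id π) ∘ₗ endo s hε 1 = endo s hε 0 ∘ₗ bar (MonoidHom.id π) :=
      ((bar_equivariant _).comp (endo_equivariant hε 1)).hom_ext
        ((endo_equivariant hε 0).comp (bar_equivariant _)) fun l => by
          simp only [LinearMap.comp_apply, endo, barToGen, barLift, listMap_single]
          match l with
          | [] => simp [bar]
          | [a] =>
            rw [List.map_cons, List.map_nil, barFox_one, act_one]
            change bar _ (genToBar ε 0 (fox ε _)) = _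
            rw [bar_genToBar_zero, aug_geodesic]
            simp [bar, mulHead, sub_eq_add_neg]
          | a :: x :: t =>
            -- In bar degree at least two both sides vanish: the Fox derivative sees only degree
            -- one, and the boundary has no part in degree zero.
            rw [proj₀_eq_zero (p := t.length) (bar_mem_deg _ _ rfl)]
            simp
    exact LinearMap.congr_fun this v
  | succ p =>
    rw [endo, LinearMap.comp_apply, bar_genToBar_succ hε, genBoundary_barToGen hε hs]
    rfl

omit hε in
variable (s) in
/-- The homotopy from the identity of the bar resolution to `endo`. -/
def homotopy (hε : IsAugmentation ε) : ℕ → FreeRep π (List π) →ₗ[ℚ] FreeRep π (List π)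
  | 0 => 0
  | p + 1 => extend fun l => cone (endo s hε (p + 1) (Finsupp.single (1, l) 1) -
      Finsupp.single (1, l) 1 - homotopy hε p (bar (MonoidHom.id π) (Finsupp.single (1, l) 1)))

omit hε in
lemma homotopy_succ_single (hε : IsAugmentation ε) (p : ℕ) (l : List π) :
    homotopy s hε (p + 1) (Finsupp.single (1, l) 1) =
      cone (endo s hε (p + 1) (Finsupp.single (1, l) 1) - Finsupp.single (1, l) 1 -
        homotopy s hε p (bar (MonoidHom.id π) (Finsupp.single (1, l) 1))) := by
  rw [homotopy, extend_single, act_one]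

omit hε in
lemma homotopy_equivariant (hε : IsAugmentation ε) (p : ℕ) :
    IsEquivariant (homotopy s hε p) := by
  cases p with
  | zero => exact fun g v => by simp [homotopy]
  | succ p => exact extend_equivariant _

omit hε in
lemma augm_homotopy (hε : IsAugmentation ε) (p : ℕ) (v : FreeRep π (List π)) :
    augm (homotopy s hε p v) = 0 := by
  have : augm ∘ₗ homotopy s hε p = 0 := hom_ext fun g b => by
    cases p with
    | zero => simp [homotopy]
    | succ p => simp only [homotopy, LinearMap.comp_apply, extend_single, augm_act, augm_cone]; rfl
  exact LinearMap.congr_fun this v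

omit hε in
-- The homotopy is a cone on basis elements, so its equation reduces to the coned element being a
-- cycle. Equivariance carries it from `(1, l)` to `(g, l)`.
lemma bar_homotopy_of (hε : IsAugmentation ε) (p : ℕ)
    (h : ∀ l : List π, l.length = p + 1 →
      bar (MonoidHom.id π) (endo s hε (p + 1) (Finsupp.single (1, l) 1)) -
        bar (MonoidHom.id π) (Finsupp.single (1, l) 1) -
        bar (MonoidHom.id π) (homotopy s hε p (bar (MonoidHom.id π) (Finsupp.single (1, l) 1))) = 0)
    {v : FreeRep π (List π)} (hv : v ∈ deg π π (p + 1)) :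
    bar (MonoidHom.id π) (homotopy s hε (p + 1) v) +
      homotopy s hε p (bar (MonoidHom.id π) v) = endo s hε (p + 1) v - v := by
  refine deg_ext (φ := bar (MonoidHom.id π) ∘ₗ homotopy s hε (p + 1) +
      homotopy s hε p ∘ₗ bar (MonoidHom.id π)) (ψ := endo s hε (p + 1) - LinearMap.id)
      (fun g l hl => ?_) hv
  have e : Finsupp.single (g, l) (1 : ℚ) = act g (Finsupp.single (1, l) 1) := by simp
  have key : bar (MonoidHom.id π) (homotopy s hε (p + 1) (Finsupp.single (1, l) 1)) =
      endo s hε (p + 1) (Finsupp.single (1, l) 1) - Finsupp.single (1, l) 1 -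
        homotopy s hε p (bar (MonoidHom.id π) (Finsupp.single (1, l) 1)) := by
    rw [homotopy_succ_single]
    refine bar_cone ?_ ?_
    · rw [map_sub, map_sub, h l hl]
    · rw [map_sub, map_sub, augm_homotopy, endo, LinearMap.comp_apply, augm_genToBar,
        augm_eq_zero (hl ▸ single_mem_deg 1 l 1)]
      simp
  simp only [LinearMap.add_apply, LinearMap.comp_apply, LinearMap.sub_apply, LinearMap.id_apply]
  rw [e, homotopy_equivariant, bar_equivariant, key, bar_equivariant, homotopy_equivariant,
    endo_equivariant]
  simp only [map_sub]
  abel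

lemma bar_homotopy (hs : ∀ m, IsContraction ε m s) (p : ℕ) {v : FreeRep π (List π)}
    (hv : v ∈ deg π π (p + 1)) :
    bar (MonoidHom.id π) (homotopy s hε (p + 1) v) +
      homotopy s hε p (bar (MonoidHom.id π) v) = endo s hε (p + 1) v - v := by
  induction p generalizing v with
  | zero =>
    refine bar_homotopy_of hε 0 (fun l hl => ?_) hv
    rw [bar_endo hε hs, homotopy, endo, proj₀_eq_self (bar_mem_deg _ _ hl)]
    simp
  | succ p ih =>
    refine bar_homotopy_of hε (p + 1) (fun l hl => ?_) hv
    have := ih (bar_mem_deg (MonoidHom.id π) 1 hl)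
    rw [bar_bar, map_zero, add_zero] at this
    rw [bar_endo hε hs, this, sub_self]

/-- Only the way into the finitely generated module needs growth bounds; the way back is bounded
because it is equivariant on a finite basis. Degree `p + 1` uses `s m` for `m < p`. -/
lemma endo_isBddMap [∀ n, Finite (Gen X n)] {p : ℕ}
    (hb : ∀ m, m + 1 < p → IsPolyBounded ε m (s m)) :
    IsBddMap (weight (inducedLength ε hε.surjective) (listWeight
        (inducedLength ε hε.surjective).len))
      (weight (inducedLength ε hε.surjective) (listWeight
        (inducedLength ε hε.surjective).len)) (endo s hε p) := by
  cases p with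
  | zero => exact proj₀_isBddMap
  | succ p =>
    exact (genToBar_equivariant p).isBddMap_of_finite.comp
      (barToGen_isBddMap hε fun m hm => hb m (by omega))

lemma homotopy_isBddMap [∀ n, Finite (Gen X n)] {p : ℕ}
    (hb : ∀ m, m + 1 < p → IsPolyBounded ε m (s m)) :
    IsBddMap (weight (inducedLength ε hε.surjective) (listWeight
        (inducedLength ε hε.surjective).len))
      (weight (inducedLength ε hε.surjective) (listWeight
        (inducedLength ε hε.surjective).len)) (homotopy s hε p) := by
  induction p with
  | zero => exact .zero
  | succ p ih =>
    have h1 := bar_isBddMap (L := inducedLength ε hε.surjective)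
      (ℓ := (inducedLength ε hε.surjective).len) (inducedLength ε hε.surjective).len_mul
      (MonoidHom.id π) (K := 1) (fun a => by simp)
    have h2 := (cone_isBddMap (G := π)).comp (((endo_isBddMap hε hb).sub .id).sub
      ((ih fun m hm => hb m (by omega)).comp h1))
    -- The cone is bounded but not equivariant, so its bound is used only on the elements `(1, l)`
    -- and then spread by equivariance.
    refine (homotopy_equivariant hε (p + 1)).isBddMap fun j => ?_
    obtain ⟨C, i, -, hC⟩ := h2.basis_le j
    refine ⟨C, i, fun l => ?_⟩
    have := hC (1, l)
    rw [homotopy_succ_single]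
    simpa [weight, (inducedLength ε hε.surjective).len_one] using this

end KanLoop

/-! ### A criterion for isomorphisms in homology -/

lemma isIso_homologyMap_of_elements {S₁ S₂ : ShortComplex (ModuleCat.{0} ℚ)} (φ : S₁ ⟶ S₂)
    (hinj : ∀ (x : S₁.X₂) (y : S₂.X₁), S₁.g x = 0 → φ.τ₂ x = S₂.f y → ∃ z, x = S₁.f z)
    (hsurj : ∀ y : S₂.X₂, S₂.g y = 0 → ∃ (x : S₁.X₂) (z : S₂.X₁), S₁.g x = 0 ∧
      y = φ.τ₂ x + S₂.f z) : IsIso (ShortComplex.homologyMap φ) := by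
  -- The criterion by refinements asks for morphisms, while the hypotheses give elements. Covering
  -- `A` by the free module on its underlying set turns arbitrary choices of elements into linear
  -- maps.
  have lift : ∀ {A B : ModuleCat.{0} ℚ} (u : A → B),
      ∃ u' : ModuleCat.of ℚ (A →₀ ℚ) ⟶ B, ∀ a, u' (Finsupp.single a 1) = u a := fun u =>
    ⟨ModuleCat.ofHom (Finsupp.linearCombination ℚ u), fun a => by simp⟩
  have ext : ∀ {A B : ModuleCat.{0} ℚ} {u v : ModuleCat.of ℚ (A →₀ ℚ) ⟶ B},
      (∀ a : A, u (Finsupp.single a 1) = v (Finsupp.single a 1)) → u = v := fun h =>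
    ModuleCat.hom_ext (Finsupp.lhom_ext' fun a => LinearMap.ext_ring (h a))
  have cover : ∀ A : ModuleCat.{0} ℚ, ∃ p : ModuleCat.of ℚ (A →₀ ℚ) ⟶ A,
      Epi p ∧ ∀ a, p (Finsupp.single a 1) = a := fun A => by
    obtain ⟨p, hp⟩ := lift (fun a : A => a)
    exact ⟨p, (ModuleCat.epi_iff_surjective p).2 fun a => ⟨_, hp a⟩, hp⟩
  have : Mono (ShortComplex.homologyMap φ) := by
    rw [ShortComplex.mono_homologyMap_iff_up_to_refinements]
    intro A x hx y hxy
    have h : ∀ a : A, ∃ z, x a = S₁.f z := fun a =>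
      hinj _ (y a) (congrArg (fun u => u a) hx) (congrArg (fun u => u a) hxy)
    choose z hz using h
    obtain ⟨p, hp, hp'⟩ := cover A
    obtain ⟨z', hz'⟩ := lift z
    refine ⟨_, p, hp, z', ext fun a => ?_⟩
    simp [hp', hz', hz]
  have : Epi (ShortComplex.homologyMap φ) := by
    rw [ShortComplex.epi_homologyMap_iff_up_to_refinements]
    intro A y hy
    have h := fun a : A => hsurj (y a) (congrArg (fun u => u a) hy)
    choose x z hx hz using h
    obtain ⟨p, hp, hp'⟩ := cover A
    obtain ⟨z', hz'⟩ := lift z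
    obtain ⟨x', hx'⟩ := lift x
    refine ⟨_, p, hp, x', ext fun a => ?_, z', ext fun a => ?_⟩
    · simp [hx', hx]
    · simp [hp', hx', hz', ← hz]
  exact isIso_of_mono_of_epi _

/-! ### Cochains as equivariant maps on the bar resolution -/

namespace Bar

open FreeRep

variable {G : Type} [Group G]

/-- Matches the recursive faces on lists with the inner terms of the usual inhomogeneous coboundary.
-/
lemma inner_ofFn {k : ℕ} (g : G) (γ : Fin (k + 1) → G) :
    inner G G (Finsupp.single (g, List.ofFn γ) 1) = ∑ j : Fin (k + 1),
      (-1 : ℚ) ^ ((j : ℕ) + 1) • Finsupp.single (g, List.ofFn (j.contractNth (· * ·) γ)) 1 := by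
  induction k with
  | zero => simp [mulHead]
  | succ k ih =>
    have h0 : List.ofFn (Fin.contractNth 0 (· * ·) γ) =
        mulHead (γ 0) (List.ofFn fun i : Fin (k + 1) => γ i.succ) := by
      rw [List.ofFn_succ, List.ofFn_succ]
      simp only [mulHead]
      congr 1
    have hs : ∀ j : Fin (k + 1), List.ofFn (Fin.contractNth j.succ (· * ·) γ) =
        γ 0 :: List.ofFn (Fin.contractNth j (· * ·) fun i => γ i.succ) := fun j => by
      rw [List.ofFn_succ]
      congr 1
      congr 1
      ext i
      simp [Fin.contractNth]
    rw [List.ofFn_succ, inner_cons, ih, Fin.sum_univ_succ (n := k + 1), h0]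
    simp only [hs, map_sum, map_smul, consMap_single, Fin.val_succ, Fin.val_zero, pow_succ]
    simp [sub_eq_add_neg]

end Bar

namespace PSModule

open FreeRep Bar

variable {G : Type} [Group G] {V : Rep.{0} ℚ G}

/-- Equivariance of a linear map from a free module to a representation. -/
def IsEquivariantMap {B : Type} (f : FreeRep G B →ₗ[ℚ] V) : Prop :=
  ∀ g v, f (act g v) = V.ρ g (f v)

/-- The inhomogeneous cochain of a linear map on the bar resolution. -/
def restrict (k : ℕ) (f : FreeRep G (List G) →ₗ[ℚ] V) : (Fin k → G) → V :=
  fun γ => f (Finsupp.single (1, List.ofFn γ) 1)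

/-- The extension of an inhomogeneous cochain to the bar resolution, by zero in the other
degrees. -/
def extendCochain {k : ℕ} (c : (Fin k → G) → V) : FreeRep G (List G) →ₗ[ℚ] V :=
  Finsupp.linearCombination ℚ fun p => if h : p.2.length = k then
    V.ρ p.1 (c fun i => p.2.get (i.cast h.symm)) else 0

lemma extendCochain_ofFn {k : ℕ} (c : (Fin k → G) → V) (g : G) (γ : Fin k → G) :
    extendCochain c (Finsupp.single (g, List.ofFn γ) 1) = V.ρ g (c γ) := by
  simp [extendCochain]

lemma restrict_extendCochain {k : ℕ} (c : (Fin k → G) → V) :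
    restrict k (extendCochain c) = c := by
  ext γ
  simp [restrict, extendCochain_ofFn]

lemma extendCochain_of_ne {k : ℕ} (c : (Fin k → G) → V) (g : G) {l : List G}
    (hl : l.length ≠ k) : extendCochain c (Finsupp.single (g, l) 1) = 0 := by
  simp [extendCochain, hl]

lemma exists_eq_ofFn {k : ℕ} {l : List G} (hl : l.length = k) :
    ∃ γ : Fin k → G, l = List.ofFn γ := by
  subst hl
  exact ⟨l.get, (List.ofFn_get l).symm⟩

lemma extendCochain_equivariant {k : ℕ} (c : (Fin k → G) → V) :
    IsEquivariantMap (extendCochain c) := fun g v => by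
  have : extendCochain c ∘ₗ act g = V.ρ g ∘ₗ extendCochain c := hom_ext fun h l => by
    by_cases hl : l.length = k
    · obtain ⟨γ, rfl⟩ := exists_eq_ofFn hl
      simp [extendCochain_ofFn]
    · simp [extendCochain_of_ne _ _ hl]
  exact LinearMap.congr_fun this v

lemma d_restrict {k : ℕ} {f : FreeRep G (List G) →ₗ[ℚ] V} (hf : IsEquivariantMap f) :
    (inhomogeneousCochains.d V k).hom (restrict k f) =
      restrict (k + 1) (f ∘ₗ bar (MonoidHom.id G)) := by
  ext γ
  rw [inhomogeneousCochains.d_hom_apply]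
  simp only [restrict, LinearMap.comp_apply, bar, LinearMap.add_apply, map_add, inner_ofFn,
    map_sum, map_smul]
  congr 1
  rw [List.ofFn_succ, first_cons, ← hf]
  simp

lemma extendCochain_bar {k : ℕ} (c : (Fin k → G) → V) (v : FreeRep G (List G)) :
    extendCochain c (bar (MonoidHom.id G) v) =
      extendCochain ((inhomogeneousCochains.d V k).hom c) v := by
  have h : extendCochain c ∘ₗ bar (MonoidHom.id G) =
      extendCochain ((inhomogeneousCochains.d V k).hom c) := hom_ext fun g l => by
    by_cases hl : l.length = k + 1
    · obtain ⟨γ, rfl⟩ := exists_eq_ofFn hl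
      have e : Finsupp.single (g, List.ofFn γ) (1 : ℚ) =
          act g (Finsupp.single (1, List.ofFn γ) 1) := by simp
      have h' := congrFun (d_restrict (k := k) (extendCochain_equivariant c)) γ
      rw [restrict_extendCochain] at h'
      rw [extendCochain_ofFn, h', LinearMap.comp_apply, e, bar_equivariant,
        extendCochain_equivariant]
      rfl
    · rw [extendCochain_of_ne _ _ hl, LinearMap.comp_apply]
      match l with
      | [] => rw [bar_nil, map_zero]
      | a :: m =>
        exact deg_ext (φ := extendCochain c) (ψ := 0) (fun g' l' hl' =>
          extendCochain_of_ne c g' (by simp at hl; omega)) (bar_mem_deg _ g rfl)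
  exact LinearMap.congr_fun h v

/-! ### Bounded maps to p-semi-normed modules -/

variable {L : WordLength G} (M : PSModule L)

/-- p-boundedness of a linear map from a free module on a weighted set. -/
def IsBddTo {Ω : Type} (w : Ω → ℕ) (f : (Ω →₀ ℚ) →ₗ[ℚ] M.V) : Prop :=
  ∃ N : ℕ, ∀ x : M.Λ, ∃ C : ℝ, ∀ v, M.η x (f v) ≤ C * wnorm w N v

variable {M}

lemma eta_zero_le (x : M.Λ) : M.η x 0 ≤ 0 := by simpa using M.smul_le x 0 0

lemma IsBddTo.of_basis {Ω : Type} {w : Ω → ℕ} {f : (Ω →₀ ℚ) →ₗ[ℚ] M.V}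
    (h : ∃ N : ℕ, ∀ x : M.Λ, ∃ C : ℝ, ∀ a,
      M.η x (f (Finsupp.single a 1)) ≤ C * (1 + (w a : ℝ)) ^ N) : M.IsBddTo w f := by
  obtain ⟨N, hN⟩ := h
  refine ⟨N, fun x => ?_⟩
  obtain ⟨C, hC⟩ := hN x
  exact ⟨C, seminorm_le_wnorm (M.η x) (eta_zero_le x) (M.add_le x) (M.smul_le x) f hC⟩

lemma IsBddTo.comp {Ω Ω' : Type} {w : Ω → ℕ} {w' : Ω' → ℕ} {f : (Ω' →₀ ℚ) →ₗ[ℚ] M.V}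
    {φ : (Ω →₀ ℚ) →ₗ[ℚ] (Ω' →₀ ℚ)} (hf : M.IsBddTo w' f) (hφ : IsBddMap w w' φ) :
    M.IsBddTo w (f ∘ₗ φ) := by
  obtain ⟨N, hN⟩ := hf
  obtain ⟨D, i, hD0, hD⟩ := hφ N
  refine ⟨i, fun x => ?_⟩
  obtain ⟨C, hC⟩ := hN x
  refine ⟨|C| * D, fun v => (hC _).trans ?_⟩
  have h1 := wnorm_nonneg (w := w') (j := N) (φ v)
  calc C * wnorm w' N (φ v) ≤ |C| * wnorm w' N (φ v) := by gcongr; exact le_abs_self C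
    _ ≤ |C| * (D * wnorm w i v) := by gcongr; exact hD v
    _ = _ := by ring

lemma IsBddTo.sub {Ω : Type} {w : Ω → ℕ} {f g : (Ω →₀ ℚ) →ₗ[ℚ] M.V} (hf : M.IsBddTo w f)
    (hg : M.IsBddTo w g) : M.IsBddTo w (f - g) := by
  obtain ⟨N, hN⟩ := hf
  obtain ⟨N', hN'⟩ := hg
  refine ⟨max N N', fun x => ?_⟩
  obtain ⟨C, hC⟩ := hN x
  obtain ⟨C', hC'⟩ := hN' x
  refine ⟨|C| + |C'|, fun v => ?_⟩
  have h1 := M.smul_le x (-1) (g v)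
  have h2 := M.add_le x (f v) ((-1 : ℚ) • g v)
  have h3 : (f - g) v = f v + (-1 : ℚ) • g v := by simp [sub_eq_add_neg]
  have a1 : M.η x (f v) ≤ |C| * wnorm w (max N N') v :=
    (hC v).trans (mul_le_mul (le_abs_self C) (wnorm_mono (le_max_left _ _) v) (wnorm_nonneg v)
      (abs_nonneg C))
  have a2 : M.η x (g v) ≤ |C'| * wnorm w (max N N') v :=
    (hC' v).trans (mul_le_mul (le_abs_self C') (wnorm_mono (le_max_right _ _) v) (wnorm_nonneg v)
      (abs_nonneg C'))
  rw [h3]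
  simp only [Rat.cast_neg, Rat.cast_one, abs_neg, abs_one, one_mul] at h1
  linarith

/-- This is where orbits of polynomial growth enter: the values on a finite basis have finitely many
exponents, whose sum serves for all of them and for all semi-norms. -/
lemma isBddTo_of_finite {B : Type} [Finite B] {f : FreeRep G B →ₗ[ℚ] M.V}
    (hf : IsEquivariantMap f) (hM : M.HasPolynomialOrbits) (wt : B → ℕ) :
    M.IsBddTo (weight L wt) f := by
  cases nonempty_fintype B
  choose N hN using fun b => hM (f (Finsupp.single (1, b) 1))
  refine .of_basis ⟨∑ b, N b, fun x => ?_⟩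
  choose C hC using fun b => hN b x
  refine ⟨∑ b, |C b|, fun ⟨g, b⟩ => ?_⟩
  have e : Finsupp.single (g, b) (1 : ℚ) = act g (Finsupp.single (1, b) 1) := by simp
  rw [e, hf]
  refine (hC b g).trans ?_
  have h1 : C b ≤ ∑ b, |C b| := (le_abs_self _).trans
    (Finset.single_le_sum (f := fun b => |C b|) (fun _ _ => abs_nonneg _) (Finset.mem_univ b))
  have h2 : N b ≤ ∑ b, N b := Finset.single_le_sum (fun _ _ => Nat.zero_le _) (Finset.mem_univ b)
  have h3 : (1 : ℝ) ≤ 1 + L.len g := by simp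
  have h4 : (1 + L.len g : ℝ) ≤ 1 + (weight L wt (g, b) : ℕ) := by simp [weight]
  refine mul_le_mul h1 ?_ (by positivity) (Finset.sum_nonneg fun _ _ => abs_nonneg _)
  exact (pow_le_pow_right₀ h3 h2).trans (pow_le_pow_left₀ (by positivity) h4 _)

lemma listWeight_ofFn {k : ℕ} (γ : Fin k → G) :
    (listWeight L.len (List.ofFn γ) : ℝ) = k + total L γ := by
  simp [listWeight, List.map_ofFn, List.sum_ofFn, total, Finset.sum_add_distrib]

/-- Moving the action of `g` from the vector into the semi-norm costs `(1 + L g) ^ n`, and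
p-boundedness controls the translated semi-norm. -/
lemma isBddTo_extendCochain {k : ℕ} {c : (Fin k → G) → M.V} (hc : M.IsPBounded c) :
    M.IsBddTo (weight L (listWeight L.len)) (extendCochain c) := by
  obtain ⟨N, hN⟩ := hc
  obtain ⟨D, n, hD⟩ := M.bounded_action
  refine .of_basis ⟨n + N + N, fun x => ?_⟩
  obtain ⟨y, hy⟩ := hD x
  obtain ⟨C, hC⟩ := hN y
  refine ⟨|D| * |C|, fun ⟨g, l⟩ => ?_⟩
  by_cases hl : l.length = k
  · obtain ⟨γ, rfl⟩ := exists_eq_ofFn hl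
    rw [extendCochain_ofFn]
    have h1 := hy 1 g (c γ)
    rw [one_smul, one_mul] at h1
    have h2 := IsPBounded.weaken M hC le_rfl g γ
    have ht := total_nonneg (L := L) γ
    have hg : (0 : ℝ) ≤ L.len g := by positivity
    have hk : (0 : ℝ) ≤ k := by positivity
    set W : ℝ := 1 + (weight L (listWeight L.len) (g, List.ofFn γ) : ℕ) with hW
    have hW' : W = 1 + (L.len g + (k + total L γ)) := by
      rw [hW, ← listWeight_ofFn]; simp [weight]
    have w1 : 1 + (L.len g : ℝ) ≤ W := by linarith
    have w2 : 1 + total L γ ≤ W := by linarith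
    calc M.η x (M.V.ρ g (c γ)) ≤ |D| * (1 + (L.len g : ℝ)) ^ n * M.η (g • y) (c γ) := by
          refine h1.trans ?_
          have := M.nonneg (g • y) (c γ)
          gcongr
          exact le_abs_self D
      _ ≤ |D| * W ^ n * (|C| * W ^ N * W ^ N) := by
          refine mul_le_mul (by gcongr) (h2.trans (by gcongr)) (M.nonneg _ _) ?_
          have : 0 ≤ W := by linarith
          positivity
      _ = _ := by rw [pow_add, pow_add]; ring
  · rw [extendCochain_of_ne _ _ hl]
    exact (eta_zero_le x).trans (by positivity)

lemma IsBddTo.restrict (k : ℕ) {f : FreeRep G (List G) →ₗ[ℚ] M.V} (hf : IsEquivariantMap f)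
    (hb : M.IsBddTo (weight L (listWeight L.len)) f) : M.IsPBounded (restrict k f) := by
  obtain ⟨N, hN⟩ := hb
  obtain ⟨D, n, hD⟩ := M.bounded_action
  refine ⟨n + N, fun x => ?_⟩
  obtain ⟨y, hy⟩ := hD x
  obtain ⟨C, hC⟩ := hN y
  refine ⟨|D| * |C| * (1 + k) ^ N, fun g γ => ?_⟩
  -- Writing the cochain value as `g⁻¹` applied to the value at `(g, γ)` cancels the translation of
  -- the semi-norm index.
  have h1 := hy g g⁻¹ (f (Finsupp.single (g, List.ofFn γ) 1))
  have e : M.V.ρ g⁻¹ (f (Finsupp.single (g, List.ofFn γ) 1)) = PSModule.restrict k f γ := by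
    rw [← hf, act_single, inv_mul_cancel]; rfl
  rw [e, mul_inv_cancel, one_smul, L.len_inv] at h1
  have h2 := hC (Finsupp.single (g, List.ofFn γ) 1)
  rw [wnorm_single] at h2
  simp only [Rat.cast_one, abs_one, one_mul, weight, Nat.cast_add, listWeight_ofFn] at h2
  have ht := total_nonneg (L := L) γ
  have hg : (0 : ℝ) ≤ L.len g := by positivity
  have hk : (0 : ℝ) ≤ k := by positivity
  have h3 : 1 + ((L.len g : ℝ) + (k + total L γ)) ≤
      (1 + k) * (1 + total L γ) * (1 + L.len g) := by
    nlinarith [mul_nonneg hk ht, mul_nonneg hk hg, mul_nonneg ht hg,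
      mul_nonneg (mul_nonneg hk ht) hg]
  calc M.η (g • x) (PSModule.restrict k f γ)
      ≤ |D| * (1 + (L.len g : ℝ)) ^ n * M.η y (f (Finsupp.single (g, List.ofFn γ) 1)) := by
        refine h1.trans ?_
        have := M.nonneg y (f (Finsupp.single (g, List.ofFn γ) 1))
        gcongr
        exact le_abs_self D
    _ ≤ |D| * (1 + (L.len g : ℝ)) ^ n *
        (|C| * ((1 + k) * (1 + total L γ) * (1 + L.len g)) ^ N) := by
        gcongr
        refine h2.trans ?_
        gcongr
        exact le_abs_self C
    _ = |D| * |C| * (1 + k) ^ N * (1 + total L γ) ^ N * (1 + (L.len g : ℝ)) ^ (n + N) := by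
        rw [mul_pow, mul_pow, pow_add]; ring
    _ ≤ _ := by
        have : (1 : ℝ) ≤ 1 + total L γ := by linarith
        gcongr
        omega

/-! ### The comparison map -/

lemma isIso_homologyMap_of_elements {K K' : CochainComplex (ModuleCat.{0} ℚ) ℕ} (φ : K ⟶ K')
    {i j l : ℕ} (hi : (ComplexShape.up ℕ).prev j = i) (hl : (ComplexShape.up ℕ).next j = l)
    (hinj : ∀ (x : K.X j) (y : K'.X i), K.d j l x = 0 → φ.f j x = K'.d i j y →
      ∃ z, x = K.d i j z)
    (hsurj : ∀ y : K'.X j, K'.d j l y = 0 → ∃ (x : K.X j) (z : K'.X i), K.d j l x = 0 ∧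
      y = φ.f j x + K'.d i j z) : IsIso (HomologicalComplex.homologyMap φ j) := by
  subst hi hl
  exact _root_.isIso_homologyMap_of_elements _ hinj hsurj

lemma pComplex_d_apply (k : ℕ) (x : M.pCochains k) :
    (M.pComplex.d k (k + 1) x : M.pCochains (k + 1)).1 =
      (inhomogeneousCochains.d M.V k).hom x.1 := by
  simp only [pComplex, CochainComplex.of_d]
  rfl

end PSModule

namespace PSModule

open FreeRep Bar

variable {G : Type} [Group G] {L : WordLength G} {M : PSModule L}

lemma isBddTo_proj₀ (hM : M.HasPolynomialOrbits) {f : FreeRep G (List G) →ₗ[ℚ] M.V}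
    (hf : IsEquivariantMap f) : M.IsBddTo (weight L (listWeight L.len)) (f ∘ₗ proj₀) := by
  obtain ⟨N, hN⟩ := hM (f (Finsupp.single (1, []) 1))
  refine .of_basis ⟨N, fun x => ?_⟩
  obtain ⟨C, hC⟩ := hN x
  refine ⟨|C|, fun ⟨g, l⟩ => ?_⟩
  cases l with
  | nil =>
    have e : Finsupp.single (g, []) (1 : ℚ) = act g (Finsupp.single (1, ([] : List G)) 1) := by simp
    rw [LinearMap.comp_apply, proj₀_nil, e, hf]
    refine (hC g).trans ?_
    simp only [weight, listWeight_nil, add_zero]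
    gcongr
    exact le_abs_self C
  | cons a l =>
    rw [LinearMap.comp_apply, proj₀_cons, map_zero]
    exact (eta_zero_le x).trans (by positivity)

lemma IsEquivariantMap.comp {V : Rep.{0} ℚ G} {B B' : Type} {f : FreeRep G B' →ₗ[ℚ] V}
    {φ : FreeRep G B →ₗ[ℚ] FreeRep G B'} (hf : IsEquivariantMap f) (hφ : IsEquivariant φ) :
    IsEquivariantMap (f ∘ₗ φ) := fun g v => by
  rw [LinearMap.comp_apply, hφ, hf]; rfl

lemma IsEquivariantMap.sub {V : Rep.{0} ℚ G} {B : Type} {f f' : FreeRep G B →ₗ[ℚ] V}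
    (hf : IsEquivariantMap f) (hf' : IsEquivariantMap f') : IsEquivariantMap (f - f') :=
  fun g v => by simp [hf g v, hf' g v]

lemma d_d {V : Rep.{0} ℚ G} {k : ℕ} (c : (Fin k → G) → V) :
    (inhomogeneousCochains.d V (k + 1)).hom ((inhomogeneousCochains.d V k).hom c) = 0 :=
  congrArg (fun φ => φ.hom c) (groupCohomology.inhomogeneousCochains.d_comp_d (n := k) V)

lemma extendCochain_zero {V : Rep.{0} ℚ G} (k : ℕ) (v : FreeRep G (List G)) :
    extendCochain (0 : (Fin k → G) → V) v = 0 := by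
  have : extendCochain (0 : (Fin k → G) → V) = 0 := hom_ext fun g l => by simp [extendCochain]
  exact LinearMap.congr_fun this v

lemma comparison_isIso_zero (hM : M.HasPolynomialOrbits) : IsIso (M.comparison 0) := by
  have hb : ∀ c : (Fin 0 → G) → M.V, M.IsPBounded c := fun c => by
    have h := isBddTo_proj₀ hM (extendCochain_equivariant c)
    have h' := h.restrict 0 ((extendCochain_equivariant c).comp proj₀_equivariant)
    convert h' using 1
    ext γ
    have := congrFun (restrict_extendCochain c) γ
    simp only [restrict, LinearMap.comp_apply, List.ofFn_zero, proj₀_nil] at this ⊢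
    exact this.symm
  -- In degree zero `prev` returns `0` and the differential `d 0 0` vanishes, so injectivity is that
  -- of the inclusion of cochains; surjectivity uses that all 0-cochains are p-bounded.
  refine isIso_homologyMap_of_elements M.pInclusion (i := 0) (l := 1) (by simp) (by simp) ?_ ?_
  · intro x y _ hxy
    have h0 : (groupCohomology.inhomogeneousCochains M.V).d 0 0 = 0 :=
      HomologicalComplex.shape _ _ _ (by simp)
    rw [h0] at hxy
    exact ⟨0, by rw [map_zero]; exact Subtype.ext hxy⟩
  · intro y hy
    refine ⟨(⟨y, hb y⟩ : M.pCochains 0), 0, ?_, ?_⟩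
    · refine Subtype.ext ((pComplex_d_apply 0 _).trans ?_)
      rw [groupCohomology.inhomogeneousCochains.d_def] at hy
      exact hy
    · rw [map_zero, add_zero]
      rfl

/-- The comparison map is an isomorphism in degree `k + 1` if the bar resolution has a chain
endomorphism improving all equivariant maps in degrees `k` and `k + 1` to bounded ones, and a
homotopy to the identity which is bounded in degree `k`. -/
theorem comparison_isIso_succ (k : ℕ) {Θ Θ' h h' : FreeRep G (List G) →ₗ[ℚ] FreeRep G (List G)}
    (eΘ : IsEquivariant Θ) (eΘ' : IsEquivariant Θ') (eh : IsEquivariant h)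
    (hc : ∀ v, bar (MonoidHom.id G) (Θ v) = Θ' (bar (MonoidHom.id G) v))
    (hh : ∀ v ∈ deg G G (k + 1),
      bar (MonoidHom.id G) (h' v) + h (bar (MonoidHom.id G) v) = Θ v - v)
    (bΘ : ∀ f : FreeRep G (List G) →ₗ[ℚ] M.V, IsEquivariantMap f →
      M.IsBddTo (weight L (listWeight L.len)) (f ∘ₗ Θ))
    (bΘ' : ∀ f : FreeRep G (List G) →ₗ[ℚ] M.V, IsEquivariantMap f →
      M.IsBddTo (weight L (listWeight L.len)) (f ∘ₗ Θ'))
    (bh : IsBddMap (weight L (listWeight L.len)) (weight L (listWeight L.len)) h) :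
    IsIso (M.comparison (k + 1)) := by
  have hdeg : ∀ γ : Fin (k + 1) → G,
      Finsupp.single (1, List.ofFn γ) (1 : ℚ) ∈ deg G G (k + 1) := fun γ => by
    have := single_mem_deg (1 : G) (List.ofFn γ) 1
    rwa [List.length_ofFn] at this
  refine isIso_homologyMap_of_elements M.pInclusion (i := k) (l := k + 2) (by simp) (by simp) ?_ ?_
  · intro x y hx hxy
    obtain ⟨x, hxb⟩ : M.pCochains (k + 1) := x
    have hxy' : x = (inhomogeneousCochains.d M.V k).hom y := by
      rw [groupCohomology.inhomogeneousCochains.d_def] at hxy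
      exact hxy
    have dx : (inhomogeneousCochains.d M.V (k + 1)).hom x = 0 := by rw [hxy', d_d]
    -- Here `x = y ∘ d` with `y` arbitrary. Evaluating `x` on the homotopy equation gives `x ∘ Θ - x
    -- = x ∘ h ∘ d`, and `x ∘ Θ = y ∘ Θ' ∘ d`. So `f` is a p-bounded primitive of `x`.
    let f : FreeRep G (List G) →ₗ[ℚ] M.V := extendCochain y ∘ₗ Θ' - extendCochain x ∘ₗ h
    have ef : IsEquivariantMap f := ((extendCochain_equivariant y).comp eΘ').sub
      ((extendCochain_equivariant x).comp eh)
    have bf : M.IsBddTo (weight L (listWeight L.len)) f :=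
      (bΘ' _ (extendCochain_equivariant y)).sub ((isBddTo_extendCochain hxb).comp bh)
    refine ⟨(⟨restrict k f, bf.restrict k ef⟩ : M.pCochains k),
      Subtype.ext (Eq.trans ?_ (pComplex_d_apply k _).symm)⟩
    rw [d_restrict ef]
    ext γ
    have e := hh _ (hdeg γ)
    have e' := congrArg (extendCochain x) e
    rw [map_add, extendCochain_bar, dx, extendCochain_zero, zero_add, map_sub] at e'
    simp only [restrict, f, LinearMap.comp_apply, LinearMap.sub_apply]
    rw [← hc, extendCochain_bar, ← hxy', e', sub_sub_cancel]
    exact (congrFun (restrict_extendCochain x) γ).symm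
  · intro y hy
    have dy : (inhomogeneousCochains.d M.V (k + 1)).hom y = 0 := by
      rw [groupCohomology.inhomogeneousCochains.d_def] at hy
      exact hy
    -- The representative `y ∘ Θ` is p-bounded even if `y` is not. Its difference from `y` is the
    -- coboundary of `y ∘ h`, which may be unbounded; `h'` enters only through `y ∘ d ∘ h' = 0` and
    -- needs no bound.
    let x := restrict (k + 1) (extendCochain y ∘ₗ Θ)
    have hx : M.IsPBounded x := (bΘ _ (extendCochain_equivariant y)).restrict (k + 1)
      ((extendCochain_equivariant y).comp eΘ)
    let z := restrict k (extendCochain y ∘ₗ h)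
    have hz : (inhomogeneousCochains.d M.V k).hom z = x - y := by
      rw [d_restrict ((extendCochain_equivariant y).comp eh)]
      ext γ
      have e' := congrArg (extendCochain y) (hh _ (hdeg γ))
      rw [map_add, extendCochain_bar, dy, extendCochain_zero, zero_add, map_sub] at e'
      have := congrFun (restrict_extendCochain y) γ
      simp only [restrict, x, LinearMap.comp_apply, Pi.sub_apply] at this ⊢
      rw [e', this]
    have hy' : y = x - (inhomogeneousCochains.d M.V k).hom z := by rw [hz, sub_sub_cancel]
    refine ⟨(⟨x, hx⟩ : M.pCochains (k + 1)), -z, Subtype.ext ((pComplex_d_apply _ _).trans ?_), ?_⟩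
    · have : x = y + (inhomogeneousCochains.d M.V k).hom z := by rw [hz, add_sub_cancel]
      change (inhomogeneousCochains.d M.V (k + 1)).hom x = 0
      rw [this, map_add, dy, d_d, add_zero]
    · rw [groupCohomology.inhomogeneousCochains.d_def, map_neg, ← sub_eq_add_neg]
      exact hy'

end PSModule

/-! ### Resolutions of type `P(m)` and the comparison isomorphism -/

namespace KanLoop

open FreeRep Bar Fox

variable {X : SSet.{0}} {π : Type} [Group π] {ε : Grp X 0 →* π}

theorem isTypeP_of_contraction (hε : IsAugmentation ε) {f : ℕ → ℕ → ℕ}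
    (hf : ∀ m, IsSectionBound X m (f m)) {s : ∀ n, Grp X n → Grp X (n + 1)}
    (hs : ∀ m, IsContraction ε m s) {m : ℕ} (hb : ∀ n < m, IsPolyBounded ε n (s n)) :
    IsTypeP ε m := by
  refine ⟨⟨hε, fun n z hz => ?_⟩, s, hs m, fun n hn => ?_⟩
  -- Exactness is the surjectivity witnessed by the section in degree `n + 1`, whatever the growth
  -- of its bound.
  · obtain ⟨t, ht, -⟩ := hf (n + 1)
    exact ⟨(t ⟨z, hz⟩).1, (t ⟨z, hz⟩).2, ht ⟨z, hz⟩⟩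
  · obtain ⟨C, N, h⟩ := hb n hn
    exact ⟨C, N, fun x hx => by exact_mod_cast h x hx⟩

theorem comparison_isIso_of_contraction [∀ n, Finite (Gen X n)] (hε : IsAugmentation ε)
    {s : ∀ n, Grp X n → Grp X (n + 1)} (hs : ∀ m, IsContraction ε m s)
    {M : PSModule (inducedLength ε hε.surjective)} (hM : M.HasPolynomialOrbits) {k : ℕ}
    (hb : ∀ m, m + 1 < k → IsPolyBounded ε m (s m)) : IsIso (M.comparison k) := by
  have hendo : ∀ p ≤ k, ∀ f : FreeRep π (List π) →ₗ[ℚ] M.V, PSModule.IsEquivariantMap f →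
      M.IsBddTo (weight (inducedLength ε hε.surjective) (listWeight (inducedLength ε hε.surjective).len))
        (f ∘ₗ endo s hε p) := by
    intro p hp f hf
    cases p with
    | zero => exact PSModule.isBddTo_proj₀ hM hf
    | succ p =>
      rw [endo, ← LinearMap.comp_assoc]
      exact (PSModule.isBddTo_of_finite (hf.comp (genToBar_equivariant p)) hM _).comp
        (barToGen_isBddMap hε fun m hm => hb m (by omega))
  cases k with
  | zero => exact PSModule.comparison_isIso_zero hM
  | succ k =>
    exact PSModule.comparison_isIso_succ k (endo_equivariant hε (k + 1)) (endo_equivariant hε k)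
      (homotopy_equivariant hε k) (bar_endo hε hs k)
      (fun v hv => bar_homotopy hε hs k hv) (hendo (k + 1) le_rfl) (hendo k (by omega))
      (homotopy_isBddMap hε fun m hm => hb m (by omega))

end KanLoop

end

theorem theorem2p2p4 (π : Type) [Group π]
    (X : SSet.{0}) (hX₀ : Nonempty (Unique (KanLoop.Simp X 0)))
    (hXfin : ∀ n : ℕ, Finite (KanLoop.Simp X n))
    (hXπ : Nonempty (ContinuousMap.HomotopyEquiv (SSet.toTop.obj X)
      (SSet.toTop.obj (nerve (SingleObj π)))))
    (ε : KanLoop.Grp X 0 →* π) (hε : KanLoop.IsAugmentation ε)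
    (f : ℕ → ℕ → ℕ) (hf : ∀ m, KanLoop.IsDehnFunction X m (f m)) :
    (∀ n : ℕ, (∀ m ≤ n, IsPolynomialType (f m)) →
      KanLoop.IsTypeP ε (n + 1) ∧
      ∀ A : PSModule (inducedLength ε hε.surjective), A.HasPolynomialOrbits →
        ∀ k ≤ n + 2, IsIso (A.comparison k)) ∧
    ((∀ m, IsPolynomialType (f m)) →
      ∀ A : PSModule (inducedLength ε hε.surjective), A.HasPolynomialOrbits →
        ∀ k : ℕ, IsIso (A.comparison k)) := by

  have hfin : ∀ n, Finite (KanLoop.Gen X n) := fun n =>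
    have := hXfin (n + 1)
    inferInstance
  have hsec : ∀ m, KanLoop.IsSectionBound X m (f m) := fun m => (hf m).1
  obtain ⟨s, hs, hb⟩ := KanLoop.exists_contraction hε hsec
  have main : ∀ n : ℕ, (∀ m ≤ n, IsPolynomialType (f m)) →
      KanLoop.IsTypeP ε (n + 1) ∧
      ∀ A : PSModule (inducedLength ε hε.surjective), A.HasPolynomialOrbits →
        ∀ k ≤ n + 2, IsIso (A.comparison k) := fun n hp => by
    have hb' : ∀ m ≤ n, KanLoop.IsPolyBounded ε m (s m) := fun m hm =>
      hb m fun i hi => hp i (by omega)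
    exact ⟨KanLoop.isTypeP_of_contraction hε hsec hs fun m hm => hb' m (by omega),
      fun A hA k hk => KanLoop.comparison_isIso_of_contraction hε hs hA fun m hm =>
        hb' m (by omega)⟩
  -- For degree `k` the first part with `n = k` is more than enough.
  exact ⟨main, fun hp A hA k => (main k fun m _ => hp m).2 A hA k (by omega)⟩
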